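/- Let $N>0$ and $\lambda>0$, let $T_N=\{z\in\mathbb C:\operatorname{Im} z>0\}/(z\sim z+2\pi N)$ be the cylinder with boundary circle $\mathbb T_N=\mathbb R/2\pi N\mathbb Z$, and put $\delta=1-\frac{2}{1+e^{\lambda/N}}$, $\phi_\delta(z)=\sqrt{z^2(1-\delta^2)-\delta^2}$ (the conformal map of the upper half plane $\mathbb H$ onto $\mathbb H\setminus[0,i\delta]$) and $F_N(z)=\tan\frac{z}{2N}$. The slit map $S=F_N^{-1}\circ\phi_\delta\circ F_N$ attaches to $\mathbb T_N$ a slit of length $\lambda$ at $0$, and $S_x(z)=S(z-x)+x$ attaches it at $x\in\mathbb T_N$; both are extended continuously to $\mathbb T_N$. Let $\{(t_1,x_1),(t_2,x_2),\dots\}$, $t_1<t_2<\cdots$, be a Poisson point process of intensity $1$ on $(0,\infty)\times\mathbb T_N$. The cylindrical Hastings–Levitov(0) process with particles of size $\lambda$ is $\mathcal C_t=S_{x_1}\circ\cdots\circ S_{x_n}$ for $t_n\le t<t_{n+1}$ (with $t_0=0$, $\mathcal C_t=\mathrm{id}$ for $t<t_1$). Its trees at time $t$ are the connected components of $\mathcal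 C_t(\mathbb T_N)\setminus\mathbb T_N$, and the particle arriving at time $t_n$, which is the set $\mathcal C_{t_{n-1}}\big((x_n,x_n+i\lambda]\big)$, is received by the tree that contains it at time $t_n$; trees are followed in time as they grow. Theorem. Almost surely exactly one tree receives infinitely many particles. Let $\upsilon_{N,\lambda}$, the one-arm domination time, be the last time at which a tree different from this infinite one receives a particle ($\upsilon_{N,\lambda}=0$ if there is no such time, $\upsilon_{N,\lambda}=\infty$ if there is no last one). For every $\Lambda>0$ there are constants $C_1,C_2,C_3,C_4>0$, depending only on $\Lambda$, such that for all $N>0$, all $0<\lambda\le\Lambda N$ and all $t>0$, $$C_3\,e^{-C_4t}\le\mathbb P\big(\upsilon_{N,\lambda}>\lambda^{-3}N^2t\big)\le C_1\,e^{-C_2t}.$$ In particular, for fixed $\lambda$ the constants do not depend on $N\ge1$, and they can be chosen independently of $\lambda$ as well if only $N\ge\lambda$ is considered. -/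

import Mathlib

open MeasureTheory

noncomputable section

namespace CHL

/-- The cylinder `ℂ / (z ∼ z + 2πN)`.  Its part `Im z > 0` is the cylinder on which the process
lives; the circle `Im z = 0` is the boundary of that part. -/
abbrev Cyl (N : ℝ) : Type := ℂ ⧸ AddSubgroup.zmultiples ((2 * Real.pi * N : ℝ) : ℂ)

/-- The boundary circle `Im z = 0` of the cylinder. -/
def boundary (N : ℝ) : Set (Cyl N) := Set.range fun a : ℝ => (((a : ℂ)) : Cyl N)

/-- The parameter `δ(N, λ) = 1 - 2 / (1 + e^{λ/N})`. -/
def delta (N lam : ℝ) : ℝ := 1 - 2 / (1 + Real.exp (lam / N))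

/-- The map `φ_δ(z) = √(z² (1 - δ²) - δ²)` from the upper half plane onto the upper half plane
slit along `[0, iδ]`, together with its continuous extension to the real line.

Factoring the radicand as `(az - δ)(az + δ)` with `a = √(1 - δ²)` and taking the principal root
of each factor selects, for `Im z > 0`, the root with positive imaginary part, and at real points
the boundary value from above. -/
def phi (δ : ℝ) (z : ℂ) : ℂ :=
  Complex.sqrt ((Real.sqrt (1 - δ ^ 2) : ℂ) * z - δ) *
    Complex.sqrt ((Real.sqrt (1 - δ ^ 2) : ℂ) * z + δ)

/-- The slit map `F_N⁻¹ ∘ φ_δ ∘ F_N`, where `F_N(z) = tan (z / (2N))`, on representatives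
`z` with `Im z ≥ 0`; the value matters only modulo `2πN`.  At the pole of `F_N` on the boundary,
`z ≡ πN`, where `F_N(z) = ∞` and `φ_δ(∞) = ∞`, the value is `πN`. -/
def slitLift (N δ : ℝ) (z : ℂ) : ℂ :=
  if Complex.cos (z / (2 * N)) = 0 then (Real.pi * N : ℝ)
  else 2 * N * Complex.arctan (phi δ (Complex.tan (z / (2 * N))))

theorem slitLift_periodic (N δ : ℝ) :
    Function.Periodic (slitLift N δ) ((2 * Real.pi * N : ℝ) : ℂ) := by
  intro z
  rcases eq_or_ne N 0 with rfl | hN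
  · simp
  · have hN' : (N : ℂ) ≠ 0 := by exact_mod_cast hN
    have h : (z + ((2 * Real.pi * N : ℝ) : ℂ)) / (2 * N) = z / (2 * N) + Real.pi := by
      push_cast
      field_simp
    simp only [slitLift, h, Complex.tan_periodic (z / (2 * N)),
      Complex.cos_antiperiodic (z / (2 * N)), neg_eq_zero]

/-- The slit map `S^{N,δ}` on the (closed upper) cylinder. -/
def slitMap (N δ : ℝ) (z : Cyl N) : Cyl N := (((slitLift_periodic N δ).lift z : ℂ) : Cyl N)

/-- The slit map `S_x^{N,δ}`, attaching a slit above the boundary point `x`: the conjugate of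
`S^{N,δ}` by the rotation taking `0` to `x`. -/
def slitMapAt (N δ x : ℝ) (z : Cyl N) : Cyl N :=
  slitMap N δ (z - ((x : ℂ) : Cyl N)) + ((x : ℂ) : Cyl N)

/-- The CHL map after the first `n` particles, at positions `x 0, …, x (n - 1)`:
`S_{x 0} ∘ S_{x 1} ∘ ⋯ ∘ S_{x (n - 1)}`.  If the particles arrive at the times
`t 0 < t 1 < ⋯`, it is the CHL map at every time in `[t (n - 1), t n)`. -/
def chl (N lam : ℝ) (x : ℕ → ℝ) : ℕ → Cyl N → Cyl N
  | 0 => id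
  | n + 1 => chl N lam x n ∘ slitMapAt N (delta N lam) (x n)

/-- The union of all trees after `n` particles: the image of the boundary circle under the CHL
map, minus the boundary circle.  The trees are its connected components. -/
def cluster (N lam : ℝ) (x : ℕ → ℝ) (n : ℕ) : Set (Cyl N) :=
  chl N lam x n '' boundary N \ boundary N

/-- The particle `n`, as a subset of the cylinder: the image of the slit `(x n, x n + iλ]` under
the CHL map at the time just before its arrival. -/
def particle (N lam : ℝ) (x : ℕ → ℝ) (n : ℕ) : Set (Cyl N) :=
  chl N lam x n ''
    ((fun s : ℝ => ((x n + s * Complex.I : ℂ) : Cyl N)) '' Set.Ioc 0 lam)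

/-- `Θ` is a tree (a connected component of the cluster) after `n` particles. -/
def IsTree (N lam : ℝ) (x : ℕ → ℝ) (n : ℕ) (Θ : Set (Cyl N)) : Prop :=
  ∃ p ∈ cluster N lam x n, Θ = connectedComponentIn (cluster N lam x n) p

/-- The particles `i` and `j` have been received by the same tree: at some step both of them are
parts of one tree.  (Trees grow with time, and distinct trees never merge.) -/
def SameTree (N lam : ℝ) (x : ℕ → ℝ) (i j : ℕ) : Prop :=
  ∃ n, i < n ∧ j < n ∧
    ∃ Θ, IsTree N lam x n Θ ∧ particle N lam x i ⊆ Θ ∧ particle N lam x j ⊆ Θ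

/-- The tree that receives the particle `i` receives infinitely many particles in total. -/
def InInfiniteTree (N lam : ℝ) (x : ℕ → ℝ) (i : ℕ) : Prop :=
  {j | SameTree N lam x i j}.Infinite

/-- There is one and only one tree that receives infinitely many particles. -/
def UniqueInfiniteTree (N lam : ℝ) (x : ℕ → ℝ) : Prop :=
  (∃ i, InInfiniteTree N lam x i) ∧
    ∀ i j, InInfiniteTree N lam x i → InInfiniteTree N lam x j → SameTree N lam x i j

/-- The one-arm domination time: the last time at which a tree different from the infinite one
receives a particle, when the particle `n` arrives at time `t n` at position `x n`.  It is `0` if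
no finite tree ever receives a particle and `∞` if there is no last such time. -/
def dominationTime (N lam : ℝ) (t x : ℕ → ℝ) : ENNReal :=
  ⨆ n, ⨆ _ : ¬ InInfiniteTree N lam x n, ENNReal.ofReal (t n)

/-- The random points `p 0, p 1, …` form a Poisson point process with intensity measure `ν`: the
numbers of points in finitely many pairwise disjoint sets `B i` of finite measure are independent
Poisson variables with means `ν (B i)`. -/
structure IsPoissonPointProcess {Ω E : Type*} [MeasurableSpace Ω] [MeasurableSpace E]
    (p : ℕ → Ω → E) (ν : Measure E) (μ : Measure Ω) : Prop where
  measurable : ∀ n, Measurable (p n)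
  count_law : ∀ (m : ℕ) (B : Fin m → Set E), (∀ i, MeasurableSet (B i)) →
    (∀ i j, i ≠ j → Disjoint (B i) (B j)) → (∀ i, ν (B i) ≠ ⊤) → ∀ k : Fin m → ℕ,
      μ {ω | ∀ i, {n | p n ω ∈ B i}.encard = k i} =
        ∏ i, ProbabilityTheory.poissonMeasure (ν (B i)).toNNReal {k i}

/-- Intensity one on `(0, ∞) × 𝕋_N`, with the circle `𝕋_N` of length `2πN` written as the interval
`(0, 2πN]`. -/
def intensity (N : ℝ) : Measure (ℝ × ℝ) :=
  volume.restrict (Set.Ioi 0 ×ˢ Set.Ioc 0 (2 * Real.pi * N))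

/-- The points `(t n, x n)` form a Poisson point process of intensity one on `(0, ∞) × 𝕋_N`, listed
in the order of their times. -/
structure IsDrivingProcess {Ω : Type*} [MeasurableSpace Ω] (N : ℝ) (t x : ℕ → Ω → ℝ)
    (μ : Measure Ω) : Prop where
  poisson : IsPoissonPointProcess (fun n ω => (t n ω, x n ω)) (intensity N) μ
  ordered : ∀ᵐ ω ∂μ, StrictMono fun n => t n ω

end CHL

end

/-!
Two particles belong to the same tree if and only if their trees are attached at the same point of
the boundary circle, so the theorem becomes a statement about the feet of the trees.  Collapse every
tree to its foot.  In the coordinate `x / (2N)`, in which the circle is `ℝ / πℤ`, the slit map then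
acts on the circle by `inMap β`, where `sin β = δ`: the arc `[-β, β]` is collapsed to the point `0`.
The angle `β` is of order `λ / N` (`exists_angle`).  The foot of the particle `n` is its position
pulled back by the first `n` of these maps, and it lies in an arc `[a, b)` if and only if the
particle arrives in the arc whose end points are `a` and `b`, moved by the adjoint maps `outMap β`
(`hit_iff`).  Hence trees with feet in `[a, b)` and trees with feet in the complement compete through
a single Markov chain, the length `q` of the moving arc, which is the harmonic measure, up to the
factor `π`, of the part of the picture above `[a, b)`.

One uniform particle does not change the expected value of `q`, and the variance of the change is at
least `c β³` times the balance `q (π - q)` (`balance_le_variance`).  So the expected balance decays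
like `exp (-c β³ n)` (`integral_balance_len_le`).  An arc that receives a particle has a length of at
least `2β` afterwards, which gives a maximal inequality for the martingale `q`
(`real_exists_hit_le`); together they bound the probability that both the arc and its complement
receive particles after the particle `2n` (`real_bothHit_two_mul_le`).  This bound is linear in
`b - a`, so the union bound over a partition of the circle into small arcs does not depend on the
mesh, and letting the mesh tend to `0` shows that all feet agree from the particle `2n` on, up to a
probability of order `exp (-c β³ n) / (β³ n)` (`seqMeasure_exists_foot_ne_le`).

Conversely, the variance is at most `64 β³`, and the expected squared balance decays at most like
`exp (-C β³ m)` (`exists_le_integral_balance_sq`).  An arc and its complement that both have a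
macroscopic length exchange consecutive particles with positive probability, so two different trees
receive the particles `m` and `m + 1` with a probability of at least `c exp (-C β³ m)`
(`exists_le_real_switch`).

The geometric input is `sameTree_iff`.  The maps of the process are injective in the interior of the
cylinder, so particles are disjoint; they are continuous up to the boundary, so each particle is
connected and its closure contains the point at which it is attached, which lies on the boundary
circle or on a particle with the same foot.  Unions of particles with a common foot are therefore
connected, and they are relatively closed in the cluster.  This needs that no position is pulled
back to an end point of a collapsed arc, which holds almost surely (`ae_regular`).

Finally, the positions of a Poisson process are independent and uniform, and independent of the
number of particles up to a fixed time (`real_coords_mem`).  That number is a Poisson variable whose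
mean at the time `λ⁻³ N² s` is `2π s (λ / N)⁻³`, so `β³` times the number of particles is of order
`s`, and the two estimates turn into the exponential bounds (`real_lt_dominationTime_le`,
`le_real_lt_dominationTime`).
-/

noncomputable section

namespace CHL

/-! ### The maps of the boundary circle -/

/-- The lift to `ℝ` of the map that a slit map induces on the boundary circle once the slit is
collapsed to its base point `0`.  The coordinate is `x / (2N)`, so the circle has length `π`; the
arc `[-β, β]` is the part of the circle that is mapped into the slit.  (`Real.arccos` is constant
outside `[-1, 1]`, which does the collapsing.) -/
def inMap (β u : ℝ) : ℝ :=
  Real.arccos (Real.cos (toIcoMod Real.pi_pos 0 u) / Real.cos β) +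
    toIcoDiv Real.pi_pos 0 u * Real.pi

/-- The lower adjoint of `inMap`, the lift of the motion of the end points of arcs: it pushes the
points of the circle away from `0`, out of the arc `[-β, β]`. -/
def outMap (β u : ℝ) : ℝ :=
  Real.arccos (Real.cos β * Real.cos (toIocMod Real.pi_pos 0 u)) +
    toIocDiv Real.pi_pos 0 u * Real.pi

theorem inMap_add_int_mul_pi (β u : ℝ) (k : ℤ) :
    inMap β (u + k * Real.pi) = inMap β u + k * Real.pi := by
  have h1 := toIcoMod_add_zsmul Real.pi_pos 0 u k
  have h2 := toIcoDiv_add_zsmul Real.pi_pos 0 u k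
  rw [zsmul_eq_mul] at h1 h2
  rw [inMap, inMap, h1, h2]
  push_cast
  ring

theorem outMap_add_int_mul_pi (β u : ℝ) (k : ℤ) :
    outMap β (u + k * Real.pi) = outMap β u + k * Real.pi := by
  have h1 := toIocMod_add_zsmul Real.pi_pos 0 u k
  have h2 := toIocDiv_add_zsmul Real.pi_pos 0 u k
  rw [zsmul_eq_mul] at h1 h2
  rw [outMap, outMap, h1, h2]
  push_cast
  ring

theorem inMap_of_mem {β u : ℝ} (hu : u ∈ Set.Ico 0 Real.pi) :
    inMap β u = Real.arccos (Real.cos u / Real.cos β) := by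
  have h : toIcoMod Real.pi_pos 0 u = u := (toIcoMod_eq_self Real.pi_pos).2 (by simpa using hu)
  have h' : toIcoDiv Real.pi_pos 0 u = 0 := by
    have := toIcoMod_add_toIcoDiv_zsmul Real.pi_pos 0 u
    rw [h, zsmul_eq_mul] at this
    have h0 : (toIcoDiv Real.pi_pos 0 u : ℝ) * Real.pi = 0 := by linarith
    rcases mul_eq_zero.1 h0 with h0 | h0
    · exact_mod_cast h0
    · exact absurd h0 Real.pi_ne_zero
  rw [inMap, h, h']
  simp

theorem outMap_of_mem {β u : ℝ} (hu : u ∈ Set.Ioc 0 Real.pi) :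
    outMap β u = Real.arccos (Real.cos β * Real.cos u) := by
  have h : toIocMod Real.pi_pos 0 u = u := (toIocMod_eq_self Real.pi_pos).2 (by simpa using hu)
  have h' : toIocDiv Real.pi_pos 0 u = 0 := by
    have := toIocMod_add_toIocDiv_zsmul Real.pi_pos 0 u
    rw [h, zsmul_eq_mul] at this
    have h0 : (toIocDiv Real.pi_pos 0 u : ℝ) * Real.pi = 0 := by linarith
    rcases mul_eq_zero.1 h0 with h0 | h0
    · exact_mod_cast h0
    · exact absurd h0 Real.pi_ne_zero
  rw [outMap, h, h']
  simp

theorem exists_add_int_mul_pi_mem_Ico (u : ℝ) : ∃ k : ℤ, u + k * Real.pi ∈ Set.Ico 0 Real.pi := by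
  obtain ⟨k, hk, -⟩ := existsUnique_add_zsmul_mem_Ico Real.pi_pos u 0
  exact ⟨k, by simpa using hk⟩

theorem exists_add_int_mul_pi_mem_Ioc (u : ℝ) : ∃ k : ℤ, u + k * Real.pi ∈ Set.Ioc 0 Real.pi := by
  obtain ⟨k, hk, -⟩ := existsUnique_add_zsmul_mem_Ioc Real.pi_pos u 0
  exact ⟨k, by simpa using hk⟩

theorem cos_pos_of_mem {β : ℝ} (hβ : β ∈ Set.Ioo 0 (Real.pi / 2)) : 0 < Real.cos β :=
  Real.cos_pos_of_mem_Ioo ⟨by linarith [hβ.1, Real.pi_pos], hβ.2⟩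

theorem cos_lt_one_of_mem {β : ℝ} (hβ : β ∈ Set.Ioo 0 (Real.pi / 2)) : Real.cos β < 1 := by
  have := Real.cos_lt_cos_of_nonneg_of_le_pi_div_two le_rfl hβ.2.le hβ.1
  simpa using this

theorem inMap_zero {β : ℝ} (hβ : β ∈ Set.Ioo 0 (Real.pi / 2)) : inMap β 0 = 0 := by
  rw [inMap_of_mem ⟨le_rfl, Real.pi_pos⟩, Real.cos_zero, Real.arccos_eq_zero]
  rw [le_div_iff₀ (cos_pos_of_mem hβ)]
  linarith [cos_lt_one_of_mem hβ]

theorem outMap_pi {β : ℝ} (hβ : β ∈ Set.Ioo 0 (Real.pi / 2)) :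
    outMap β Real.pi = Real.pi - β := by
  rw [outMap_of_mem ⟨Real.pi_pos, le_rfl⟩, Real.cos_pi, mul_neg_one, Real.arccos_neg,
    Real.arccos_cos hβ.1.le (by linarith [hβ.2, Real.pi_pos])]

theorem le_arccos_iff {A z : ℝ} (hA : A ∈ Set.Ioc 0 Real.pi) :
    A ≤ Real.arccos z ↔ z ≤ Real.cos A := by
  constructor
  · intro h
    by_contra! hz
    rcases le_or_gt z 1 with h1 | h1
    · have := Real.cos_le_cos_of_nonneg_of_le_pi hA.1.le (Real.arccos_le_pi z) h
      rw [Real.cos_arccos (by linarith [Real.neg_one_le_cos A]) h1] at this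
      linarith
    · rw [Real.arccos_of_one_le h1.le] at h
      linarith [hA.1]
  · intro h
    have := Real.arccos_le_arccos h
    rwa [Real.arccos_cos hA.1.le hA.2] at this

theorem arccos_le_iff {y z : ℝ} (hy : y ∈ Set.Ico 0 Real.pi) :
    Real.arccos z ≤ y ↔ Real.cos y ≤ z := by
  constructor
  · intro h
    by_contra! hz
    rcases le_or_gt (-1) z with h1 | h1
    · have := Real.cos_le_cos_of_nonneg_of_le_pi (Real.arccos_nonneg z) hy.2.le h
      rw [Real.cos_arccos h1 (by linarith [Real.cos_le_one y])] at this
      linarith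
    · rw [Real.arccos_of_le_neg_one h1.le] at h
      linarith [hy.2]
  · intro h
    have := Real.arccos_le_arccos h
    rwa [Real.arccos_cos hy.1 hy.2.le] at this

theorem beta_le_outMap {β u : ℝ} (hβ : β ∈ Set.Ioo 0 (Real.pi / 2)) (hu : u ∈ Set.Ioc 0 Real.pi) :
    β ≤ outMap β u := by
  rw [outMap_of_mem hu, le_arccos_iff ⟨hβ.1, by linarith [hβ.2, Real.pi_pos]⟩]
  nlinarith [cos_pos_of_mem hβ, Real.cos_le_one u]

theorem outMap_le_sub {β u : ℝ} (hβ : β ∈ Set.Ioo 0 (Real.pi / 2)) (hu : u ∈ Set.Ioc 0 Real.pi) :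
    outMap β u ≤ Real.pi - β := by
  rw [outMap_of_mem hu, arccos_le_iff ⟨by linarith [hβ.2, Real.pi_pos], by linarith [hβ.1]⟩,
    Real.cos_pi_sub]
  nlinarith [cos_pos_of_mem hβ, Real.neg_one_le_cos u]

theorem inMap_nonpos {β y : ℝ} (hβ : β ∈ Set.Ioo 0 (Real.pi / 2)) (hy : y ≤ 0) :
    inMap β y ≤ 0 := by
  rcases hy.eq_or_lt with rfl | hy
  · rw [inMap_zero hβ]
  obtain ⟨k, hk⟩ := exists_add_int_mul_pi_mem_Ico y
  have hk1 : (1 : ℝ) ≤ k := by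
    have : (0 : ℝ) < k := by
      by_contra! h
      nlinarith [hk.1, Real.pi_pos]
    exact_mod_cast this
  have := inMap_add_int_mul_pi β y k
  rw [inMap_of_mem hk] at this
  nlinarith [Real.arccos_le_pi (Real.cos (y + k * Real.pi) / Real.cos β), Real.pi_pos]

theorem pi_le_inMap {β y : ℝ} (hy : Real.pi ≤ y) : Real.pi ≤ inMap β y := by
  obtain ⟨k, hk⟩ := exists_add_int_mul_pi_mem_Ico y
  have hk1 : (k : ℝ) ≤ -1 := by
    have : (k : ℝ) < 0 := by
      by_contra! h
      nlinarith [hk.2, Real.pi_pos]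
    have h2 : k < 0 := by exact_mod_cast this
    exact_mod_cast (show k ≤ -1 by omega)
  have := inMap_add_int_mul_pi β y k
  rw [inMap_of_mem hk] at this
  nlinarith [Real.arccos_nonneg (Real.cos (y + k * Real.pi) / Real.cos β), Real.pi_pos]

/-- The motion of the end points of arcs is adjoint to the collapsed boundary map. -/
theorem gc_outMap_inMap {β : ℝ} (hβ : β ∈ Set.Ioo 0 (Real.pi / 2)) :
    GaloisConnection (outMap β) (inMap β) := by
  have key : ∀ A ∈ Set.Ioc 0 Real.pi, ∀ y, outMap β A ≤ y ↔ A ≤ inMap β y := by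
    intro A hA y
    rcases le_or_gt y 0 with hy | hy
    · have h1 := beta_le_outMap hβ hA
      have h2 := inMap_nonpos hβ hy
      constructor
      · intro h; linarith [hβ.1]
      · intro h; linarith [hA.1]
    rcases le_or_gt Real.pi y with hy' | hy'
    · have h1 := outMap_le_sub hβ hA
      have h2 := pi_le_inMap (β := β) hy'
      constructor
      · intro h; linarith [hA.2]
      · intro h; linarith [hβ.1]
    rw [outMap_of_mem hA, inMap_of_mem ⟨hy.le, hy'⟩, arccos_le_iff ⟨hy.le, hy'⟩, le_arccos_iff hA,
      div_le_iff₀ (cos_pos_of_mem hβ), mul_comm]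
  intro A y
  obtain ⟨k, hk⟩ := exists_add_int_mul_pi_mem_Ioc A
  have := key _ hk (y + k * Real.pi)
  rw [outMap_add_int_mul_pi, inMap_add_int_mul_pi] at this
  simpa using this

/-- The displacement of an arc end point at distance `u` from the particle. -/
def disp (β u : ℝ) : ℝ := outMap β u - u

theorem disp_add_int_mul_pi (β u : ℝ) (k : ℤ) : disp β (u + k * Real.pi) = disp β u := by
  rw [disp, disp, outMap_add_int_mul_pi]
  ring

theorem disp_periodic (β : ℝ) : Function.Periodic (disp β) Real.pi := by
  intro u
  simpa using disp_add_int_mul_pi β u 1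

theorem disp_of_mem {β u : ℝ} (hu : u ∈ Set.Ioc 0 Real.pi) :
    disp β u = Real.arccos (Real.cos β * Real.cos u) - u := by
  rw [disp, outMap_of_mem hu]

theorem disp_pi_sub {β u : ℝ} (hu : u ∈ Set.Ioo 0 Real.pi) :
    disp β (Real.pi - u) = -disp β u := by
  rw [disp_of_mem ⟨hu.1, hu.2.le⟩, disp_of_mem ⟨by linarith [hu.2], by linarith [hu.1]⟩,
    Real.cos_pi_sub, mul_neg, Real.arccos_neg]
  ring

theorem disp_nonneg {β u : ℝ} (hβ : β ∈ Set.Ioo 0 (Real.pi / 2))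
    (hu : u ∈ Set.Ioc 0 (Real.pi / 2)) : 0 ≤ disp β u := by
  have hu' : u ∈ Set.Ioc 0 Real.pi := ⟨hu.1, by linarith [hu.2, Real.pi_pos]⟩
  rw [disp_of_mem hu', sub_nonneg, le_arccos_iff hu']
  have : 0 ≤ Real.cos u := Real.cos_nonneg_of_mem_Icc ⟨by linarith [hu.1, Real.pi_pos], hu.2⟩
  nlinarith [cos_lt_one_of_mem hβ]

theorem sub_le_disp {β u : ℝ} (hβ : β ∈ Set.Ioo 0 (Real.pi / 2))
    (hu : u ∈ Set.Ioc 0 Real.pi) : β - u ≤ disp β u := by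
  rw [disp]
  linarith [beta_le_outMap hβ hu]

/-- The displacement decays like `β ^ 2 / u` away from the particle. -/
theorem disp_mul_le {β u : ℝ} (hβ : β ∈ Set.Ioo 0 (Real.pi / 2))
    (hu : u ∈ Set.Ioc 0 (Real.pi / 2)) :
    disp β u * (disp β u + 2 * u) ≤ 3 * Real.pi ^ 2 / 4 * β ^ 2 := by
  have hpi := Real.pi_pos
  have hu' : u ∈ Set.Ioc 0 Real.pi := ⟨hu.1, by linarith [hu.2, Real.pi_pos]⟩
  have hd := disp_nonneg hβ hu
  have hle : outMap β u ≤ Real.pi := by linarith [outMap_le_sub hβ hu', hβ.1]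
  have hcos : Real.cos (outMap β u) = Real.cos β * Real.cos u := by
    rw [outMap_of_mem hu', Real.cos_arccos]
    · nlinarith [cos_pos_of_mem hβ, cos_lt_one_of_mem hβ, Real.neg_one_le_cos u]
    · nlinarith [cos_pos_of_mem hβ, cos_lt_one_of_mem hβ, Real.cos_le_one u]
  have hcu : 0 ≤ Real.cos u := Real.cos_nonneg_of_mem_Icc ⟨by linarith [hu.1, Real.pi_pos], hu.2⟩
  have h1 : Real.cos u - Real.cos (outMap β u) ≤ β ^ 2 / 2 := by
    rw [hcos]
    have := Real.one_sub_sq_div_two_le_cos (x := β)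
    nlinarith [Real.cos_le_one u, cos_lt_one_of_mem hβ]
  set h := outMap β u with hh
  have hdh : disp β u = h - u := rfl
  rw [hdh] at hd ⊢
  have h2 : Real.cos u - Real.cos h =
      2 * Real.sin ((h + u) / 2) * Real.sin ((h - u) / 2) := by
    have := Real.cos_sub_cos u h
    rw [this, show (u - h) / 2 = -((h - u) / 2) by ring, Real.sin_neg, add_comm u h]
    ring
  have hpq : ∀ x, 0 ≤ x → x ≤ 3 * Real.pi / 4 → 2 / Real.pi * (x / 3) ≤ Real.sin x := by
    intro x hx0 hx1
    rcases le_or_gt x (Real.pi / 2) with h | h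
    · have := Real.mul_le_sin hx0 h
      have h0 : 0 ≤ 2 / Real.pi * x := by positivity
      linarith
    · have := Real.mul_le_sin (x := Real.pi - x) (by linarith) (by linarith)
      rw [Real.sin_pi_sub] at this
      refine le_trans ?_ this
      gcongr
      linarith
  have h3 := hpq ((h + u) / 2) (by linarith [hu.1]) (by linarith [hu.2])
  have h4 := Real.mul_le_sin (x := (h - u) / 2) (by linarith) (by linarith [hu.1])
  have h5 : 2 * (2 / Real.pi * ((h + u) / 2 / 3)) * (2 / Real.pi * ((h - u) / 2)) ≤
      2 * Real.sin ((h + u) / 2) * Real.sin ((h - u) / 2) := by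
    have hs : 0 ≤ 2 / Real.pi * ((h - u) / 2) := by positivity
    have hs' : 0 ≤ 2 / Real.pi * ((h + u) / 2 / 3) := by
      have : 0 ≤ h + u := by linarith [hu.1]
      positivity
    gcongr
    linarith
  rw [← h2] at h5
  have h6 : 2 * (2 / Real.pi * ((h + u) / 2 / 3)) * (2 / Real.pi * ((h - u) / 2)) =
      2 / 3 * (h + u) * (h - u) / Real.pi ^ 2 := by
    field_simp
  rw [h6, div_le_iff₀ (by positivity)] at h5
  nlinarith [sq_nonneg Real.pi]

theorem monotone_outMap {β : ℝ} (hβ : β ∈ Set.Ioo 0 (Real.pi / 2)) : Monotone (outMap β) :=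
  (gc_outMap_inMap hβ).monotone_l

theorem measurable_outMap {β : ℝ} (hβ : β ∈ Set.Ioo 0 (Real.pi / 2)) : Measurable (outMap β) :=
  (monotone_outMap hβ).measurable

theorem measurable_disp {β : ℝ} (hβ : β ∈ Set.Ioo 0 (Real.pi / 2)) : Measurable (disp β) :=
  (measurable_outMap hβ).sub measurable_id

theorem abs_disp_le {β : ℝ} (hβ : β ∈ Set.Ioo 0 (Real.pi / 2)) (u : ℝ) :
    |disp β u| ≤ β := by
  have key : ∀ u ∈ Set.Ioc 0 (Real.pi / 2), |disp β u| ≤ β := by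
    intro u hu
    have hu' : u ∈ Set.Ioc 0 Real.pi := ⟨hu.1, by linarith [hu.2, Real.pi_pos]⟩
    rw [abs_of_nonneg (disp_nonneg hβ hu), disp_of_mem hu', sub_le_iff_le_add]
    rcases le_or_gt Real.pi (β + u) with h | h
    · exact (Real.arccos_le_pi _).trans h
    rw [arccos_le_iff ⟨by linarith [hβ.1, hu.1], h⟩, Real.cos_add]
    have := Real.sin_nonneg_of_nonneg_of_le_pi hu'.1.le hu'.2
    have := Real.sin_nonneg_of_nonneg_of_le_pi hβ.1.le (by linarith [hβ.2, Real.pi_pos])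
    nlinarith
  obtain ⟨k, hk⟩ := exists_add_int_mul_pi_mem_Ioc u
  rw [← disp_add_int_mul_pi β u k]
  rcases le_or_gt (u + k * Real.pi) (Real.pi / 2) with h | h
  · exact key _ ⟨hk.1, h⟩
  rcases hk.2.eq_or_lt with h' | h'
  · rw [h', disp, outMap_pi hβ]
    simp [abs_of_pos hβ.1]
  · have := disp_pi_sub (β := β) (u := Real.pi - (u + k * Real.pi)) ⟨by linarith, by linarith [hk.1]⟩
    rw [sub_sub_cancel] at this
    rw [this, abs_neg]
    exact key _ ⟨by linarith, by linarith⟩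

end CHL

end

noncomputable section

namespace CHL

/-! ### The motion of an arc under one uniform particle -/

/-- The uniform distribution on the circle of length `π`, written as `(0, π]`. -/
def unif : Measure ℝ := (ENNReal.ofReal Real.pi)⁻¹ • volume.restrict (Set.Ioc 0 Real.pi)

instance : IsProbabilityMeasure unif := by
  constructor
  simp only [unif, Measure.smul_apply, Measure.restrict_apply MeasurableSet.univ, Set.univ_inter,
    Real.volume_Ioc, sub_zero, smul_eq_mul]
  exact ENNReal.inv_mul_cancel (by simp [Real.pi_pos]) (by simp)

theorem unif_countable {s : Set ℝ} (hs : s.Countable) : unif s = 0 := by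
  simp [unif, Measure.smul_apply, (hs.measure_zero (volume.restrict (Set.Ioc 0 Real.pi)))]

theorem integral_unif {f : ℝ → ℝ} (hf : Function.Periodic f Real.pi) (c : ℝ) :
    ∫ x, f x ∂unif = (∫ x in c..c + Real.pi, f x) / Real.pi := by
  rw [hf.intervalIntegral_add_eq c 0, zero_add, unif, integral_smul_measure,
    intervalIntegral.integral_of_le Real.pi_pos.le]
  simp [Real.pi_pos.le]
  ring

theorem integrable_of_bounded {α : Type*} [MeasurableSpace α] {μ : Measure α} [IsFiniteMeasure μ]
    {f : α → ℝ} (hf : Measurable f) {C : ℝ} (hC : ∀ x, |f x| ≤ C) : Integrable f μ :=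
  Integrable.of_bound hf.aestronglyMeasurable C (Filter.Eventually.of_forall hC)

theorem intervalIntegrable_of_bounded {f : ℝ → ℝ} (hf : Measurable f) {C : ℝ}
    (hC : ∀ x, |f x| ≤ C) (a b : ℝ) : IntervalIntegrable f volume a b := by
  rw [intervalIntegrable_iff]
  have : IsFiniteMeasure (volume.restrict (Set.uIoc a b)) := ⟨by simp [Set.uIoc]⟩
  exact integrable_of_bounded hf hC

theorem le_integral_unif {f : ℝ → ℝ} (hf : Function.Periodic f Real.pi) (hm : Measurable f)
    {C : ℝ} (hC : ∀ x, |f x| ≤ C) (h0 : ∀ x, 0 ≤ f x) {a b c : ℝ} (hab : a ≤ b)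
    (hba : b ≤ a + Real.pi) (hc : ∀ x ∈ Set.Ioo a b, c ≤ f x) :
    (b - a) * c / Real.pi ≤ ∫ x, f x ∂unif := by
  rw [integral_unif hf a]
  have hi := intervalIntegrable_of_bounded hm hC
  gcongr
  calc (b - a) * c = ∫ x in a..b, c := by simp
    _ ≤ ∫ x in a..b, f x :=
        intervalIntegral.integral_mono_on_of_le_Ioo hab (by simp) (hi _ _) hc
    _ ≤ ∫ x in a..a + Real.pi, f x := by
        rw [← intervalIntegral.integral_add_adjacent_intervals (hi a b)
          (hi b (a + Real.pi))]
        have := intervalIntegral.integral_nonneg (μ := volume) hba (fun x _ => h0 x)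
        linarith

/-- The motion of an arc end point `A` caused by a particle at `x`. -/
def push (β x A : ℝ) : ℝ := x + outMap β (A - x)

/-- The particle position `x` lies in the arc `[A, B)` of the circle `ℝ / πℤ`. -/
def ArcHit (A B x : ℝ) : Prop := ∃ k : ℤ, A ≤ x + k * Real.pi ∧ x + k * Real.pi < B

theorem push_eq (β x A : ℝ) : push β x A = A + disp β (A - x) := by
  rw [push, disp]; ring

theorem push_add_pi (β x A : ℝ) : push β x (A + Real.pi) = push β x A + Real.pi := by
  have := disp_periodic β (A - x)
  rw [push_eq, push_eq, show A + Real.pi - x = A - x + Real.pi by ring, this]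
  ring

theorem push_add_int_mul_pi (β x A : ℝ) (k : ℤ) : push β (x + k * Real.pi) A = push β x A := by
  have := disp_add_int_mul_pi β (A - x) (-k)
  rw [push_eq, push_eq, ← this]
  congr 2
  push_cast
  ring

theorem push_mono {β : ℝ} (hβ : β ∈ Set.Ioo 0 (Real.pi / 2)) (x : ℝ) : Monotone (push β x) := by
  intro A B h
  have := monotone_outMap hβ (show A - x ≤ B - x by linarith)
  simp only [push]
  linarith

theorem measurable_push {β : ℝ} (hβ : β ∈ Set.Ioo 0 (Real.pi / 2)) :
    Measurable fun p : ℝ × ℝ => push β p.1 p.2 :=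
  measurable_fst.add ((measurable_outMap hβ).comp (measurable_snd.sub measurable_fst))

theorem arcHit_add_int_mul_pi (A B x : ℝ) (k : ℤ) :
    ArcHit A B (x + k * Real.pi) ↔ ArcHit A B x := by
  constructor
  · rintro ⟨l, h⟩
    refine ⟨k + l, ?_⟩
    push_cast
    rwa [add_mul, ← add_assoc]
  · rintro ⟨l, h⟩
    refine ⟨l - k, ?_⟩
    push_cast
    rwa [sub_mul, add_add_sub_cancel]

theorem measurableSet_arcHit :
    MeasurableSet {p : (ℝ × ℝ) × ℝ | ArcHit p.1.1 p.1.2 p.2} := by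
  have : {p : (ℝ × ℝ) × ℝ | ArcHit p.1.1 p.1.2 p.2} =
      ⋃ k : ℤ, {p | p.1.1 ≤ p.2 + k * Real.pi} ∩ {p | p.2 + k * Real.pi < p.1.2} := by
    ext p
    simp [ArcHit]
  rw [this]
  refine MeasurableSet.iUnion fun k => MeasurableSet.inter ?_ ?_
  · exact measurableSet_le (by fun_prop) (by fun_prop)
  · exact measurableSet_lt (by fun_prop) (by fun_prop)

theorem exists_add_int_mul_pi_mem_Ico' (x a : ℝ) :
    ∃ k : ℤ, x + k * Real.pi ∈ Set.Ico a (a + Real.pi) := by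
  obtain ⟨k, hk, -⟩ := existsUnique_add_zsmul_mem_Ico Real.pi_pos x a
  exact ⟨k, by simpa using hk⟩

theorem arcHit_iff_of_mem {A B x : ℝ} (hBA : B ≤ A + Real.pi)
    (hx : x ∈ Set.Ico A (A + Real.pi)) : ArcHit A B x ↔ x < B := by
  have hpi := Real.pi_pos
  constructor
  · rintro ⟨k, h1, h2⟩
    have hk0 : -1 < (k : ℝ) := by
      by_contra! h
      nlinarith [hx.2]
    have hk1 : (k : ℝ) < 1 := by
      by_contra! h
      nlinarith [hx.1]
    have hk : k = 0 := by
      have : -1 < k := by exact_mod_cast hk0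
      have : k < 1 := by exact_mod_cast hk1
      omega
    simpa [hk] using h2
  · intro h
    exact ⟨0, by simpa using hx.1, by simpa using h⟩

/-- The complement of an arc `[A, B)` of the circle is the arc `[B, A + π)`. -/
theorem arcHit_compl {A B : ℝ} (hAB : A ≤ B) (hBA : B ≤ A + Real.pi) (x : ℝ) :
    ArcHit B (A + Real.pi) x ↔ ¬ArcHit A B x := by
  obtain ⟨k, hk⟩ := exists_add_int_mul_pi_mem_Ico' x A
  rw [← arcHit_add_int_mul_pi A B x k, arcHit_iff_of_mem hBA hk, not_lt]
  constructor
  · intro h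
    obtain ⟨l, hl⟩ := exists_add_int_mul_pi_mem_Ico' x B
    rw [← arcHit_add_int_mul_pi _ _ x l, arcHit_iff_of_mem (by linarith) hl] at h
    have hpi := Real.pi_pos
    have hlk : l = k := by
      have h1 : (l : ℝ) < k + 1 := by
        by_contra! h'
        nlinarith [hk.1]
      have h2 : (k : ℝ) < l + 1 := by
        by_contra! h'
        nlinarith [hk.2, hl.1]
      have : l < k + 1 := by exact_mod_cast h1
      have : k < l + 1 := by exact_mod_cast h2
      omega
    rw [← hlk]
    exact hl.1
  · intro h
    exact ⟨k, h, hk.2⟩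

theorem beta_le_outMap_of_pos {β u : ℝ} (hβ : β ∈ Set.Ioo 0 (Real.pi / 2)) (hu : 0 < u) :
    β ≤ outMap β u := by
  have hm : min u Real.pi ∈ Set.Ioc 0 Real.pi := ⟨lt_min hu Real.pi_pos, min_le_right _ _⟩
  exact (beta_le_outMap hβ hm).trans (monotone_outMap hβ (min_le_left _ _))

theorem outMap_le_neg {β u : ℝ} (hβ : β ∈ Set.Ioo 0 (Real.pi / 2)) (hu : u ≤ 0) :
    outMap β u ≤ -β := by
  have h0 : outMap β 0 = -β := by
    have := outMap_add_int_mul_pi β 0 1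
    simp only [Int.cast_one, one_mul, zero_add, outMap_pi hβ] at this
    linarith
  exact (monotone_outMap hβ hu).trans h0.le

/-- An arc that has just received a particle covers the arc `[-β, β]` around it. -/
theorem two_mul_beta_le_of_arcHit {β A B x : ℝ} (hβ : β ∈ Set.Ioo 0 (Real.pi / 2))
    (h : ArcHit A B x) : 2 * β ≤ push β x B - push β x A := by
  obtain ⟨k, h1, h2⟩ := h
  rw [← push_add_int_mul_pi β x A k, ← push_add_int_mul_pi β x B k, push, push]
  linarith [beta_le_outMap_of_pos hβ (show 0 < B - (x + k * Real.pi) by linarith),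
    outMap_le_neg hβ (show A - (x + k * Real.pi) ≤ 0 by linarith)]

theorem unif_arcHit {A B : ℝ} (hAB : A ≤ B) (hBA : B ≤ A + Real.pi) :
    ∫ x, {x | ArcHit A B x}.indicator (fun _ => (1 : ℝ)) x ∂unif = (B - A) / Real.pi := by
  have hp : Function.Periodic ({x | ArcHit A B x}.indicator (fun _ => (1 : ℝ))) Real.pi := by
    intro x
    have := arcHit_add_int_mul_pi A B x 1
    simp only [Int.cast_one, one_mul] at this
    have h : x + Real.pi ∈ {x | ArcHit A B x} ↔ x ∈ {x | ArcHit A B x} := this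
    by_cases hx : x ∈ {x | ArcHit A B x}
    · rw [Set.indicator_of_mem hx, Set.indicator_of_mem (h.2 hx)]
    · rw [Set.indicator_of_notMem hx, Set.indicator_of_notMem (mt h.1 hx)]
  rw [integral_unif hp A]
  congr 1
  have : ∫ x in A..A + Real.pi, {x | ArcHit A B x}.indicator (fun _ => (1 : ℝ)) x =
      ∫ x in Set.Ico A (A + Real.pi), (Set.Ico A B).indicator (fun _ => (1 : ℝ)) x := by
    rw [intervalIntegral.integral_of_le (by linarith [Real.pi_pos]),
      ← integral_Ico_eq_integral_Ioc]
    refine setIntegral_congr_fun measurableSet_Ico fun x hx => ?_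
    have h := arcHit_iff_of_mem hBA hx
    have h' : x ∈ Set.Ico A B ↔ x < B := ⟨fun h => h.2, fun h => ⟨hx.1, h⟩⟩
    simp only [Set.indicator, Set.mem_ofPred_eq, h, h']
  rw [this, setIntegral_indicator measurableSet_Ico, Set.inter_eq_right.2
    (Set.Ico_subset_Ico_right hBA)]
  simp [hAB]

theorem measurable_disp_sub {β : ℝ} (hβ : β ∈ Set.Ioo 0 (Real.pi / 2)) (c : ℝ) :
    Measurable fun x => disp β (c - x) :=
  (measurable_disp hβ).comp (measurable_const.sub measurable_id)

theorem disp_sub_periodic (β c : ℝ) : Function.Periodic (fun x => disp β (c - x)) Real.pi := by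
  intro x
  have := disp_periodic β (c - (x + Real.pi))
  simp only
  rw [← this]
  congr 1
  ring

theorem integral_disp {β : ℝ} (c : ℝ) : ∫ x, disp β (c - x) ∂unif = 0 := by
  rw [integral_unif (disp_sub_periodic β c) (c - Real.pi), sub_add_cancel]
  have h1 : ∫ x in c - Real.pi..c, disp β (c - x) = ∫ x in (0 : ℝ)..Real.pi, disp β x := by
    rw [intervalIntegral.integral_comp_sub_left]
    simp
  have h2 : ∫ x in (0 : ℝ)..Real.pi, disp β x = ∫ x in (0 : ℝ)..Real.pi, -disp β x := by
    calc ∫ x in (0 : ℝ)..Real.pi, disp β x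
        = ∫ x in (0 : ℝ)..Real.pi, disp β (Real.pi - x) := by
          rw [intervalIntegral.integral_comp_sub_left]
          simp
      _ = _ := by
          rw [intervalIntegral.integral_of_le Real.pi_pos.le,
            intervalIntegral.integral_of_le Real.pi_pos.le, integral_Ioc_eq_integral_Ioo,
            integral_Ioc_eq_integral_Ioo]
          exact setIntegral_congr_fun measurableSet_Ioo fun x hx => disp_pi_sub hx
  rw [intervalIntegral.integral_neg] at h2
  rw [h1, show ∫ x in (0 : ℝ)..Real.pi, disp β x = 0 by linarith, zero_div]

/-- The change of the length of the arc `[A, B)` caused by a particle at `x`. -/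
def incr (β A B x : ℝ) : ℝ := disp β (B - x) - disp β (A - x)

theorem push_sub_push (β A B x : ℝ) : push β x B - push β x A = B - A + incr β A B x := by
  rw [push_eq, push_eq, incr]; ring

theorem incr_compl (β A B x : ℝ) : incr β B (A + Real.pi) x = -incr β A B x := by
  have := disp_periodic β (A - x)
  rw [incr, incr, show A + Real.pi - x = A - x + Real.pi by ring, this]
  ring

theorem abs_incr_le {β : ℝ} (hβ : β ∈ Set.Ioo 0 (Real.pi / 2)) (A B x : ℝ) :
    |incr β A B x| ≤ 2 * β := by
  have h1 := abs_le.1 (abs_disp_le hβ (B - x))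
  have h2 := abs_le.1 (abs_disp_le hβ (A - x))
  rw [incr, abs_le]
  constructor <;> linarith [h1.1, h1.2, h2.1, h2.2]

theorem measurable_incr {β : ℝ} (hβ : β ∈ Set.Ioo 0 (Real.pi / 2)) (A B : ℝ) :
    Measurable (incr β A B) :=
  (measurable_disp_sub hβ B).sub (measurable_disp_sub hβ A)

theorem incr_periodic (β A B : ℝ) : Function.Periodic (incr β A B) Real.pi := by
  intro x
  have h1 := disp_sub_periodic β B x
  have h2 := disp_sub_periodic β A x
  simp only at h1 h2
  rw [incr, incr, h1, h2]

theorem integrable_incr {β : ℝ} (hβ : β ∈ Set.Ioo 0 (Real.pi / 2)) (A B : ℝ) :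
    Integrable (incr β A B) unif :=
  integrable_of_bounded (measurable_incr hβ A B) (abs_incr_le hβ A B)

theorem abs_incr_sq_le {β : ℝ} (hβ : β ∈ Set.Ioo 0 (Real.pi / 2)) (A B x : ℝ) :
    |incr β A B x ^ 2| ≤ (2 * β) ^ 2 := by
  rw [abs_pow]
  exact pow_le_pow_left₀ (abs_nonneg _) (abs_incr_le hβ A B x) 2

theorem integrable_incr_sq {β : ℝ} (hβ : β ∈ Set.Ioo 0 (Real.pi / 2)) (A B : ℝ) :
    Integrable (fun x => incr β A B x ^ 2) unif :=
  integrable_of_bounded ((measurable_incr hβ A B).pow_const 2) (abs_incr_sq_le hβ A B)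

/-- The length of an arc is a martingale. -/
theorem integral_incr {β : ℝ} (hβ : β ∈ Set.Ioo 0 (Real.pi / 2)) (A B : ℝ) :
    ∫ x, incr β A B x ∂unif = 0 := by
  have h : ∀ c, Integrable (fun x => disp β (c - x)) unif := fun c =>
    integrable_of_bounded (measurable_disp_sub hβ c) fun x => abs_disp_le hβ _
  simp only [incr]
  rw [integral_sub (h B) (h A), integral_disp, integral_disp, sub_zero]

/-- The variance of the change of the length of the arc `[A, B)` caused by one particle. -/
def variance (β A B : ℝ) : ℝ := ∫ x, incr β A B x ^ 2 ∂unif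

theorem variance_compl (β A B : ℝ) : variance β B (A + Real.pi) = variance β A B := by
  simp only [variance, incr_compl, neg_sq]

theorem disp_neg_le {β u : ℝ} (hβ : β ∈ Set.Ioo 0 (Real.pi / 2)) (hu : u ∈ Set.Ioo 0 Real.pi) :
    disp β (-u) ≤ u - β := by
  have h : disp β (-u) = -disp β u := by
    rw [← disp_pi_sub hu, ← disp_periodic β (-u)]
    congr 1
    ring
  linarith [sub_le_disp hβ ⟨hu.1, hu.2.le⟩]

/-- A particle that arrives in an arc close to one of its ends changes its length by a definite
fraction of `β`. -/
theorem le_variance {β A B : ℝ} (hβ : β ∈ Set.Ioo 0 (Real.pi / 2)) (hAB : A ≤ B)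
    (hBA : B ≤ A + Real.pi) :
    β ^ 2 / (4 * Real.pi) * min (min (B - A) (Real.pi - (B - A))) (β / 2) ≤ variance β A B := by
  have hpi := Real.pi_pos
  wlog h : B - A ≤ Real.pi / 2 generalizing A B
  · have := this (A := B) (B := A + Real.pi) hBA (by linarith) (by linarith)
    rw [variance_compl, min_comm (A + Real.pi - B)] at this
    rwa [show Real.pi - (B - A) = A + Real.pi - B by ring,
      show B - A = Real.pi - (A + Real.pi - B) by ring]
  set m := min (min (B - A) (Real.pi - (B - A))) (β / 2) with hm
  have hm1 : m ≤ B - A := (min_le_left _ _).trans (min_le_left _ _)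
  have hm2 : m ≤ β / 2 := min_le_right _ _
  have hm0 : 0 ≤ m := le_min (le_min (by linarith) (by linarith)) (by linarith [hβ.1])
  have := le_integral_unif (f := fun x => incr β A B x ^ 2) (C := (2 * β) ^ 2) (a := A)
    (b := A + m) (c := (β / 2) ^ 2) (fun x => by simp only [incr_periodic β A B x])
    ((measurable_incr hβ A B).pow_const 2) (abs_incr_sq_le hβ A B)
    (fun x => sq_nonneg _) (by linarith) (by linarith) (fun x hx => ?_)
  · rw [variance]
    refine le_trans (le_of_eq ?_) this
    field_simp
    ring
  · have h1 := disp_neg_le hβ (u := x - A) ⟨by linarith [hx.1], by linarith [hx.2]⟩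
    have h2 := disp_nonneg hβ (u := B - x) ⟨by linarith [hx.2], by linarith [hx.1]⟩
    rw [neg_sub] at h1
    have : β / 2 ≤ incr β A B x := by
      rw [incr]; linarith [hx.2]
    exact pow_le_pow_left₀ (by linarith [hβ.1]) this 2

theorem disp_sq_le {β u : ℝ} (hβ : β ∈ Set.Ioo 0 (Real.pi / 2))
    (hu : u ∈ Set.Icc (-(Real.pi / 2)) (Real.pi / 2)) :
    disp β u ^ 2 ≤ 16 * β ^ 2 * (1 + (u / β) ^ 2)⁻¹ := by
  have hβ0 := hβ.1
  have hpi := Real.pi_pos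
  have key : ∀ v : ℝ, v ∈ Set.Ioc 0 (Real.pi / 2) →
      disp β v ^ 2 ≤ 16 * β ^ 2 * (1 + (v / β) ^ 2)⁻¹ := by
    intro v hv
    have h0 := disp_nonneg hβ hv
    have h1 : disp β v ≤ β := (abs_le.1 (abs_disp_le hβ v)).2
    have h2 := disp_mul_le hβ hv
    have h3 : disp β v * v ≤ 3.75 * β ^ 2 := by
      have : Real.pi ^ 2 ≤ 10 := by nlinarith [Real.pi_lt_d2, Real.pi_pos]
      nlinarith [sq_nonneg (disp β v), sq_nonneg β]
    have h4 : disp β v ^ 2 * v ^ 2 ≤ 15 * β ^ 4 := by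
      have h0' : 0 ≤ disp β v * v := mul_nonneg h0 hv.1.le
      have := pow_le_pow_left₀ h0' h3 2
      nlinarith [sq_nonneg (β ^ 2)]
    have h5 : disp β v ^ 2 ≤ β ^ 2 := pow_le_pow_left₀ h0 h1 2
    rw [← div_eq_mul_inv, le_div_iff₀ (by positivity)]
    have h6 : disp β v ^ 2 * (1 + (v / β) ^ 2) = disp β v ^ 2 + disp β v ^ 2 * v ^ 2 / β ^ 2 := by
      field_simp
    rw [h6]
    have : disp β v ^ 2 * v ^ 2 / β ^ 2 ≤ 15 * β ^ 2 := by
      rw [div_le_iff₀ (by positivity)]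
      nlinarith
    linarith
  rcases lt_trichotomy u 0 with h | h | h
  · have h1 : disp β u = -disp β (-u) := by
      have := disp_pi_sub (β := β) (u := -u) ⟨by linarith, by linarith [hu.1]⟩
      rw [← this, ← disp_periodic β u]
      congr 1
      ring
    have := key (-u) ⟨by linarith, by linarith [hu.1]⟩
    rw [h1, neg_sq]
    simpa [neg_div] using this
  · have h1 := sq_le_sq' (abs_le.1 (abs_disp_le hβ u)).1 (abs_le.1 (abs_disp_le hβ u)).2
    rw [h] at h1 ⊢
    simp only [zero_div]
    nlinarith [sq_nonneg β]
  · exact key u ⟨h, hu.2⟩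

/-- The displacement at distance `u` from the particle is at most `β`, and of order `β ^ 2 / u` for
`u` larger than `β`, so the integral of its square is of order `β ^ 3`. -/
theorem integral_disp_sq_le {β : ℝ} (hβ : β ∈ Set.Ioo 0 (Real.pi / 2)) (c : ℝ) :
    ∫ x, disp β (c - x) ^ 2 ∂unif ≤ 16 * β ^ 3 := by
  have hpi := Real.pi_pos
  have hβ0 := hβ.1
  have hper : Function.Periodic (fun x => disp β (c - x) ^ 2) Real.pi := by
    intro x
    have := disp_sub_periodic β c x
    simp only at this ⊢
    rw [this]
  rw [integral_unif hper (c - Real.pi / 2), div_le_iff₀ hpi]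
  calc ∫ x in c - Real.pi / 2..c - Real.pi / 2 + Real.pi, disp β (c - x) ^ 2
      = ∫ x in -(Real.pi / 2)..Real.pi / 2, disp β x ^ 2 := by
        rw [intervalIntegral.integral_comp_sub_left (fun x => disp β x ^ 2)]
        rw [show c - (c - Real.pi / 2 + Real.pi) = -(Real.pi / 2) by ring, sub_sub_cancel]
    _ ≤ ∫ x in -(Real.pi / 2)..Real.pi / 2, 16 * β ^ 2 * (1 + (x / β) ^ 2)⁻¹ := by
        refine intervalIntegral.integral_mono_on (by linarith) ?_ ?_ fun x hx => disp_sq_le hβ hx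
        · refine intervalIntegrable_of_bounded ((measurable_disp hβ).pow_const 2) (C := β ^ 2)
            (fun x => ?_) _ _
          rw [abs_pow]
          exact pow_le_pow_left₀ (abs_nonneg _) (abs_disp_le hβ x) 2
        · refine Continuous.intervalIntegrable ?_ _ _
          refine continuous_const.mul (Continuous.inv₀ (by fun_prop) fun x => by positivity)
    _ = 16 * β ^ 3 * (Real.arctan (Real.pi / 2 / β) - Real.arctan (-(Real.pi / 2) / β)) := by
        rw [intervalIntegral.integral_const_mul,
          intervalIntegral.integral_comp_div (fun x => (1 + x ^ 2)⁻¹) hβ0.ne', integral_inv_one_add_sq]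
        simp only [smul_eq_mul]
        ring
    _ ≤ 16 * β ^ 3 * Real.pi := by
        gcongr
        linarith [Real.arctan_lt_pi_div_two (Real.pi / 2 / β),
          Real.neg_pi_div_two_lt_arctan (-(Real.pi / 2) / β)]

theorem variance_le {β : ℝ} (hβ : β ∈ Set.Ioo 0 (Real.pi / 2)) (A B : ℝ) :
    variance β A B ≤ 64 * β ^ 3 := by
  have h : ∀ c, Integrable (fun x => 2 * disp β (c - x) ^ 2) unif := fun c => by
    refine Integrable.const_mul
      (integrable_of_bounded ((measurable_disp_sub hβ c).pow_const 2) (C := β ^ 2) fun x => ?_) 2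
    rw [abs_pow]
    exact pow_le_pow_left₀ (abs_nonneg _) (abs_disp_le hβ _) 2
  calc variance β A B ≤ ∫ x, 2 * disp β (B - x) ^ 2 + 2 * disp β (A - x) ^ 2 ∂unif := by
        refine integral_mono (integrable_incr_sq hβ A B) ((h B).add (h A)) fun x => ?_
        simp only [incr]
        nlinarith [sq_nonneg (disp β (B - x) + disp β (A - x))]
    _ = 2 * ∫ x, disp β (B - x) ^ 2 ∂unif + 2 * ∫ x, disp β (A - x) ^ 2 ∂unif := by
        rw [integral_add (h B) (h A), integral_const_mul, integral_const_mul]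
    _ ≤ 64 * β ^ 3 := by
        linarith [integral_disp_sq_le hβ B, integral_disp_sq_le hβ A]

end CHL

end

noncomputable section

namespace CHL

/-! ### The balance of an arc and its complement -/

/-- The length of the arc `[A, B)` after a particle has arrived at `x`. -/
def newLen (β A B x : ℝ) : ℝ := push β x B - push β x A

theorem newLen_eq (β A B x : ℝ) : newLen β A B x = B - A + incr β A B x := push_sub_push β A B x

theorem newLen_compl (β A B x : ℝ) :
    newLen β B (A + Real.pi) x = Real.pi - newLen β A B x := by
  rw [newLen_eq, newLen_eq, incr_compl]; ring

theorem newLen_mem {β : ℝ} (hβ : β ∈ Set.Ioo 0 (Real.pi / 2)) {A B : ℝ} (hAB : A ≤ B)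
    (hBA : B ≤ A + Real.pi) (x : ℝ) : newLen β A B x ∈ Set.Icc 0 Real.pi := by
  have h1 := push_mono hβ x hAB
  have h2 := push_mono hβ x hBA
  rw [push_add_pi] at h2
  constructor <;> rw [newLen] <;> linarith

theorem measurable_newLen {β : ℝ} (hβ : β ∈ Set.Ioo 0 (Real.pi / 2)) (A B : ℝ) :
    Measurable (newLen β A B) := by
  have : newLen β A B = fun x => B - A + incr β A B x := funext (newLen_eq β A B)
  rw [this]
  exact measurable_const.add (measurable_incr hβ A B)

theorem newLen_periodic (β A B : ℝ) : Function.Periodic (newLen β A B) Real.pi := by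
  intro x
  rw [newLen_eq, newLen_eq, incr_periodic]

theorem integral_newLen {β : ℝ} (hβ : β ∈ Set.Ioo 0 (Real.pi / 2)) (A B : ℝ) :
    ∫ x, newLen β A B x ∂unif = B - A := by
  simp only [newLen_eq]
  rw [integral_add (integrable_const _) (integrable_incr hβ A B), integral_incr hβ]
  simp

/-- The product of the lengths of an arc of length `q` and of its complement. -/
def balance (q : ℝ) : ℝ := q * (Real.pi - q)

theorem balance_nonneg {q : ℝ} (hq : q ∈ Set.Icc 0 Real.pi) : 0 ≤ balance q :=
  mul_nonneg hq.1 (by linarith [hq.2])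

theorem balance_le_min {q : ℝ} (hq : q ∈ Set.Icc 0 Real.pi) :
    balance q ≤ Real.pi * min q (Real.pi - q) := by
  rw [balance]
  rcases min_cases q (Real.pi - q) with ⟨h, _⟩ | ⟨h, _⟩ <;> rw [h] <;>
    nlinarith [hq.1, hq.2, Real.pi_pos]

theorem balance_le (q : ℝ) : balance q ≤ Real.pi ^ 2 / 4 := by
  rw [balance]
  nlinarith [sq_nonneg (q - Real.pi / 2)]

theorem balance_compl (q : ℝ) : balance (Real.pi - q) = balance q := by
  rw [balance, balance]; ring

theorem integral_quadratic_incr {β : ℝ} (hβ : β ∈ Set.Ioo 0 (Real.pi / 2)) (A B a b c : ℝ) :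
    Integrable (fun x => a + b * incr β A B x - c * incr β A B x ^ 2) unif ∧
      ∫ x, a + b * incr β A B x - c * incr β A B x ^ 2 ∂unif = a - c * variance β A B := by
  have h1 := (integrable_incr hβ A B).const_mul b
  have h2 := (integrable_incr_sq hβ A B).const_mul c
  have h3 : Integrable (fun x => a + b * incr β A B x) unif := (integrable_const a).add h1
  refine ⟨h3.sub h2, ?_⟩
  rw [integral_sub h3 h2, integral_add (integrable_const _) h1, integral_const_mul,
    integral_const_mul, integral_incr hβ, variance]
  simp

theorem integral_balance {β : ℝ} (hβ : β ∈ Set.Ioo 0 (Real.pi / 2)) (A B : ℝ) :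
    ∫ x, balance (newLen β A B x) ∂unif = balance (B - A) - variance β A B := by
  have h : ∀ x, balance (newLen β A B x) =
      balance (B - A) + (Real.pi - 2 * (B - A)) * incr β A B x - 1 * incr β A B x ^ 2 := by
    intro x
    rw [newLen_eq, balance, balance]
    ring
  simp only [h]
  rw [(integral_quadratic_incr hβ A B _ _ _).2, one_mul]

/-- The lower bound of `le_variance` is of order `β ^ 2` times the length of the shorter arc if that is
shorter than `β`, and of order `β ^ 3` otherwise; the balance is at most of the order of that length. -/
theorem balance_le_variance {β : ℝ} (hβ : β ∈ Set.Ioo 0 (Real.pi / 2)) {A B : ℝ} (hAB : A ≤ B)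
    (hBA : B ≤ A + Real.pi) :
    β ^ 3 / (2 * Real.pi ^ 3) * balance (B - A) ≤ variance β A B := by
  have hpi := Real.pi_pos
  have hβ0 := hβ.1
  refine le_trans ?_ (le_variance hβ hAB hBA)
  have hq : B - A ∈ Set.Icc 0 Real.pi := ⟨by linarith, by linarith⟩
  have h1 := balance_le_min hq
  have h2 := balance_le (B - A)
  have h0 := balance_nonneg hq
  have h3 : 2 * β / Real.pi ^ 2 * balance (B - A) ≤
      min (min (B - A) (Real.pi - (B - A))) (β / 2) := by
    refine le_min ?_ ?_
    · calc 2 * β / Real.pi ^ 2 * balance (B - A) ≤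
          2 * (Real.pi / 2) / Real.pi ^ 2 * (Real.pi * min (B - A) (Real.pi - (B - A))) := by
            gcongr
            exact hβ.2.le
        _ = _ := by field_simp
    · calc 2 * β / Real.pi ^ 2 * balance (B - A) ≤ 2 * β / Real.pi ^ 2 * (Real.pi ^ 2 / 4) := by
            gcongr
        _ = _ := by field_simp; norm_num
  calc β ^ 3 / (2 * Real.pi ^ 3) * balance (B - A)
      = β ^ 2 / (4 * Real.pi) * (2 * β / Real.pi ^ 2 * balance (B - A)) := by
        field_simp; ring
    _ ≤ _ := by gcongr

theorem arccos_le_sub {z : ℝ} (hz : 0 ≤ z) (hz1 : z ≤ 1) : Real.arccos z ≤ Real.pi / 2 - z := by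
  rw [Real.arccos]
  have h := Real.sin_le (Real.arcsin_nonneg.2 hz)
  rw [Real.sin_arcsin (by linarith) hz1] at h
  linarith

theorem cos_three_pi_div_eight_pos : 0 < Real.cos (3 * Real.pi / 8) :=
  Real.cos_pos_of_mem_Ioo ⟨by linarith [Real.pi_pos], by linarith [Real.pi_pos]⟩

/-- A particle in the middle part of an arc leaves space to the complementary arc. -/
theorem newLen_le_of_mid {β : ℝ} (hβ : β ∈ Set.Ioo 0 (Real.pi / 2)) {A B x : ℝ} (hAB : A ≤ B)
    (hq : B - A ≤ Real.pi / 2) (hx : x ∈ Set.Ioo (A + (B - A) / 4) (B - (B - A) / 4)) :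
    newLen β A B x ≤ Real.pi - 2 * Real.cos β * Real.cos (3 * Real.pi / 8) := by
  have hpi := Real.pi_pos
  have hc := cos_pos_of_mem hβ
  have hc1 := cos_lt_one_of_mem hβ
  have hc' := cos_three_pi_div_eight_pos
  have hout : ∀ v, v ≤ 3 * Real.pi / 8 →
      outMap β v ≤ Real.pi / 2 - Real.cos β * Real.cos (3 * Real.pi / 8) := by
    intro v hv
    refine (monotone_outMap hβ hv).trans ?_
    rw [outMap_of_mem ⟨by linarith, by linarith⟩]
    exact arccos_le_sub (by positivity) (by nlinarith [Real.cos_le_one (3 * Real.pi / 8)])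
  have h1 := hout (B - x) (by linarith [hx.1])
  have h2 := hout (x - A) (by linarith [hx.2])
  have h3 : outMap β (A - x) = -outMap β (x - A) := by
    have hu : x - A ∈ Set.Ioo 0 Real.pi := ⟨by linarith [hx.1], by linarith [hx.2]⟩
    have := disp_pi_sub (β := β) hu
    have h4 := disp_periodic β (A - x)
    rw [show A - x + Real.pi = Real.pi - (x - A) by ring, this] at h4
    simp only [disp] at h4
    linarith
  rw [newLen, push, push, h3]
  linarith

/-- The probability that the first of two particles is received by exactly one of the arc `[A, B)`
and its complement, and the second by the other one. -/
def switchProb (β A B : ℝ) : ℝ :=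
  ∫ x, {x | ArcHit A B x}.indicator (fun x => 1 - newLen β A B x / Real.pi) x +
    {x | ArcHit A B x}ᶜ.indicator (fun x => newLen β A B x / Real.pi) x ∂unif

theorem measurableSet_arcHit_const (A B : ℝ) : MeasurableSet {x | ArcHit A B x} :=
  measurableSet_arcHit.preimage (measurable_const.prodMk measurable_id :
    Measurable fun x : ℝ => ((A, B), x))

theorem arcHit_periodic (A B x : ℝ) : ArcHit A B (x + Real.pi) ↔ ArcHit A B x := by
  simpa using arcHit_add_int_mul_pi A B x 1

theorem newLen_div_pi_mem {β : ℝ} (hβ : β ∈ Set.Ioo 0 (Real.pi / 2)) {A B : ℝ} (hAB : A ≤ B)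
    (hBA : B ≤ A + Real.pi) (x : ℝ) : newLen β A B x / Real.pi ∈ Set.Icc 0 1 := by
  have h := newLen_mem hβ hAB hBA x
  exact ⟨div_nonneg h.1 Real.pi_pos.le, (div_le_one Real.pi_pos).2 h.2⟩

theorem switchProb_compl {β A B : ℝ} (hAB : A ≤ B) (hBA : B ≤ A + Real.pi) :
    switchProb β B (A + Real.pi) = switchProb β A B := by
  rw [switchProb, switchProb]
  congr 1
  ext x
  have h : {x | ArcHit B (A + Real.pi) x} = {x | ArcHit A B x}ᶜ := by
    ext x
    exact arcHit_compl hAB hBA x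
  simp only [h, compl_compl, newLen_compl]
  rw [add_comm]
  have hpi := Real.pi_ne_zero
  congr 2 <;> ext x <;> field_simp
  ring

theorem le_switchProb {β : ℝ} (hβ : β ∈ Set.Ioo 0 (Real.pi / 2)) {A B : ℝ} (hAB : A ≤ B)
    (hBA : B ≤ A + Real.pi) :
    Real.cos β * Real.cos (3 * Real.pi / 8) / Real.pi ^ 2 * min (B - A) (Real.pi - (B - A)) ≤
      switchProb β A B := by
  have hpi := Real.pi_pos
  wlog h : B - A ≤ Real.pi / 2 generalizing A B
  · have := this (A := B) (B := A + Real.pi) hBA (by linarith) (by linarith)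
    rw [switchProb_compl hAB hBA, min_comm (A + Real.pi - B)] at this
    rwa [show Real.pi - (B - A) = A + Real.pi - B by ring,
      show B - A = Real.pi - (A + Real.pi - B) by ring]
  have hmem := newLen_div_pi_mem hβ hAB hBA
  rw [min_eq_left (by linarith)]
  have := le_integral_unif (f := fun x =>
      {x | ArcHit A B x}.indicator (fun x => 1 - newLen β A B x / Real.pi) x +
        {x | ArcHit A B x}ᶜ.indicator (fun x => newLen β A B x / Real.pi) x) (C := 1)
    (a := A + (B - A) / 4) (b := B - (B - A) / 4)
    (c := 2 * Real.cos β * Real.cos (3 * Real.pi / 8) / Real.pi) ?_ ?_ ?_ ?_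
    (by linarith) (by linarith) ?_
  · refine le_trans (le_of_eq ?_) this
    field_simp
    ring
  · intro x
    have hx := arcHit_periodic A B x
    have hn := newLen_periodic β A B x
    by_cases h : ArcHit A B x
    · have h' := hx.2 h
      simp [Set.indicator, h, h', hn]
    · have h' := mt hx.1 h
      simp [Set.indicator, h, h', hn]
  · have hm := measurableSet_arcHit_const A B
    have hn := (measurable_newLen hβ A B).div_const Real.pi
    exact ((measurable_const.sub hn).indicator hm).add (hn.indicator hm.compl)
  · intro x
    have := hmem x
    by_cases h : ArcHit A B x <;> simp [Set.indicator, h, abs_le] <;> constructor <;>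
      linarith [this.1, this.2]
  · intro x
    have := hmem x
    by_cases h : ArcHit A B x <;> simp [Set.indicator, h] <;> linarith [this.1, this.2]
  · intro x hx
    have hh : ArcHit A B x := ⟨0, by simp; linarith [hx.1], by simp; linarith [hx.2]⟩
    have := newLen_le_of_mid hβ hAB h hx
    simp only [Set.indicator, Set.mem_ofPred_eq, hh, if_true, Set.mem_compl_iff, not_true_eq_false,
      if_false, add_zero]
    rw [le_sub_iff_add_le, ← add_div, div_le_one hpi]
    linarith

theorem integrable_balance_sq {β : ℝ} (hβ : β ∈ Set.Ioo 0 (Real.pi / 2)) {A B : ℝ} (hAB : A ≤ B)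
    (hBA : B ≤ A + Real.pi) : Measurable (fun x => balance (newLen β A B x) ^ 2) ∧
      ∀ x, |balance (newLen β A B x) ^ 2| ≤ (Real.pi ^ 2 / 4) ^ 2 := by
  have hm := measurable_newLen hβ A B
  refine ⟨(hm.mul (measurable_const.sub hm)).pow_const 2, fun x => ?_⟩
  have h0 := balance_nonneg (newLen_mem hβ hAB hBA x)
  rw [abs_of_nonneg (by positivity)]
  exact pow_le_pow_left₀ h0 (balance_le _) 2

/-- For particles of macroscopic size, the arc and its complement both survive one particle with a
probability that is at least a constant. -/
theorem le_integral_balance_sq_of_large {β : ℝ} (hβ : β ∈ Set.Ioo 0 (Real.pi / 2)) {A B : ℝ}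
    (hAB : A ≤ B) (hBA : B ≤ A + Real.pi) :
    2 / Real.pi ^ 4 * (2 * β * (2 * Real.cos β * Real.cos (3 * Real.pi / 8))) ^ 2 *
      balance (B - A) ^ 2 ≤ ∫ x, balance (newLen β A B x) ^ 2 ∂unif := by
  have hpi := Real.pi_pos
  wlog h : B - A ≤ Real.pi / 2 generalizing A B
  · have := this (A := B) (B := A + Real.pi) hBA (by linarith) (by linarith)
    simp only [newLen_compl, balance_compl] at this
    rwa [show A + Real.pi - B = Real.pi - (B - A) by ring, balance_compl] at this
  have hβ0 := hβ.1
  have hc := cos_pos_of_mem hβ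
  have hc' := cos_three_pi_div_eight_pos
  set η := 2 * Real.cos β * Real.cos (3 * Real.pi / 8) with hη
  have hη0 : 0 < η := by positivity
  obtain ⟨hm, hb⟩ := integrable_balance_sq hβ hAB hBA
  have := le_integral_unif (f := fun x => balance (newLen β A B x) ^ 2)
    (a := A + (B - A) / 4) (b := B - (B - A) / 4) (c := (2 * β * η) ^ 2) (fun x => by
      simp only [newLen_periodic β A B x]) hm hb (fun x => sq_nonneg _) (by linarith)
    (by linarith) ?_
  · refine le_trans ?_ this
    have hq : B - A ∈ Set.Icc 0 Real.pi := ⟨by linarith, by linarith⟩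
    have h1 := balance_le_min hq
    have h2 := balance_le (B - A)
    have h0 := balance_nonneg hq
    rw [min_eq_left (by linarith)] at h1
    have h3 : balance (B - A) ^ 2 ≤ Real.pi ^ 3 / 4 * (B - A) := by
      calc balance (B - A) ^ 2 = balance (B - A) * balance (B - A) := sq _
        _ ≤ (Real.pi ^ 2 / 4) * (Real.pi * (B - A)) := by gcongr
        _ = _ := by ring
    calc 2 / Real.pi ^ 4 * (2 * β * η) ^ 2 * balance (B - A) ^ 2 ≤
        2 / Real.pi ^ 4 * (2 * β * η) ^ 2 * (Real.pi ^ 3 / 4 * (B - A)) := by gcongr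
      _ = _ := by field_simp; ring
  · intro x hx
    have hh : ArcHit A B x := ⟨0, by simp; linarith [hx.1], by simp; linarith [hx.2]⟩
    have h1 := two_mul_beta_le_of_arcHit hβ hh
    have h2 := newLen_le_of_mid hβ hAB h hx
    refine pow_le_pow_left₀ (by positivity) ?_ 2
    rw [balance]
    have h3 : 2 * β ≤ newLen β A B x := h1
    have h4 : η ≤ Real.pi - newLen β A B x := by linarith
    exact mul_le_mul h3 h4 hη0.le (by linarith)

/-- For small particles, the squared balance decays at most at rate of order `β ^ 3`: while the arc
or its complement is short the square is a submartingale. -/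
theorem le_integral_balance_sq_of_small {β : ℝ} (hβ : β ∈ Set.Ioo 0 (Real.pi / 2))
    (hβ' : β ≤ 1 / 4) {A B : ℝ} (hAB : A ≤ B) (hBA : B ≤ A + Real.pi) :
    (1 - 128 * β ^ 3) * balance (B - A) ^ 2 ≤ ∫ x, balance (newLen β A B x) ^ 2 ∂unif := by
  have hβ0 := hβ.1
  have hpi := Real.pi_gt_d2
  have hpi' := Real.pi_lt_d2
  have hq : B - A ∈ Set.Icc 0 Real.pi := ⟨by linarith, by linarith⟩
  obtain ⟨hm, hb⟩ := integrable_balance_sq hβ hAB hBA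
  have h1 := integrable_incr hβ A B
  have h2 := integrable_incr_sq hβ A B
  set W := balance (B - A) with hW
  have hW0 : 0 ≤ W := balance_nonneg hq
  have h4W : 4 * W = Real.pi ^ 2 - (Real.pi - 2 * (B - A)) ^ 2 := by
    rw [hW, balance]; ring
  set r := Real.pi - 2 * (B - A) with hr
  have hexp : ∀ x, balance (newLen β A B x) ^ 2 = W ^ 2 + 2 * W * r * incr β A B x -
      2 * W * incr β A B x ^ 2 + incr β A B x ^ 2 * (r - incr β A B x) ^ 2 := by
    intro x
    rw [newLen_eq, hW, hr, balance, balance]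
    ring
  -- If `|r|` is large, then the balance is small and the last term of the expansion dominates the
  -- negative one, as `|incr| ≤ 1 / 2`; otherwise `1 ≤ W`, and the last term is dropped.
  rcases le_or_gt 2.2 |r| with hr2 | hr2
  · have : W ^ 2 ≤ ∫ x, balance (newLen β A B x) ^ 2 ∂unif := by
      calc W ^ 2 = ∫ x, W ^ 2 + 2 * W * r * incr β A B x ∂unif := by
            rw [integral_add (integrable_const _) (h1.const_mul _), integral_const_mul,
              integral_incr hβ]
            simp
        _ ≤ _ := by
            refine integral_mono ((integrable_const _).add (h1.const_mul _))
              (integrable_of_bounded hm hb) fun x => ?_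
            rw [hexp]
            have hd := abs_incr_le hβ A B x
            have h3 : 1.7 ≤ |r - incr β A B x| := by
              have := abs_sub_abs_le_abs_sub r (incr β A B x)
              linarith
            have h4 : 1.7 ^ 2 ≤ (r - incr β A B x) ^ 2 := by
              rw [← sq_abs (r - incr β A B x)]
              exact pow_le_pow_left₀ (by norm_num) h3 2
            have h5 : 2.2 ^ 2 ≤ r ^ 2 := by
              rw [← sq_abs r]
              exact pow_le_pow_left₀ (by norm_num) hr2 2
            have h6 : 2 * W ≤ (r - incr β A B x) ^ 2 := by nlinarith
            nlinarith [sq_nonneg (incr β A B x)]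
    refine le_trans ?_ this
    have : 0 ≤ β ^ 3 := by positivity
    nlinarith [sq_nonneg W]
  · have hW1 : 1 ≤ W := by
      have : r ^ 2 ≤ 2.2 ^ 2 := by
        rw [← sq_abs r]
        exact pow_le_pow_left₀ (abs_nonneg _) hr2.le 2
      nlinarith
    obtain ⟨hint, hint'⟩ := integral_quadratic_incr hβ A B (W ^ 2) (2 * W * r) (2 * W)
    calc (1 - 128 * β ^ 3) * W ^ 2 ≤ W ^ 2 - 2 * W * variance β A B := by
          have := variance_le hβ A B
          have h7 : W * variance β A B ≤ W ^ 2 * (64 * β ^ 3) := by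
            rw [sq, mul_assoc]
            refine mul_le_mul_of_nonneg_left ?_ hW0
            have : 0 ≤ 64 * β ^ 3 := by positivity
            nlinarith
          linarith
      _ = ∫ x, W ^ 2 + 2 * W * r * incr β A B x - 2 * W * incr β A B x ^ 2 ∂unif := by
          rw [hint']
      _ ≤ _ := by
          refine integral_mono hint (integrable_of_bounded hm hb) fun x => ?_
          simp only [hexp]
          have := mul_nonneg (sq_nonneg (incr β A B x)) (sq_nonneg (r - incr β A B x))
          linarith

theorem exp_neg_two_mul_le {y : ℝ} (h0 : 0 ≤ y) (h1 : y ≤ 1 / 2) : Real.exp (-(2 * y)) ≤ 1 - y := by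
  have h := Real.add_one_le_exp (2 * y)
  rw [Real.exp_neg]
  rw [inv_le_comm₀ (Real.exp_pos _) (by linarith)]
  refine le_trans ?_ h
  rw [inv_le_iff_one_le_mul₀ (by linarith)]
  nlinarith

theorem exists_le_integral_balance_sq {c₀ : ℝ} (hc₀ : 0 < c₀) :
    ∃ C : ℝ, 0 < C ∧ ∀ β ∈ Set.Ioo 0 (Real.pi / 2), c₀ ≤ Real.cos β →
      ∀ A B : ℝ, A ≤ B → B ≤ A + Real.pi →
        Real.exp (-C * β ^ 3) * balance (B - A) ^ 2 ≤ ∫ x, balance (newLen β A B x) ^ 2 ∂unif := by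
  have hpi := Real.pi_pos
  have hc' := cos_three_pi_div_eight_pos
  -- Below `1 / 8` the small-particle bound applies with `128 * β ^ 3 ≤ 1 / 2`.
  set γ := 2 / Real.pi ^ 4 * (2 * (1 / 8) * (2 * c₀ * Real.cos (3 * Real.pi / 8))) ^ 2 with hγ
  have hγ0 : 0 < γ := by positivity
  refine ⟨max 256 (512 * -Real.log γ), lt_of_lt_of_le (by norm_num) (le_max_left _ _), ?_⟩
  intro β hβ hβc A B hAB hBA
  have hβ0 := hβ.1
  rcases le_or_gt β (1 / 8) with h | h
  · refine le_trans ?_ (le_integral_balance_sq_of_small hβ (by linarith) hAB hBA)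
    gcongr
    have h3 : β ^ 3 ≤ (1 / 8) ^ 3 := pow_le_pow_left₀ hβ0.le h 3
    refine le_trans ?_ (exp_neg_two_mul_le (y := 128 * β ^ 3) (by positivity) (by linarith))
    rw [Real.exp_le_exp]
    have := mul_le_mul_of_nonneg_right (le_max_left 256 (512 * -Real.log γ))
      (show 0 ≤ β ^ 3 by positivity)
    linarith
  · refine le_trans ?_ (le_integral_balance_sq_of_large hβ hAB hBA)
    gcongr
    have h3 : (1 / 8) ^ 3 ≤ β ^ 3 := pow_le_pow_left₀ (by norm_num) h.le 3
    calc Real.exp (-max 256 (512 * -Real.log γ) * β ^ 3) ≤ Real.exp (Real.log γ) := by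
          rw [Real.exp_le_exp]
          have h4 := mul_le_mul_of_nonneg_left h3
            (show 0 ≤ max 256 (512 * -Real.log γ) from le_max_of_le_left (by norm_num))
          have h5 := le_max_right 256 (512 * -Real.log γ)
          linarith
      _ = γ := Real.exp_log hγ0
      _ ≤ _ := by
          rw [hγ]
          gcongr

end CHL

end

noncomputable section

namespace CHL

/-! ### Arcs under independent uniform particles -/

/-- The law of a sequence of independent uniform points of the circle. -/
def seqMeasure : Measure (ℕ → ℝ) := Measure.infinitePi fun _ => unif

instance : IsProbabilityMeasure seqMeasure := by
  unfold seqMeasure; infer_instance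

/-- A coordinate is independent of everything that is determined by finitely many others. -/
theorem map_prod_seqMeasure {S : Type*} [MeasurableSpace S] {Z : (ℕ → ℝ) → S}
    (hZ : Measurable Z) (n : ℕ) {T : Finset ℕ} (hT : n ∉ T)
    (hdep : ∀ x y : ℕ → ℝ, (∀ i ∈ T, x i = y i) → Z x = Z y) :
    seqMeasure.map (fun x => (x n, Z x)) = unif.prod (seqMeasure.map Z) := by
  have hind := ProbabilityTheory.iIndepFun_infinitePi (P := fun _ : ℕ => unif)
    (X := fun _ (x : ℝ) => x) (fun _ => measurable_id)
  have h1 := hind.indepFun_finset {n} T (by simpa using hT) fun i => measurable_pi_apply i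
  have hψ : Measurable fun v : (T → ℝ) => Z fun i => if h : i ∈ T then v ⟨i, h⟩ else 0 := by
    refine hZ.comp (measurable_pi_lambda _ fun i => ?_)
    by_cases h : i ∈ T
    · simp only [h, dif_pos]
      exact measurable_pi_apply _
    · simp only [h, dif_neg, not_false_eq_true]
      exact measurable_const
  have hφ : Measurable fun v : (({n} : Finset ℕ) → ℝ) => v ⟨n, by simp⟩ := measurable_pi_apply _
  have h2 := h1.comp hφ hψ
  have h3 : (fun v : (T → ℝ) => Z fun i => if h : i ∈ T then v ⟨i, h⟩ else 0) ∘
      (fun (x : ℕ → ℝ) (i : T) => x i) = Z := by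
    ext1 x
    refine hdep _ _ fun i hi => ?_
    simp [hi]
  rw [h3] at h2
  have h4 := h2.map_prod_eq_prod_map_map
    (hφ.comp (measurable_pi_lambda _ fun i => measurable_pi_apply _)).aemeasurable hZ.aemeasurable
  have h5 : seqMeasure.map (fun x : ℕ → ℝ => x n) = unif :=
    Measure.infinitePi_map_eval (fun _ : ℕ => unif) n
  rw [← h5]
  exact h4

/-- The average over the sequence can be taken by averaging first over the coordinate `n`, with the
earlier coordinates, through which `Z` depends on the sequence, kept fixed. -/
theorem integral_seqMeasure {S : Type*} [MeasurableSpace S] {Z : (ℕ → ℝ) → S}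
    (hZ : Measurable Z) (n : ℕ) (hdep : ∀ x y : ℕ → ℝ, (∀ i < n, x i = y i) → Z x = Z y)
    {g : ℝ × S → ℝ} (hg : Measurable g) {C : ℝ} (hC : ∀ u x, |g (u, Z x)| ≤ C) :
    Integrable (fun x => ∫ u, g (u, Z x) ∂unif) seqMeasure ∧
      ∫ x, g (x n, Z x) ∂seqMeasure = ∫ x, ∫ u, g (u, Z x) ∂unif ∂seqMeasure := by
  have hmap := map_prod_seqMeasure hZ n (T := Finset.range n) (by simp)
    fun x y h => hdep x y fun i hi => h i (by simpa using hi)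
  have hm : Measurable fun x : ℕ → ℝ => (x n, Z x) := (measurable_pi_apply n).prodMk hZ
  have hint : Integrable g (unif.prod (seqMeasure.map Z)) := by
    rw [← hmap, integrable_map_measure hg.aestronglyMeasurable hm.aemeasurable]
    exact integrable_of_bounded (hg.comp hm) fun x => hC _ _
  have hsm : AEStronglyMeasurable (fun z => ∫ u, g (u, z) ∂unif) (seqMeasure.map Z) :=
    hint.integral_prod_right.aestronglyMeasurable
  refine ⟨?_, ?_⟩
  · exact (integrable_map_measure hsm hZ.aemeasurable).1 hint.integral_prod_right
  calc ∫ x, g (x n, Z x) ∂seqMeasure = ∫ p, g p ∂(seqMeasure.map fun x => (x n, Z x)) :=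
        (integral_map hm.aemeasurable hg.aestronglyMeasurable).symm
    _ = ∫ z, ∫ u, g (u, z) ∂unif ∂(seqMeasure.map Z) := by
        have : SFinite (seqMeasure.map Z) := inferInstance
        rw [hmap, integral_prod_symm g hint]
    _ = _ := integral_map hZ.aemeasurable hsm

/-- The end point after `n` particles of an arc with initial end point `a`. -/
def flow (β : ℝ) (x : ℕ → ℝ) (a : ℝ) : ℕ → ℝ
  | 0 => a
  | n + 1 => push β (x n) (flow β x a n)

theorem flow_add_pi (β : ℝ) (x : ℕ → ℝ) (a : ℝ) (n : ℕ) :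
    flow β x (a + Real.pi) n = flow β x a n + Real.pi := by
  induction n with
  | zero => rfl
  | succ n ih => rw [flow, flow, ih, push_add_pi]

theorem flow_mono {β : ℝ} (hβ : β ∈ Set.Ioo 0 (Real.pi / 2)) (x : ℕ → ℝ) {a b : ℝ} (hab : a ≤ b)
    (n : ℕ) : flow β x a n ≤ flow β x b n := by
  induction n with
  | zero => exact hab
  | succ n ih => exact push_mono hβ _ ih

theorem flow_le_add_pi {β : ℝ} (hβ : β ∈ Set.Ioo 0 (Real.pi / 2)) (x : ℕ → ℝ) {a b : ℝ}
    (hba : b ≤ a + Real.pi) (n : ℕ) : flow β x b n ≤ flow β x a n + Real.pi := by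
  rw [← flow_add_pi]
  exact flow_mono hβ x hba n

theorem flow_congr (β : ℝ) {x y : ℕ → ℝ} (a : ℝ) {n : ℕ} (h : ∀ i < n, x i = y i) :
    flow β x a n = flow β y a n := by
  induction n with
  | zero => rfl
  | succ n ih => rw [flow, flow, ih fun i hi => h i (by omega), h n (by omega)]

theorem measurable_flow {β : ℝ} (hβ : β ∈ Set.Ioo 0 (Real.pi / 2)) (a : ℝ) (n : ℕ) :
    Measurable fun x : ℕ → ℝ => flow β x a n := by
  induction n with
  | zero => exact measurable_const
  | succ n ih => exact (measurable_push hβ).comp ((measurable_pi_apply n).prodMk ih)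

/-- The particle `n` arrives in the arc with initial end points `a` and `b`. -/
def Hit (β a b : ℝ) (n : ℕ) (x : ℕ → ℝ) : Prop :=
  ArcHit (flow β x a n) (flow β x b n) (x n)

theorem hit_compl {β : ℝ} (hβ : β ∈ Set.Ioo 0 (Real.pi / 2)) {a b : ℝ} (hab : a ≤ b)
    (hba : b ≤ a + Real.pi) (n : ℕ) (x : ℕ → ℝ) :
    Hit β b (a + Real.pi) n x ↔ ¬Hit β a b n x := by
  rw [Hit, Hit, flow_add_pi]
  exact arcHit_compl (flow_mono hβ x hab n) (flow_le_add_pi hβ x hba n) (x n)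

theorem hit_congr (β a b : ℝ) {n : ℕ} {x y : ℕ → ℝ} (h : ∀ i ≤ n, x i = y i) :
    Hit β a b n x ↔ Hit β a b n y := by
  rw [Hit, Hit, flow_congr β a fun i hi => h i hi.le, flow_congr β b fun i hi => h i hi.le,
    h n le_rfl]

theorem measurableSet_hit {β : ℝ} (hβ : β ∈ Set.Ioo 0 (Real.pi / 2)) (a b : ℝ) (n : ℕ) :
    MeasurableSet {x | Hit β a b n x} :=
  measurableSet_arcHit.preimage
    (((measurable_flow hβ a n).prodMk (measurable_flow hβ b n)).prodMk (measurable_pi_apply n))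

/-- The length after `n` particles of the arc with initial end points `a` and `b`. -/
def len (β a b : ℝ) (n : ℕ) (x : ℕ → ℝ) : ℝ := flow β x b n - flow β x a n

theorem len_mem {β : ℝ} (hβ : β ∈ Set.Ioo 0 (Real.pi / 2)) {a b : ℝ} (hab : a ≤ b)
    (hba : b ≤ a + Real.pi) (n : ℕ) (x : ℕ → ℝ) : len β a b n x ∈ Set.Icc 0 Real.pi := by
  have h1 := flow_mono hβ x hab n
  have h2 := flow_le_add_pi hβ x hba n
  constructor <;> rw [len] <;> linarith

theorem len_succ (β a b : ℝ) (n : ℕ) (x : ℕ → ℝ) :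
    len β a b (n + 1) x = newLen β (flow β x a n) (flow β x b n) (x n) := rfl

theorem len_compl (β a b : ℝ) (n : ℕ) (x : ℕ → ℝ) :
    len β b (a + Real.pi) n x = Real.pi - len β a b n x := by
  rw [len, len, flow_add_pi]; ring

theorem measurable_len {β : ℝ} (hβ : β ∈ Set.Ioo 0 (Real.pi / 2)) (a b : ℝ) (n : ℕ) :
    Measurable (len β a b n) :=
  (measurable_flow hβ b n).sub (measurable_flow hβ a n)

theorem measurable_newLen_prod {β : ℝ} (hβ : β ∈ Set.Ioo 0 (Real.pi / 2)) :
    Measurable fun p : ℝ × ℝ × ℝ => newLen β p.2.1 p.2.2 p.1 :=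
  ((measurable_push hβ).comp (measurable_fst.prodMk measurable_snd.snd)).sub
    ((measurable_push hβ).comp (measurable_fst.prodMk measurable_snd.fst))

/-- The Markov property: averaging over the particle `n`, given the past. -/
theorem integral_step {β : ℝ} (hβ : β ∈ Set.Ioo 0 (Real.pi / 2)) {a b : ℝ} (n : ℕ)
    {w : (ℕ → ℝ) → ℝ} (hw : Measurable w) (hdep : ∀ x y : ℕ → ℝ, (∀ i < n, x i = y i) → w x = w y)
    {g : ℝ × ℝ × ℝ → ℝ} (hg : Measurable g) {C : ℝ}
    (hC : ∀ u x, |w x * g (u, flow β x a n, flow β x b n)| ≤ C) :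
    Integrable (fun x => w x * ∫ u, g (u, flow β x a n, flow β x b n) ∂unif) seqMeasure ∧
      ∫ x, w x * g (x n, flow β x a n, flow β x b n) ∂seqMeasure =
        ∫ x, w x * ∫ u, g (u, flow β x a n, flow β x b n) ∂unif ∂seqMeasure := by
  have := integral_seqMeasure (S := ℝ × ℝ × ℝ)
    (Z := fun x => (w x, flow β x a n, flow β x b n))
    (hw.prodMk ((measurable_flow hβ a n).prodMk (measurable_flow hβ b n))) n
    (fun x y h => by rw [hdep x y h, flow_congr β a h, flow_congr β b h])
    (g := fun p => p.2.1 * g (p.1, p.2.2)) (by fun_prop) hC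
  simpa only [integral_const_mul] using this

/-- The expected variance of the change of an arc caused by the particle `n`. -/
def meanVariance (β a b : ℝ) (n : ℕ) : ℝ :=
  ∫ x, variance β (flow β x a n) (flow β x b n) ∂seqMeasure

theorem measurable_incr_prod {β : ℝ} (hβ : β ∈ Set.Ioo 0 (Real.pi / 2)) :
    Measurable fun p : ℝ × ℝ × ℝ => incr β p.2.1 p.2.2 p.1 :=
  ((measurable_disp hβ).comp (measurable_snd.snd.sub measurable_fst)).sub
    ((measurable_disp hβ).comp (measurable_snd.fst.sub measurable_fst))

theorem integrable_variance {β : ℝ} (hβ : β ∈ Set.Ioo 0 (Real.pi / 2)) (a b : ℝ) (n : ℕ) :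
    Integrable (fun x => variance β (flow β x a n) (flow β x b n)) seqMeasure := by
  have := (integral_step hβ (a := a) (b := b) n (w := fun _ => 1) measurable_const
    (fun _ _ _ => rfl) (g := fun p => incr β p.2.1 p.2.2 p.1 ^ 2)
    ((measurable_incr_prod hβ).pow_const 2) (C := (2 * β) ^ 2) fun u x => by
      simpa using abs_incr_sq_le hβ (flow β x a n) (flow β x b n) u).1
  simpa only [one_mul, variance] using this

theorem measurable_balance : Measurable balance := by
  unfold balance; fun_prop

theorem abs_balance_le {q : ℝ} (hq : q ∈ Set.Icc 0 Real.pi) : |balance q| ≤ Real.pi ^ 2 / 4 := by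
  rw [abs_of_nonneg (balance_nonneg hq)]
  exact balance_le q

theorem integrable_balance_len {β : ℝ} (hβ : β ∈ Set.Ioo 0 (Real.pi / 2)) {a b : ℝ} (hab : a ≤ b)
    (hba : b ≤ a + Real.pi) (n : ℕ) :
    Integrable (fun x => balance (len β a b n x)) seqMeasure :=
  integrable_of_bounded (measurable_balance.comp (measurable_len hβ a b n)) fun x =>
    abs_balance_le (len_mem hβ hab hba n x)

theorem integral_balance_len_succ {β : ℝ} (hβ : β ∈ Set.Ioo 0 (Real.pi / 2)) {a b : ℝ}
    (hab : a ≤ b) (hba : b ≤ a + Real.pi) (n : ℕ) :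
    ∫ x, balance (len β a b (n + 1) x) ∂seqMeasure =
      ∫ x, balance (len β a b n x) ∂seqMeasure - meanVariance β a b n := by
  have := (integral_step hβ (a := a) (b := b) n (w := fun _ => 1) measurable_const
    (fun _ _ _ => rfl) (g := fun p => balance (newLen β p.2.1 p.2.2 p.1))
    (measurable_balance.comp (measurable_newLen_prod hβ)) (C := Real.pi ^ 2 / 4) fun u x => by
      simpa using abs_balance_le (newLen_mem hβ (flow_mono hβ x hab n)
        (flow_le_add_pi hβ x hba n) u)).2
  simp only [one_mul, integral_balance hβ] at this
  rw [meanVariance, ← integral_sub (integrable_balance_len hβ hab hba n)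
    (integrable_variance hβ a b n)]
  exact this

/-- The arc or its complement takes over: each particle multiplies the expected balance by a
factor of at most `1 - β ^ 3 / (2 * π ^ 3)`. -/
theorem integral_balance_len_le {β : ℝ} (hβ : β ∈ Set.Ioo 0 (Real.pi / 2)) {a b : ℝ}
    (hab : a ≤ b) (hba : b ≤ a + Real.pi) (n : ℕ) :
    ∫ x, balance (len β a b n x) ∂seqMeasure ≤
      Real.exp (-(β ^ 3 / (2 * Real.pi ^ 3)) * n) * balance (b - a) := by
  induction n with
  | zero => simp [len, flow]
  | succ n ih =>
    have h1 : β ^ 3 / (2 * Real.pi ^ 3) * ∫ x, balance (len β a b n x) ∂seqMeasure ≤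
        meanVariance β a b n := by
      rw [← integral_const_mul]
      exact integral_mono ((integrable_balance_len hβ hab hba n).const_mul _)
        (integrable_variance hβ a b n) fun x =>
          balance_le_variance hβ (flow_mono hβ x hab n) (flow_le_add_pi hβ x hba n)
    have h2 : 0 ≤ ∫ x, balance (len β a b n x) ∂seqMeasure :=
      integral_nonneg fun x => balance_nonneg (len_mem hβ hab hba n x)
    have h3 := Real.add_one_le_exp (-(β ^ 3 / (2 * Real.pi ^ 3)))
    rw [integral_balance_len_succ hβ hab hba n]
    calc _ ≤ (1 - β ^ 3 / (2 * Real.pi ^ 3)) * ∫ x, balance (len β a b n x) ∂seqMeasure := by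
          linarith
      _ ≤ Real.exp (-(β ^ 3 / (2 * Real.pi ^ 3))) * ∫ x, balance (len β a b n x) ∂seqMeasure := by
          gcongr
          linarith
      _ ≤ Real.exp (-(β ^ 3 / (2 * Real.pi ^ 3))) *
          (Real.exp (-(β ^ 3 / (2 * Real.pi ^ 3)) * n) * balance (b - a)) := by gcongr
      _ = _ := by
          rw [← mul_assoc, ← Real.exp_add]
          push_cast
          ring_nf

/-- Telescoping: the balance is nonnegative, and the particle `m` reduces its expectation by exactly
`meanVariance β a b m`. -/
theorem sum_meanVariance_le {β : ℝ} (hβ : β ∈ Set.Ioo 0 (Real.pi / 2)) {a b : ℝ}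
    (hab : a ≤ b) (hba : b ≤ a + Real.pi) (n M : ℕ) :
    ∑ m ∈ Finset.range M, meanVariance β a b (n + m) ≤
      ∫ x, balance (len β a b n x) ∂seqMeasure := by
  have h : ∑ m ∈ Finset.range M, meanVariance β a b (n + m) =
      ∫ x, balance (len β a b n x) ∂seqMeasure -
        ∫ x, balance (len β a b (n + M) x) ∂seqMeasure := by
    induction M with
    | zero => simp
    | succ M ih =>
      rw [Finset.sum_range_succ, ih, ← add_assoc, integral_balance_len_succ hβ hab hba]
      ring
  have h2 : 0 ≤ ∫ x, balance (len β a b (n + M) x) ∂seqMeasure :=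
    integral_nonneg fun x => balance_nonneg (len_mem hβ hab hba _ x)
  linarith

end CHL

end

noncomputable section

namespace CHL

/-! ### The maximal inequality and the decay of the competition -/

/-- After `m` particles the arc has a length in `R`, and none of the next `k` particles arrives in
it. -/
def missed (β a b : ℝ) (R : Set ℝ) (m k : ℕ) : Set (ℕ → ℝ) :=
  {x | len β a b m x ∈ R ∧ ∀ j < k, ¬Hit β a b (m + j) x}

theorem measurableSet_missed {β : ℝ} (hβ : β ∈ Set.Ioo 0 (Real.pi / 2)) (a b : ℝ) {R : Set ℝ}
    (hR : MeasurableSet R) (m k : ℕ) : MeasurableSet (missed β a b R m k) := by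
  have : missed β a b R m k = (len β a b m ⁻¹' R) ∩ ⋂ j, ⋂ _ : j < k, {x | Hit β a b (m + j) x}ᶜ := by
    ext x
    simp [missed]
  rw [this]
  exact (measurable_len hβ a b m hR).inter
    (MeasurableSet.iInter fun j => MeasurableSet.iInter fun _ =>
      (measurableSet_hit hβ a b _).compl)

theorem missed_congr (β a b : ℝ) (R : Set ℝ) {m k : ℕ} {x y : ℕ → ℝ}
    (h : ∀ i < m + k, x i = y i) : x ∈ missed β a b R m k ↔ y ∈ missed β a b R m k := by
  simp only [missed, Set.mem_ofPred_eq]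
  refine and_congr ?_ (forall₂_congr fun j hj => not_congr ?_)
  · rw [len, len, flow_congr β a fun i hi => h i (by omega),
      flow_congr β b fun i hi => h i (by omega)]
  · exact hit_congr β a b fun i hi => h i (by omega)

/-- The maximal inequality for the length of an arc: an arc that receives a particle has a length
of at least `2β`, while the expected length does not change. -/
theorem real_exists_hit_le {β : ℝ} (hβ : β ∈ Set.Ioo 0 (Real.pi / 2)) {a b : ℝ} (hab : a ≤ b)
    (hba : b ≤ a + Real.pi) {R : Set ℝ} (hR : MeasurableSet R) (m : ℕ) :
    seqMeasure.real {x | len β a b m x ∈ R ∧ ∃ k, Hit β a b (m + k) x} ≤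
      (∫ x, R.indicator (fun q => q) (len β a b m x) ∂seqMeasure) / (2 * β) := by
  have hβ0 := hβ.1
  set w : ℕ → (ℕ → ℝ) → ℝ := fun k => (missed β a b R m k).indicator fun _ => 1 with hw
  have hwm : ∀ k, Measurable (w k) := fun k =>
    measurable_const.indicator (measurableSet_missed hβ a b hR m k)
  have hw01 : ∀ k x, w k x ∈ Set.Icc (0 : ℝ) 1 := by
    intro k x
    by_cases h : x ∈ missed β a b R m k <;> simp [hw, h]
  have hwlen : ∀ k l x, |w k x * len β a b l x| ≤ Real.pi := by
    intro k l x
    have h1 := hw01 k x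
    have h2 := len_mem hβ hab hba l x
    rw [abs_of_nonneg (mul_nonneg h1.1 h2.1)]
    nlinarith [h1.1, h1.2, h2.1, h2.2]
  have hint : ∀ k l, Integrable (fun x => w k x * len β a b l x) seqMeasure := fun k l =>
    integrable_of_bounded ((hwm k).mul (measurable_len hβ a b l)) (hwlen k l)
  have hintw : ∀ k, Integrable (w k) seqMeasure := fun k =>
    integrable_of_bounded (hwm k) (C := 1) fun x => by
      rw [abs_of_nonneg (hw01 k x).1]; exact (hw01 k x).2
  have hstep : ∀ k, ∫ x, w k x * len β a b (m + k + 1) x ∂seqMeasure =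
      ∫ x, w k x * len β a b (m + k) x ∂seqMeasure := by
    intro k
    have := (integral_step hβ (a := a) (b := b) (m + k) (hwm k) (fun x y h => by
      have := missed_congr β a b R (m := m) (k := k) h
      by_cases h' : x ∈ missed β a b R m k
      · simp [hw, h', this.1 h']
      · simp [hw, h', mt this.2 h'])
      (g := fun p => newLen β p.2.1 p.2.2 p.1) (measurable_newLen_prod hβ) (C := Real.pi)
      fun u x => by
        have h1 := hw01 k x
        have h2 := newLen_mem hβ (flow_mono hβ x hab (m + k)) (flow_le_add_pi hβ x hba (m + k)) u
        rw [abs_of_nonneg (mul_nonneg h1.1 h2.1)]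
        nlinarith [h1.1, h1.2, h2.1, h2.2]).2
    simp only [integral_newLen hβ] at this
    exact this
  have hpt : ∀ k x, w (k + 1) x * len β a b (m + k + 1) x + 2 * β * (w k x - w (k + 1) x) ≤
      w k x * len β a b (m + k + 1) x := by
    intro k x
    by_cases h1 : x ∈ missed β a b R m (k + 1)
    · have h2 : x ∈ missed β a b R m k := ⟨h1.1, fun j hj => h1.2 j (by omega)⟩
      simp [hw, h1, h2]
    · by_cases h2 : x ∈ missed β a b R m k
      · have h3 : Hit β a b (m + k) x := by
          by_contra h4
          refine h1 ⟨h2.1, fun j hj => ?_⟩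
          rcases Nat.lt_succ_iff_lt_or_eq.1 hj with h | h
          · exact h2.2 j h
          · rwa [h]
        have : 2 * β ≤ len β a b (m + k + 1) x := two_mul_beta_le_of_arcHit hβ h3
        simpa [hw, h1, h2] using this
      · simp [hw, h1, h2]
  have hsum : ∀ k, ∫ x, w k x * len β a b (m + k) x ∂seqMeasure +
      2 * β * (∫ x, w 0 x ∂seqMeasure - ∫ x, w k x ∂seqMeasure) ≤
        ∫ x, w 0 x * len β a b m x ∂seqMeasure := by
    intro k
    induction k with
    | zero => simp
    | succ k ih =>
      have h1 : ∫ x, w (k + 1) x * len β a b (m + k + 1) x + 2 * β * (w k x - w (k + 1) x)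
          ∂seqMeasure ≤ ∫ x, w k x * len β a b (m + k + 1) x ∂seqMeasure :=
        integral_mono ((hint _ _).add (((hintw _).sub (hintw _)).const_mul _)) (hint _ _) (hpt k)
      have h2 : Integrable (fun x => 2 * β * (w k x - w (k + 1) x)) seqMeasure :=
        ((hintw _).sub (hintw _)).const_mul _
      rw [integral_add (hint _ _) h2, integral_const_mul, integral_sub (hintw _) (hintw _),
        hstep] at h1
      rw [← add_assoc]
      linarith
  have h0 : ∫ x, w 0 x * len β a b m x ∂seqMeasure =
      ∫ x, R.indicator (fun q => q) (len β a b m x) ∂seqMeasure := by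
    congr 1
    ext x
    by_cases h : len β a b m x ∈ R <;> simp [hw, missed, Set.indicator, h]
  have hbound : ∀ k, seqMeasure.real (missed β a b R m 0 \ missed β a b R m k) ≤
      (∫ x, R.indicator (fun q => q) (len β a b m x) ∂seqMeasure) / (2 * β) := by
    intro k
    have h1 := hsum k
    have h2 : 0 ≤ ∫ x, w k x * len β a b (m + k) x ∂seqMeasure :=
      integral_nonneg fun x => mul_nonneg (hw01 k x).1 (len_mem hβ hab hba _ x).1
    have h3 : ∀ k, ∫ x, w k x ∂seqMeasure = seqMeasure.real (missed β a b R m k) := fun k =>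
      integral_indicator_one (measurableSet_missed hβ a b hR m k)
    rw [h3, h3, h0] at h1
    have h4 : missed β a b R m k ⊆ missed β a b R m 0 := fun x hx => ⟨hx.1, by simp⟩
    rw [measureReal_sdiff h4 (measurableSet_missed hβ a b hR m k),
      le_div_iff₀ (by positivity)]
    linarith
  have hU : {x | len β a b m x ∈ R ∧ ∃ k, Hit β a b (m + k) x} =
      ⋃ k, missed β a b R m 0 \ missed β a b R m k := by
    ext x
    simp only [missed, Set.mem_ofPred_eq, Set.mem_iUnion, Set.mem_sdiff]
    constructor
    · rintro ⟨h, k, hk⟩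
      exact ⟨k + 1, ⟨h, by simp⟩, fun h' => h'.2 k (by omega) hk⟩
    · rintro ⟨k, ⟨h, -⟩, h'⟩
      refine ⟨h, ?_⟩
      by_contra! h''
      exact h' ⟨h, fun j _ => h'' j⟩
  have hmono : Monotone fun k => missed β a b R m 0 \ missed β a b R m k := by
    intro k l hkl
    exact Set.sdiff_subset_sdiff_right fun x hx => ⟨hx.1, fun j hj => hx.2 j (by omega)⟩
  rw [hU, measureReal_def, hmono.measure_iUnion]
  refine ENNReal.toReal_le_of_le_ofReal ((measureReal_nonneg).trans (hbound 0))
    (iSup_le fun k => ?_)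
  rw [← ofReal_measureReal]
  exact ENNReal.ofReal_le_ofReal (hbound k)

/-- Both the arc and its complement receive a particle after the first `m` particles. -/
def bothHit (β a b : ℝ) (m : ℕ) : Set (ℕ → ℝ) :=
  {x | (∃ k, m ≤ k ∧ Hit β a b k x) ∧ ∃ k, m ≤ k ∧ ¬Hit β a b k x}

theorem bothHit_anti (β a b : ℝ) {m n : ℕ} (h : m ≤ n) : bothHit β a b n ⊆ bothHit β a b m := by
  rintro x ⟨⟨k, hk, h1⟩, l, hl, h2⟩
  exact ⟨⟨k, h.trans hk, h1⟩, l, h.trans hl, h2⟩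

/-- If the arc or its complement is shorter than `β / 2`, then the maximal inequality applies to the
short one; otherwise the indicator function of the event is bounded by `1`.  In both cases the bound
is at most a multiple of the variance. -/
theorem real_bothHit_le {β : ℝ} (hβ : β ∈ Set.Ioo 0 (Real.pi / 2)) {a b : ℝ} (hab : a ≤ b)
    (hba : b ≤ a + Real.pi) (m : ℕ) :
    seqMeasure.real (bothHit β a b m) ≤ 8 * Real.pi / β ^ 3 * meanVariance β a b m := by
  have hβ0 := hβ.1
  have hpi := Real.pi_pos
  set low : Set ℝ := Set.Iio (β / 2) with hlow
  set mid : Set ℝ := Set.Icc (β / 2) (Real.pi - β / 2) with hmid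
  have hm1 : MeasurableSet low := measurableSet_Iio
  have hm2 : MeasurableSet mid := measurableSet_Icc
  have hsub : bothHit β a b m ⊆ ({x | len β a b m x ∈ low ∧ ∃ k, Hit β a b (m + k) x} ∪
      {x | len β b (a + Real.pi) m x ∈ low ∧ ∃ k, Hit β b (a + Real.pi) (m + k) x}) ∪
        len β a b m ⁻¹' mid := by
    rintro x ⟨⟨k, hk, h1⟩, l, hl, h2⟩
    rcases lt_or_ge (len β a b m x) (β / 2) with h | h
    · left; left
      exact ⟨h, k - m, by rwa [Nat.add_sub_cancel' hk]⟩
    rcases lt_or_ge (len β b (a + Real.pi) m x) (β / 2) with h' | h'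
    · left; right
      exact ⟨h', l - m, by rwa [Nat.add_sub_cancel' hl, hit_compl hβ hab hba]⟩
    · right
      rw [len_compl] at h'
      exact ⟨h, by linarith⟩
  have hlen := fun x => len_mem hβ hab hba m x
  have hI1 : Integrable (fun x => low.indicator (fun q => q) (len β a b m x)) seqMeasure := by
    refine integrable_of_bounded ((measurable_id.indicator hm1).comp (measurable_len hβ a b m))
      (C := Real.pi) fun x => ?_
    have := hlen x
    by_cases h : len β a b m x ∈ low <;> simp only [Set.indicator, h, if_true, if_false]
    · rw [abs_of_nonneg this.1]; exact this.2
    · simp [hpi.le]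
  have hI2 : Integrable (fun x => low.indicator (fun q => q) (len β b (a + Real.pi) m x))
      seqMeasure := by
    refine integrable_of_bounded ((measurable_id.indicator hm1).comp
      (measurable_len hβ b (a + Real.pi) m)) (C := Real.pi) fun x => ?_
    have := len_mem hβ hba (by linarith) m x (a := b) (b := a + Real.pi)
    by_cases h : len β b (a + Real.pi) m x ∈ low <;>
      simp only [Set.indicator, h, if_true, if_false]
    · rw [abs_of_nonneg this.1]; exact this.2
    · simp [hpi.le]
  have hI3 : Integrable ((len β a b m ⁻¹' mid).indicator fun _ => (1 : ℝ)) seqMeasure :=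
    (integrable_const 1).indicator (measurable_len hβ a b m hm2)
  calc seqMeasure.real (bothHit β a b m)
      ≤ seqMeasure.real {x | len β a b m x ∈ low ∧ ∃ k, Hit β a b (m + k) x} +
        seqMeasure.real {x | len β b (a + Real.pi) m x ∈ low ∧
          ∃ k, Hit β b (a + Real.pi) (m + k) x} + seqMeasure.real (len β a b m ⁻¹' mid) :=
        (measureReal_mono hsub).trans ((measureReal_union_le _ _).trans
          (add_le_add_left (measureReal_union_le _ _) _))
    _ ≤ (∫ x, low.indicator (fun q => q) (len β a b m x) ∂seqMeasure) / (2 * β) +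
        (∫ x, low.indicator (fun q => q) (len β b (a + Real.pi) m x) ∂seqMeasure) / (2 * β) +
        ∫ x, (len β a b m ⁻¹' mid).indicator (fun _ => (1 : ℝ)) x ∂seqMeasure := by
        refine add_le_add (add_le_add (real_exists_hit_le hβ hab hba hm1 m)
          (real_exists_hit_le hβ hba (by linarith) hm1 m)) (le_of_eq ?_)
        exact (integral_indicator_one (measurable_len hβ a b m hm2)).symm
    _ = ∫ x, low.indicator (fun q => q) (len β a b m x) / (2 * β) +
          low.indicator (fun q => q) (len β b (a + Real.pi) m x) / (2 * β) +
          (len β a b m ⁻¹' mid).indicator (fun _ => (1 : ℝ)) x ∂seqMeasure := by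
        have h4 : Integrable (fun x => low.indicator (fun q => q) (len β a b m x) / (2 * β) +
          low.indicator (fun q => q) (len β b (a + Real.pi) m x) / (2 * β)) seqMeasure :=
          (hI1.div_const _).add (hI2.div_const _)
        rw [integral_add h4 hI3, integral_add (hI1.div_const _) (hI2.div_const _),
          integral_div, integral_div]
    _ ≤ ∫ x, 8 * Real.pi / β ^ 3 * variance β (flow β x a m) (flow β x b m) ∂seqMeasure := by
        refine integral_mono (((hI1.div_const _).add (hI2.div_const _)).add hI3)
          ((integrable_variance hβ a b m).const_mul _) fun x => ?_
        have hv := le_variance hβ (flow_mono hβ x hab m) (flow_le_add_pi hβ x hba m)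
        have hl := hlen x
        rw [len_compl]
        change len β a b m x ∈ Set.Icc 0 Real.pi at hl
        have hfl : flow β x b m - flow β x a m = len β a b m x := rfl
        rw [hfl] at hv
        set q := len β a b m x with hq
        set v := variance β (flow β x a m) (flow β x b m) with hvdef
        have hmin : 2 / β * min (min q (Real.pi - q)) (β / 2) ≤ 8 * Real.pi / β ^ 3 * v := by
          calc 2 / β * min (min q (Real.pi - q)) (β / 2) = 8 * Real.pi / β ^ 3 *
                (β ^ 2 / (4 * Real.pi) * min (min q (Real.pi - q)) (β / 2)) := by
                field_simp; ring
            _ ≤ _ := by gcongr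
        refine le_trans ?_ hmin
        have hb := hβ.2
        have hxm : x ∈ len β a b m ⁻¹' mid ↔ q ∈ mid := Iff.rfl
        rcases lt_or_ge q (β / 2) with h | h
        · have e1 : q ∈ low := h
          have e2 : Real.pi - q ∉ low := by
            simp only [hlow, Set.mem_Iio, not_lt]; linarith
          have e3 : q ∉ mid := fun h' => absurd h'.1 (not_le.2 h)
          rw [min_eq_left (show q ≤ Real.pi - q by linarith), min_eq_left h.le]
          simp only [Set.indicator, e1, e2, hxm, e3, if_true, if_false]
          rw [zero_div, add_zero, add_zero, div_le_iff₀ (by positivity)]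
          have : 2 / β * q * (2 * β) = 4 * q := by field_simp; ring
          rw [this]
          linarith [hl.1]
        rcases lt_or_ge (Real.pi - q) (β / 2) with h' | h'
        · have e1 : q ∉ low := not_lt.2 h
          have e2 : Real.pi - q ∈ low := h'
          have e3 : q ∉ mid := fun h'' => by linarith [h''.2]
          rw [min_eq_right (show Real.pi - q ≤ q by linarith), min_eq_left h'.le]
          simp only [Set.indicator, e1, e2, hxm, e3, if_true, if_false]
          rw [zero_div, zero_add, add_zero, div_le_iff₀ (by positivity)]
          have : 2 / β * (Real.pi - q) * (2 * β) = 4 * (Real.pi - q) := by field_simp; ring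
          rw [this]
          linarith [hl.2]
        · have e1 : q ∉ low := not_lt.2 h
          have e2 : Real.pi - q ∉ low := not_lt.2 h'
          have e3 : q ∈ mid := ⟨h, by linarith⟩
          rw [min_eq_right (le_min h h')]
          simp only [Set.indicator, e1, e2, hxm, e3, if_true, if_false]
          rw [zero_div, add_zero, zero_add]
          exact le_of_eq (by field_simp)
    _ = _ := by rw [integral_const_mul, meanVariance]

/-- The average of `real_bothHit_le` over the particles `n, …, 2n - 1`.  The gain over a direct use
of the maximal inequality is that the bound is linear in the length `b - a` of the arc. -/
theorem real_bothHit_two_mul_le {β : ℝ} (hβ : β ∈ Set.Ioo 0 (Real.pi / 2)) {a b : ℝ} (hab : a ≤ b)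
    (hba : b ≤ a + Real.pi) {n : ℕ} (hn : 0 < n) :
    seqMeasure.real (bothHit β a b (2 * n)) ≤
      8 * Real.pi ^ 2 / (β ^ 3 * n) * Real.exp (-(β ^ 3 / (2 * Real.pi ^ 3)) * n) * (b - a) := by
  have hβ0 := hβ.1
  have hpi := Real.pi_pos
  have hn' : (0 : ℝ) < n := by exact_mod_cast hn
  have h1 : n * seqMeasure.real (bothHit β a b (2 * n)) ≤
      8 * Real.pi / β ^ 3 * (Real.exp (-(β ^ 3 / (2 * Real.pi ^ 3)) * n) *
        (Real.pi * (b - a))) := by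
    calc n * seqMeasure.real (bothHit β a b (2 * n))
        = ∑ _m ∈ Finset.range n, seqMeasure.real (bothHit β a b (2 * n)) := by simp
      _ ≤ ∑ m ∈ Finset.range n, 8 * Real.pi / β ^ 3 * meanVariance β a b (n + m) := by
          refine Finset.sum_le_sum fun m hm => ?_
          have := Finset.mem_range.1 hm
          exact (measureReal_mono (bothHit_anti β a b (by omega))).trans
            (real_bothHit_le hβ hab hba (n + m))
      _ ≤ 8 * Real.pi / β ^ 3 * ∫ x, balance (len β a b n x) ∂seqMeasure := by
          rw [← Finset.mul_sum]
          gcongr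
          exact sum_meanVariance_le hβ hab hba n n
      _ ≤ 8 * Real.pi / β ^ 3 * (Real.exp (-(β ^ 3 / (2 * Real.pi ^ 3)) * n) *
          balance (b - a)) := by
          gcongr
          exact integral_balance_len_le hβ hab hba n
      _ ≤ _ := by
          gcongr
          refine (balance_le_min ⟨by linarith, by linarith⟩).trans ?_
          gcongr
          exact min_le_left _ _
  rw [mul_comm, ← le_div_iff₀ hn'] at h1
  refine h1.trans (le_of_eq ?_)
  field_simp

end CHL

end

noncomputable section

namespace CHL

/-! ### The persistence of the competition -/

/-- Of the particles `m` and `m + 1`, one arrives in the arc and the other one in its complement. -/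
def switch (β a b : ℝ) (m : ℕ) : Set (ℕ → ℝ) :=
  {x | ¬(Hit β a b m x ↔ Hit β a b (m + 1) x)}

theorem measurableSet_switch {β : ℝ} (hβ : β ∈ Set.Ioo 0 (Real.pi / 2)) (a b : ℝ) (m : ℕ) :
    MeasurableSet (switch β a b m) := by
  have h1 := measurableSet_hit hβ a b m
  have h2 := measurableSet_hit hβ a b (m + 1)
  have : switch β a b m = ({x | Hit β a b m x} \ {x | Hit β a b (m + 1) x}) ∪
      ({x | Hit β a b (m + 1) x} \ {x | Hit β a b m x}) := by
    ext x
    simp only [switch, Set.mem_ofPred_eq, Set.mem_union, Set.mem_sdiff]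
    tauto
  rw [this]
  exact (h1.diff h2).union (h2.diff h1)

theorem real_switch {β : ℝ} (hβ : β ∈ Set.Ioo 0 (Real.pi / 2)) {a b : ℝ} (hab : a ≤ b)
    (hba : b ≤ a + Real.pi) (m : ℕ) :
    Integrable (fun x => switchProb β (flow β x a m) (flow β x b m)) seqMeasure ∧
      seqMeasure.real (switch β a b m) =
        ∫ x, switchProb β (flow β x a m) (flow β x b m) ∂seqMeasure := by
  have hpi := Real.pi_pos
  set w : (ℕ → ℝ) → ℝ := {x | Hit β a b m x}.indicator fun _ => 1 with hw
  set h : (ℕ → ℝ) → ℝ := {x | Hit β a b (m + 1) x}.indicator fun _ => 1 with hh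
  have hwm : Measurable w := measurable_const.indicator (measurableSet_hit hβ a b m)
  have hhm : Measurable h := measurable_const.indicator (measurableSet_hit hβ a b (m + 1))
  have hw01 : ∀ x, w x = 0 ∨ w x = 1 := fun x => by
    by_cases h' : Hit β a b m x <;> simp [hw, h']
  have hh01 : ∀ x, h x = 0 ∨ h x = 1 := fun x => by
    by_cases h' : Hit β a b (m + 1) x <;> simp [hh, h']
  have hiw : Integrable w seqMeasure := integrable_of_bounded hwm (C := 1) fun x => by
    rcases hw01 x with h' | h' <;> simp [h']
  have hwh : Integrable (fun x => (1 - 2 * w x) * h x) seqMeasure := by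
    refine integrable_of_bounded (C := 1) (by fun_prop) fun x => ?_
    rcases hw01 x with h' | h' <;> rcases hh01 x with h'' | h'' <;> norm_num [h', h'']
  -- The sum below is the indicator function of the event.
  have h1 : seqMeasure.real (switch β a b m) =
      ∫ x, w x + (1 - 2 * w x) * h x ∂seqMeasure := by
    rw [← integral_indicator_one (measurableSet_switch hβ a b m)]
    congr 1
    ext x
    by_cases h' : Hit β a b m x <;> by_cases h'' : Hit β a b (m + 1) x <;>
      norm_num [switch, hw, hh, h', h'']
  have hlen : ∀ x, len β a b (m + 1) x / Real.pi ∈ Set.Icc 0 1 := fun x => by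
    have := len_mem hβ hab hba (m + 1) x
    exact ⟨div_nonneg this.1 hpi.le, (div_le_one hpi).2 this.2⟩
  have h2 : ∫ x, (1 - 2 * w x) * h x ∂seqMeasure =
      ∫ x, (1 - 2 * w x) * (len β a b (m + 1) x / Real.pi) ∂seqMeasure := by
    have := (integral_step hβ (a := a) (b := b) (m + 1) (w := fun x => 1 - 2 * w x) (by fun_prop)
      (fun x y hxy => by
        have := hit_congr β a b (n := m) (x := x) (y := y) fun i hi => hxy i (by omega)
        by_cases h' : Hit β a b m x
        · simp [hw, h', this.1 h']
        · simp [hw, h', mt this.2 h'])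
      (g := {p : ℝ × ℝ × ℝ | ArcHit p.2.1 p.2.2 p.1}.indicator fun _ => 1)
      (measurable_const.indicator (measurableSet_arcHit.preimage
        (measurable_snd.prodMk measurable_fst : Measurable fun p : ℝ × ℝ × ℝ => (p.2, p.1))))
      (C := 1) fun u x => by
        by_cases h' : ArcHit (flow β x a (m + 1)) (flow β x b (m + 1)) u <;>
          rcases hw01 x with h'' | h'' <;> norm_num [h', h'', Set.indicator]).2
    refine Eq.trans ?_ (this.trans ?_)
    · rfl
    · congr 1
      ext x
      congr 1
      exact unif_arcHit (flow_mono hβ x hab (m + 1)) (flow_le_add_pi hβ x hba (m + 1))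
  have h3 := integral_step hβ (a := a) (b := b) m (w := fun _ => 1) measurable_const
    (fun _ _ _ => rfl)
    (g := fun p => {p : ℝ × ℝ × ℝ | ArcHit p.2.1 p.2.2 p.1}.indicator
        (fun p => 1 - newLen β p.2.1 p.2.2 p.1 / Real.pi) p +
      {p : ℝ × ℝ × ℝ | ArcHit p.2.1 p.2.2 p.1}ᶜ.indicator
        (fun p => newLen β p.2.1 p.2.2 p.1 / Real.pi) p) (by
      have hm := measurableSet_arcHit.preimage
        (measurable_snd.prodMk measurable_fst : Measurable fun p : ℝ × ℝ × ℝ => (p.2, p.1))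
      have hn := (measurable_newLen_prod hβ).div_const Real.pi
      exact ((measurable_const.sub hn).indicator hm).add (hn.indicator hm.compl)) (C := 1)
    fun u x => by
      have := newLen_div_pi_mem hβ (flow_mono hβ x hab m) (flow_le_add_pi hβ x hba m) u
      by_cases h' : ArcHit (flow β x a m) (flow β x b m) u <;>
        simp [h', Set.indicator, abs_le] <;> constructor <;> linarith [this.1, this.2]
  simp only [one_mul] at h3
  refine ⟨h3.1, ?_⟩
  have hwl : Integrable (fun x => (1 - 2 * w x) * (len β a b (m + 1) x / Real.pi)) seqMeasure := by
    refine integrable_of_bounded (C := 1) ((measurable_const.sub (hwm.const_mul 2)).mul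
      ((measurable_len hβ a b (m + 1)).div_const _)) fun x => ?_
    have := hlen x
    rcases hw01 x with h' | h' <;> rw [h', abs_le] <;> constructor <;> linarith [this.1, this.2]
  rw [h1, integral_add hiw hwh, h2, ← integral_add hiw hwl]
  refine Eq.trans ?_ h3.2
  congr 1
  ext x
  by_cases h' : Hit β a b m x
  · have e : ArcHit (flow β x a m) (flow β x b m) (x m) := h'
    simp only [hw, Set.indicator, Set.mem_ofPred_eq, h', e, if_true, Set.mem_compl_iff,
      not_true_eq_false, if_false, len_succ]
    ring
  · have e : ¬ArcHit (flow β x a m) (flow β x b m) (x m) := h'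
    simp only [hw, Set.indicator, Set.mem_ofPred_eq, h', e, if_true, Set.mem_compl_iff,
      not_false_eq_true, if_false, len_succ]
    ring

/-- An arc of half the circle and its complement keep exchanging particles with a probability that
decays at most exponentially. -/
theorem exists_le_real_switch {c₀ : ℝ} (hc₀ : 0 < c₀) :
    ∃ c C : ℝ, 0 < c ∧ 0 < C ∧ ∀ β ∈ Set.Ioo 0 (Real.pi / 2), c₀ ≤ Real.cos β → ∀ m : ℕ,
      c * Real.exp (-C * β ^ 3 * m) ≤ seqMeasure.real (switch β 0 (Real.pi / 2) m) := by
  have hpi := Real.pi_pos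
  have hc' := cos_three_pi_div_eight_pos
  obtain ⟨C, hC, hstep⟩ := exists_le_integral_balance_sq hc₀
  refine ⟨c₀ * Real.cos (3 * Real.pi / 8) / Real.pi ^ 2 * (4 / Real.pi ^ 3) *
    balance (Real.pi / 2) ^ 2, C, ?_, hC, ?_⟩
  · have : 0 < balance (Real.pi / 2) := by
      rw [balance]
      exact mul_pos (by positivity) (by linarith)
    positivity
  intro β hβ hβc m
  have hab : (0 : ℝ) ≤ Real.pi / 2 := by positivity
  have hba : Real.pi / 2 ≤ 0 + Real.pi := by linarith
  have hint : ∀ n, Integrable (fun x => balance (len β 0 (Real.pi / 2) n x) ^ 2) seqMeasure := by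
    intro n
    refine integrable_of_bounded
      ((measurable_balance.comp (measurable_len hβ _ _ n)).pow_const 2)
      (C := (Real.pi ^ 2 / 4) ^ 2) fun x => ?_
    rw [abs_pow]
    exact pow_le_pow_left₀ (abs_nonneg _) (abs_balance_le (len_mem hβ hab hba n x)) 2
  have hdecay : ∀ n : ℕ, Real.exp (-C * β ^ 3 * n) * balance (Real.pi / 2) ^ 2 ≤
      ∫ x, balance (len β 0 (Real.pi / 2) n x) ^ 2 ∂seqMeasure := by
    intro n
    induction n with
    | zero => simp [len, flow]
    | succ n ih =>
      have h1 := integral_step hβ (a := 0) (b := Real.pi / 2) n (w := fun _ => 1) measurable_const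
        (fun _ _ _ => rfl) (g := fun p => balance (newLen β p.2.1 p.2.2 p.1) ^ 2)
        ((measurable_balance.comp (measurable_newLen_prod hβ)).pow_const 2)
        (C := (Real.pi ^ 2 / 4) ^ 2) fun u x => by
          rw [one_mul]
          exact (integrable_balance_sq hβ (flow_mono hβ x hab n) (flow_le_add_pi hβ x hba n)).2 u
      simp only [one_mul] at h1
      calc Real.exp (-C * β ^ 3 * (n + 1 : ℕ)) * balance (Real.pi / 2) ^ 2
          = Real.exp (-C * β ^ 3) *
              (Real.exp (-C * β ^ 3 * n) * balance (Real.pi / 2) ^ 2) := by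
            rw [← mul_assoc, ← Real.exp_add]
            push_cast
            ring_nf
        _ ≤ Real.exp (-C * β ^ 3) *
              ∫ x, balance (len β 0 (Real.pi / 2) n x) ^ 2 ∂seqMeasure := by gcongr
        _ = ∫ x, Real.exp (-C * β ^ 3) * balance (len β 0 (Real.pi / 2) n x) ^ 2 ∂seqMeasure :=
            (integral_const_mul _ _).symm
        _ ≤ _ := integral_mono ((hint n).const_mul _) h1.1 fun x =>
            hstep β hβ hβc _ _ (flow_mono hβ x hab n) (flow_le_add_pi hβ x hba n)
        _ = _ := h1.2.symm
  obtain ⟨hi, hs⟩ := real_switch hβ hab hba m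
  rw [hs]
  calc _ = c₀ * Real.cos (3 * Real.pi / 8) / Real.pi ^ 2 * (4 / Real.pi ^ 3) *
        (Real.exp (-C * β ^ 3 * m) * balance (Real.pi / 2) ^ 2) := by ring
    _ ≤ c₀ * Real.cos (3 * Real.pi / 8) / Real.pi ^ 2 * (4 / Real.pi ^ 3) *
        ∫ x, balance (len β 0 (Real.pi / 2) m x) ^ 2 ∂seqMeasure := by
        gcongr
        exact hdecay m
    _ = ∫ x, c₀ * Real.cos (3 * Real.pi / 8) / Real.pi ^ 2 * (4 / Real.pi ^ 3) *
        balance (len β 0 (Real.pi / 2) m x) ^ 2 ∂seqMeasure := (integral_const_mul _ _).symm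
    _ ≤ _ := by
        refine integral_mono ((hint m).const_mul _) hi fun x => ?_
        refine le_trans ?_ (le_switchProb hβ (flow_mono hβ x hab m) (flow_le_add_pi hβ x hba m))
        have hl := len_mem hβ hab hba m x
        have hfl : flow β x (Real.pi / 2) m - flow β x 0 m = len β 0 (Real.pi / 2) m x := rfl
        rw [hfl]
        set q := len β 0 (Real.pi / 2) m x
        have h1 := balance_le_min hl
        have h2 := balance_le q
        have h0 := balance_nonneg hl
        have h3 : balance q ^ 2 ≤ Real.pi ^ 3 / 4 * min q (Real.pi - q) := by
          calc balance q ^ 2 = balance q * balance q := sq _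
            _ ≤ (Real.pi ^ 2 / 4) * (Real.pi * min q (Real.pi - q)) := by gcongr
            _ = _ := by ring
        have h4 : 0 ≤ min q (Real.pi - q) := le_min hl.1 (by linarith [hl.2])
        calc c₀ * Real.cos (3 * Real.pi / 8) / Real.pi ^ 2 * (4 / Real.pi ^ 3) * balance q ^ 2
            ≤ c₀ * Real.cos (3 * Real.pi / 8) / Real.pi ^ 2 * (4 / Real.pi ^ 3) *
              (Real.pi ^ 3 / 4 * min q (Real.pi - q)) := by gcongr
          _ = c₀ * Real.cos (3 * Real.pi / 8) / Real.pi ^ 2 * min q (Real.pi - q) := by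
              field_simp
          _ ≤ _ := by gcongr

end CHL

end

noncomputable section

namespace CHL

/-! ### The feet of the trees -/

/-- The lift to `ℝ` of the collapsed boundary map of a slit map attached at `x`. -/
def pull (β x y : ℝ) : ℝ := x + inMap β (y - x)

/-- The lift to `ℝ` of the boundary map of the first `n` particles, where every tree is collapsed
to its foot on the circle. -/
def back (β : ℝ) (x : ℕ → ℝ) : ℕ → ℝ → ℝ
  | 0 => id
  | n + 1 => back β x n ∘ pull β (x n)

/-- The foot of the tree that receives the particle `n`, as a point of the circle `[0, π)`. -/
def foot (β : ℝ) (x : ℕ → ℝ) (n : ℕ) : ℝ := toIcoMod Real.pi_pos 0 (back β x n (x n))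

theorem pull_add_int_mul_pi (β x y : ℝ) (k : ℤ) :
    pull β x (y + k * Real.pi) = pull β x y + k * Real.pi := by
  rw [pull, pull, show y + k * Real.pi - x = y - x + k * Real.pi by ring, inMap_add_int_mul_pi]
  ring

theorem back_add_int_mul_pi (β : ℝ) (x : ℕ → ℝ) (n : ℕ) (y : ℝ) (k : ℤ) :
    back β x n (y + k * Real.pi) = back β x n y + k * Real.pi := by
  induction n generalizing y with
  | zero => rfl
  | succ n ih => rw [back, Function.comp, Function.comp, pull_add_int_mul_pi, ih]

/-- The end points of arcs move by the adjoint of the collapsed boundary map. -/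
theorem flow_le_iff {β : ℝ} (hβ : β ∈ Set.Ioo 0 (Real.pi / 2)) (x : ℕ → ℝ) (n : ℕ) (a y : ℝ) :
    flow β x a n ≤ y ↔ a ≤ back β x n y := by
  induction n generalizing y with
  | zero => rfl
  | succ n ih =>
    rw [flow, back, Function.comp, ← ih, push, pull, ← le_sub_iff_add_le', gc_outMap_inMap hβ _ _,
      sub_le_iff_le_add']

theorem hit_iff_back {β : ℝ} (hβ : β ∈ Set.Ioo 0 (Real.pi / 2)) (x : ℕ → ℝ) (n : ℕ) (a b : ℝ) :
    Hit β a b n x ↔ ∃ k : ℤ, a ≤ back β x n (x n) + k * Real.pi ∧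
      back β x n (x n) + k * Real.pi < b := by
  rw [Hit, ArcHit]
  refine exists_congr fun k => and_congr ?_ ?_
  · rw [flow_le_iff hβ, back_add_int_mul_pi]
  · rw [← not_le, flow_le_iff hβ, back_add_int_mul_pi, not_le]

theorem foot_mem (β : ℝ) (x : ℕ → ℝ) (n : ℕ) : foot β x n ∈ Set.Ico 0 Real.pi := by
  simpa [foot] using toIcoMod_mem_Ico Real.pi_pos 0 (back β x n (x n))

theorem foot_eq (β : ℝ) (x : ℕ → ℝ) (n : ℕ) :
    ∃ k : ℤ, foot β x n = back β x n (x n) + k * Real.pi := by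
  refine ⟨-toIcoDiv Real.pi_pos 0 (back β x n (x n)), ?_⟩
  have := self_sub_toIcoDiv_zsmul Real.pi_pos 0 (back β x n (x n))
  rw [foot, ← this, zsmul_eq_mul]
  push_cast
  ring

theorem foot_eq_iff (β : ℝ) (x : ℕ → ℝ) (m n : ℕ) :
    foot β x m = foot β x n ↔ ∃ k : ℤ, back β x m (x m) = back β x n (x n) + k * Real.pi := by
  obtain ⟨k, hk⟩ := foot_eq β x m
  obtain ⟨l, hl⟩ := foot_eq β x n
  constructor
  · intro h
    refine ⟨l - k, ?_⟩
    push_cast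
    linarith
  · rintro ⟨j, hj⟩
    rw [foot, foot, hj]
    have := toIcoMod_add_zsmul Real.pi_pos 0 (back β x n (x n)) j
    rwa [zsmul_eq_mul] at this

theorem hit_iff {β : ℝ} (hβ : β ∈ Set.Ioo 0 (Real.pi / 2)) (x : ℕ → ℝ) (n : ℕ) {a b : ℝ}
    (ha : 0 ≤ a) (hb : b ≤ Real.pi) : Hit β a b n x ↔ foot β x n ∈ Set.Ico a b := by
  have hpi := Real.pi_pos
  rw [hit_iff_back hβ]
  obtain ⟨k, hk⟩ := foot_eq β x n
  have hm := foot_mem β x n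
  constructor
  · rintro ⟨l, h1, h2⟩
    have hlk : l = k := by
      have h3 : (l : ℝ) < k + 1 := by
        by_contra! h
        nlinarith [hm.1]
      have h4 : (k : ℝ) < l + 1 := by
        by_contra! h
        nlinarith [hm.2]
      have : l < k + 1 := by exact_mod_cast h3
      have : k < l + 1 := by exact_mod_cast h4
      omega
    rw [hk, ← hlk]
    exact ⟨h1, h2⟩
  · intro h
    rw [hk] at h
    exact ⟨k, h.1, h.2⟩

theorem foot_ne_of_mem_switch {β : ℝ} (hβ : β ∈ Set.Ioo 0 (Real.pi / 2)) {m : ℕ} {x : ℕ → ℝ}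
    (hx : x ∈ switch β 0 (Real.pi / 2) m) : foot β x m ≠ foot β x (m + 1) := by
  intro h
  apply hx
  rw [hit_iff hβ _ _ le_rfl (by linarith [Real.pi_pos]),
    hit_iff hβ _ _ le_rfl (by linarith [Real.pi_pos]), h]

/-- The index of the dyadic arc of length `π / 2 ^ j` that contains the foot. -/
def dyadicIndex (β : ℝ) (j : ℕ) (x : ℕ → ℝ) (n : ℕ) : ℕ := ⌊2 ^ j * foot β x n / Real.pi⌋₊

theorem dyadicIndex_eq_of_succ {β : ℝ} {j : ℕ} {x : ℕ → ℝ} {m n : ℕ}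
    (h : dyadicIndex β (j + 1) x m = dyadicIndex β (j + 1) x n) :
    dyadicIndex β j x m = dyadicIndex β j x n := by
  have key : ∀ n, dyadicIndex β j x n = dyadicIndex β (j + 1) x n / 2 := by
    intro n
    have := Nat.floor_div_natCast (2 ^ (j + 1) * foot β x n / Real.pi) 2
    rw [dyadicIndex, dyadicIndex, ← this]
    congr 1
    push_cast
    ring
  rw [key, key, h]

/-- All trees but one have stopped growing after `2 * n` particles, up to an exponentially small
probability: the union bound over the arcs of a partition of the circle does not depend on the mesh
of the partition. -/
theorem seqMeasure_exists_foot_ne_le {β : ℝ} (hβ : β ∈ Set.Ioo 0 (Real.pi / 2)) {n : ℕ}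
    (hn : 0 < n) :
    seqMeasure {x | ∃ k l, 2 * n ≤ k ∧ 2 * n ≤ l ∧ foot β x k ≠ foot β x l} ≤
      ENNReal.ofReal (8 * Real.pi ^ 3 / (β ^ 3 * n) *
        Real.exp (-(β ^ 3 / (2 * Real.pi ^ 3)) * n)) := by
  have hpi := Real.pi_pos
  have hβ0 := hβ.1
  set D : ℕ → Set (ℕ → ℝ) := fun j =>
    {x | ∃ k l, 2 * n ≤ k ∧ 2 * n ≤ l ∧ dyadicIndex β j x k ≠ dyadicIndex β j x l} with hD
  have hsub : {x | ∃ k l, 2 * n ≤ k ∧ 2 * n ≤ l ∧ foot β x k ≠ foot β x l} ⊆ ⋃ j, D j := by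
    rintro x ⟨k, l, hk, hl, hkl⟩
    obtain ⟨j, hj⟩ := pow_unbounded_of_one_lt (Real.pi / |foot β x k - foot β x l|)
      (one_lt_two : (1 : ℝ) < 2)
    rw [Set.mem_iUnion]
    refine ⟨j, k, l, hk, hl, fun h => ?_⟩
    rw [div_lt_iff₀ (abs_pos.2 (sub_ne_zero.2 hkl))] at hj
    have hnn : ∀ m, 0 ≤ 2 ^ j * foot β x m / Real.pi := fun m => by
      have := (foot_mem β x m).1
      positivity
    have h1 := Nat.floor_le (hnn k)
    have h2 := Nat.lt_floor_add_one (2 ^ j * foot β x k / Real.pi)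
    have h3 := Nat.floor_le (hnn l)
    have h4 := Nat.lt_floor_add_one (2 ^ j * foot β x l / Real.pi)
    have h' : ⌊2 ^ j * foot β x k / Real.pi⌋₊ = ⌊2 ^ j * foot β x l / Real.pi⌋₊ := h
    rw [h'] at h1 h2
    have h5 : |2 ^ j * foot β x k / Real.pi - 2 ^ j * foot β x l / Real.pi| < 1 := by
      rw [abs_lt]
      constructor <;> linarith
    rw [← sub_div, ← mul_sub, abs_div, abs_mul, abs_of_pos hpi, abs_of_pos (by positivity),
      div_lt_one hpi] at h5
    linarith
  have hmono : Monotone D := by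
    refine monotone_nat_of_le_succ fun j => ?_
    rintro x ⟨k, l, hk, hl, hkl⟩
    exact ⟨k, l, hk, hl, fun h => hkl (dyadicIndex_eq_of_succ h)⟩
  refine (measure_mono hsub).trans ?_
  rw [hmono.measure_iUnion]
  refine iSup_le fun j => ?_
  have hDj : D j ⊆ ⋃ i ∈ Finset.range (2 ^ j),
      bothHit β (i * (Real.pi / 2 ^ j)) ((i + 1) * (Real.pi / 2 ^ j)) (2 * n) := by
    rintro x ⟨k, l, hk, hl, hkl⟩
    have hidx : ∀ m i, dyadicIndex β j x m = i ↔
        foot β x m ∈ Set.Ico (i * (Real.pi / 2 ^ j)) ((i + 1) * (Real.pi / 2 ^ j)) := by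
      intro m i
      have h0 := (foot_mem β x m).1
      rw [dyadicIndex, Nat.floor_eq_iff (by positivity), Set.mem_Ico, le_div_iff₀ hpi,
        div_lt_iff₀ hpi, ← mul_div_assoc, ← mul_div_assoc, div_le_iff₀ (by positivity),
        lt_div_iff₀ (by positivity), mul_comm (2 ^ j : ℝ)]
    have hlt : dyadicIndex β j x k < 2 ^ j := by
      rw [dyadicIndex, Nat.floor_lt (by have := (foot_mem β x k).1; positivity), div_lt_iff₀ hpi]
      push_cast
      have := (foot_mem β x k).2
      gcongr
    have hcast : ((dyadicIndex β j x k : ℝ) + 1) * (Real.pi / 2 ^ j) ≤ Real.pi := by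
      have : (dyadicIndex β j x k : ℝ) + 1 ≤ 2 ^ j := by exact_mod_cast hlt
      calc _ ≤ 2 ^ j * (Real.pi / 2 ^ j) := by gcongr
        _ = Real.pi := by field_simp
    simp only [Set.mem_iUnion, Finset.mem_range]
    refine ⟨_, hlt, ⟨k, hk, ?_⟩, l, hl, ?_⟩
    · rw [hit_iff hβ _ _ (by positivity) hcast, ← hidx]
    · rw [hit_iff hβ _ _ (by positivity) hcast, ← hidx]
      exact fun h => hkl h.symm
  refine (measure_mono hDj).trans ((measure_biUnion_finset_le _ _).trans ?_)
  have hstep : ∀ i ∈ Finset.range (2 ^ j),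
      seqMeasure (bothHit β (i * (Real.pi / 2 ^ j)) ((i + 1) * (Real.pi / 2 ^ j)) (2 * n)) ≤
        ENNReal.ofReal (8 * Real.pi ^ 2 / (β ^ 3 * n) *
          Real.exp (-(β ^ 3 / (2 * Real.pi ^ 3)) * n) * (Real.pi / 2 ^ j)) := by
    intro i hi
    rw [← ofReal_measureReal]
    apply ENNReal.ofReal_le_ofReal
    have hw : (0 : ℝ) ≤ Real.pi / 2 ^ j := by positivity
    have hle : Real.pi / 2 ^ j ≤ Real.pi := div_le_self hpi.le (one_le_pow₀ one_le_two)
    have := real_bothHit_two_mul_le hβ (a := i * (Real.pi / 2 ^ j))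
      (b := (i + 1) * (Real.pi / 2 ^ j)) (by linarith) (by linarith) hn
    rwa [show (i + 1) * (Real.pi / 2 ^ j) - i * (Real.pi / 2 ^ j) = Real.pi / 2 ^ j by ring] at this
  refine (Finset.sum_le_sum hstep).trans (le_of_eq ?_)
  rw [Finset.sum_const, Finset.card_range, nsmul_eq_mul,
    show ((2 ^ j : ℕ) : ENNReal) = ENNReal.ofReal (2 ^ j) by
      rw [ENNReal.ofReal_pow (by norm_num)]; push_cast; norm_num,
    ← ENNReal.ofReal_mul (by positivity)]
  congr 1
  field_simp

theorem measurable_inMap {β : ℝ} (hβ : β ∈ Set.Ioo 0 (Real.pi / 2)) : Measurable (inMap β) :=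
  (gc_outMap_inMap hβ).monotone_u.measurable

/-- The path of the boundary point `y` under the first `d` steps of the evaluation of
`back β x n y`. -/
def path (β : ℝ) (x : ℕ → ℝ) (n : ℕ) (y : ℝ) : ℕ → ℝ
  | 0 => y
  | d + 1 => pull β (x (n - 1 - d)) (path β x n y d)

theorem path_succ (β : ℝ) (x : ℕ → ℝ) (n : ℕ) (y : ℝ) (d : ℕ) :
    path β x (n + 1) y (d + 1) = path β x n (pull β (x n) y) d := by
  induction d with
  | zero => rfl
  | succ d ih =>
    rw [path, ih, path]
    congr 2
    omega

/-- The path of the boundary point `y` never passes through an end point of the arc that is mapped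
to a slit. -/
def Regular (β : ℝ) (x : ℕ → ℝ) (n : ℕ) (y : ℝ) : Prop :=
  ∀ d < n, Real.cos (path β x n y d - x (n - 1 - d)) ^ 2 ≠ Real.cos β ^ 2

theorem regular_succ {β : ℝ} {x : ℕ → ℝ} {n : ℕ} {y : ℝ} (h : Regular β x (n + 1) y) :
    Real.cos (y - x n) ^ 2 ≠ Real.cos β ^ 2 ∧ Regular β x n (pull β (x n) y) := by
  refine ⟨by simpa [path] using h 0 (by omega), fun d hd => ?_⟩
  have := h (d + 1) (by omega)
  rwa [path_succ, show n + 1 - 1 - (d + 1) = n - 1 - d by omega] at this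

theorem countable_cos_sq_eq (β z : ℝ) :
    {u : ℝ | Real.cos (z - u) ^ 2 = Real.cos β ^ 2}.Countable := by
  have : {u : ℝ | Real.cos (z - u) ^ 2 = Real.cos β ^ 2} ⊆
      (Set.range fun k : ℤ => z + k * Real.pi - β) ∪ Set.range fun k : ℤ => z - k * Real.pi + β := by
    intro u hu
    have hu' : Real.cos (z - u) ^ 2 = Real.cos β ^ 2 := hu
    have h : Real.cos (2 * (z - u)) = Real.cos (2 * β) := by
      rw [Real.cos_two_mul, Real.cos_two_mul, hu']
    obtain ⟨k, hk | hk⟩ := Real.cos_eq_cos_iff.1 h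
    · left
      exact ⟨k, by linarith⟩
    · right
      exact ⟨k, by linarith⟩
  exact ((Set.countable_range _).union (Set.countable_range _)).mono this

theorem ae_regular {β : ℝ} (hβ : β ∈ Set.Ioo 0 (Real.pi / 2)) :
    ∀ᵐ x ∂seqMeasure, ∀ n, Regular β x n (x n) := by
  have hpath : ∀ n d, Measurable fun x : ℕ → ℝ => path β x n (x n) d := by
    intro n d
    induction d with
    | zero => exact measurable_pi_apply n
    | succ d ih =>
      have h1 : Measurable fun x : ℕ → ℝ => x (n - 1 - d) := measurable_pi_apply _
      exact h1.add ((measurable_inMap hβ).comp (ih.sub h1))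
  have hdep : ∀ n d, d < n → ∀ x y : ℕ → ℝ, (∀ i ∈ Finset.Icc (n - d) n, x i = y i) →
      path β x n (x n) d = path β y n (y n) d := by
    intro n d
    induction d with
    | zero =>
      intro hd x y h
      exact h n (by simp)
    | succ d ih =>
      intro hd x y h
      rw [path, path, ih (by omega) x y fun i hi => h i ?_, h (n - 1 - d) ?_]
      · rw [Finset.mem_Icc]; omega
      · rw [Finset.mem_Icc] at hi ⊢; omega
  rw [ae_all_iff]
  intro n
  unfold Regular
  rw [ae_all_iff]
  intro d
  rw [ae_all_iff]
  intro hd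
  have hmap := map_prod_seqMeasure (hpath n d) (n - 1 - d) (T := Finset.Icc (n - d) n)
    (by rw [Finset.mem_Icc]; omega) (hdep n d hd)
  have hS : MeasurableSet {p : ℝ × ℝ | Real.cos (p.2 - p.1) ^ 2 = Real.cos β ^ 2} :=
    measurableSet_eq_fun (by fun_prop) measurable_const
  have hm : Measurable fun x : ℕ → ℝ => (x (n - 1 - d), path β x n (x n) d) :=
    (measurable_pi_apply _).prodMk (hpath n d)
  have hnull : seqMeasure.map (fun x => (x (n - 1 - d), path β x n (x n) d))
      {p : ℝ × ℝ | Real.cos (p.2 - p.1) ^ 2 = Real.cos β ^ 2} = 0 := by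
    rw [hmap, Measure.prod_apply_symm hS]
    simp only [lintegral_eq_zero_iff' (measurable_measure_prodMk_right hS).aemeasurable]
    refine Filter.Eventually.of_forall fun z => ?_
    exact unif_countable (countable_cos_sq_eq β z)
  rw [Measure.map_apply hm hS] at hnull
  rw [ae_iff]
  simpa using hnull

end CHL

end

noncomputable section

namespace CHL

/-! ### The slit map on the cylinder -/

open Complex in
theorem exp_periodic (N : ℝ) :
    Function.Periodic (fun z : ℂ => exp (I * z / N)) ((2 * Real.pi * N : ℝ) : ℂ) := by
  intro z
  rcases eq_or_ne N 0 with rfl | hN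
  · simp
  · have hN' : (N : ℂ) ≠ 0 := by exact_mod_cast hN
    have h : I * (z + ((2 * Real.pi * N : ℝ) : ℂ)) / N = I * z / N + 2 * Real.pi * I := by
      push_cast
      field_simp
    simp only [h, Complex.exp_periodic _]

/-- The embedding `z ↦ e^{iz/N}` of the cylinder into the plane. -/
def cylExp (N : ℝ) (p : Cyl N) : ℂ := (exp_periodic N).lift p

theorem cylExp_coe (N : ℝ) (z : ℂ) : cylExp N (z : Cyl N) = Complex.exp (Complex.I * z / N) := rfl

theorem im_periodic (N : ℝ) :
    Function.Periodic (fun z : ℂ => z.im) ((2 * Real.pi * N : ℝ) : ℂ) := by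
  intro z
  simp

/-- The imaginary part of a point of the cylinder. -/
def height (N : ℝ) (p : Cyl N) : ℝ := (im_periodic N).lift p

theorem height_coe (N : ℝ) (z : ℂ) : height N (z : Cyl N) = z.im := rfl

theorem height_add_real (N : ℝ) (p : Cyl N) (x : ℝ) : height N (p + ((x : ℂ) : Cyl N)) = height N p := by
  induction p using QuotientAddGroup.induction_on with
  | H z =>
    rw [← QuotientAddGroup.mk_add, height_coe, height_coe]
    simp

theorem height_sub_real (N : ℝ) (p : Cyl N) (x : ℝ) : height N (p - ((x : ℂ) : Cyl N)) = height N p := by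
  induction p using QuotientAddGroup.induction_on with
  | H z =>
    rw [← QuotientAddGroup.mk_sub, height_coe, height_coe]
    simp

theorem mem_boundary_iff (N : ℝ) (p : Cyl N) : p ∈ boundary N ↔ height N p = 0 := by
  constructor
  · rintro ⟨a, rfl⟩
    rw [height_coe]
    simp
  · induction p using QuotientAddGroup.induction_on with
    | H z =>
      rw [height_coe]
      intro h
      refine ⟨z.re, ?_⟩
      simp only
      congr 1
      apply Complex.ext <;> simp [h]

theorem coe_add_period {N : ℝ} (z : ℂ) (k : ℤ) :
    ((z + k * (2 * Real.pi * N : ℝ) : ℂ) : Cyl N) = (z : Cyl N) := by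
  rw [QuotientAddGroup.eq]
  exact ⟨-k, by simp⟩

theorem cylExp_injective {N : ℝ} (hN : 0 < N) : Function.Injective (cylExp N) := by
  intro p q
  induction p using QuotientAddGroup.induction_on with
  | H z =>
    induction q using QuotientAddGroup.induction_on with
    | H w =>
      rw [cylExp_coe, cylExp_coe, Complex.exp_eq_exp_iff_exists_int]
      rintro ⟨n, hn⟩
      have hN' : (N : ℂ) ≠ 0 := by exact_mod_cast hN.ne'
      have : z = w + n * (2 * Real.pi * N : ℝ) := by
        push_cast
        field_simp at hn
        linear_combination hn
      rw [this, coe_add_period]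

theorem isEmbedding_cylExp {N : ℝ} (hN : 0 < N) : Topology.IsEmbedding (cylExp N) := by
  have hN' : (N : ℂ) ≠ 0 := by exact_mod_cast hN.ne'
  refine (Topology.IsOpenEmbedding.of_continuous_injective_isOpenMap ?_ (cylExp_injective hN)
    ?_).isEmbedding
  · rw [← QuotientAddGroup.isOpenQuotientMap_mk.continuous_comp_iff]
    have : cylExp N ∘ QuotientAddGroup.mk = fun z : ℂ => Complex.exp (Complex.I * z / N) := rfl
    rw [this]
    fun_prop
  · intro U hU
    have hpre : IsOpen ((QuotientAddGroup.mk : ℂ → Cyl N) ⁻¹' U) :=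
      hU.preimage QuotientAddGroup.isOpenQuotientMap_mk.continuous
    have himg : cylExp N '' U = Complex.exp '' ((fun z : ℂ => (Complex.I / N) * z) ''
        ((QuotientAddGroup.mk : ℂ → Cyl N) ⁻¹' U)) := by
      ext w
      constructor
      · rintro ⟨p, hp, rfl⟩
        induction p using QuotientAddGroup.induction_on with
        | H z =>
          exact ⟨_, ⟨z, hp, rfl⟩, by rw [cylExp_coe]; congr 1; ring⟩
      · rintro ⟨_, ⟨z, hz, rfl⟩, rfl⟩
        exact ⟨(z : Cyl N), hz, by rw [cylExp_coe]; congr 1; ring⟩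
    rw [himg]
    refine Complex.isOpenMap_exp _ ?_
    have hne : Complex.I / N ≠ 0 := div_ne_zero Complex.I_ne_zero hN'
    exact (Homeomorph.mulLeft₀ _ hne).isOpenMap _ hpre

theorem continuousWithinAt_of_comp_mk {N : ℝ} {Y : Type*} [TopologicalSpace Y] {f : Cyl N → Y}
    {s : Set (Cyl N)} {z : ℂ}
    (h : ContinuousWithinAt (fun w : ℂ => f (w : Cyl N)) ((QuotientAddGroup.mk : ℂ → Cyl N) ⁻¹' s) z) :
    ContinuousWithinAt f s (z : Cyl N) := by
  intro V hV
  have := h hV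
  rw [Filter.mem_map, mem_nhdsWithin] at this ⊢
  obtain ⟨U, hU, hz, hUV⟩ := this
  refine ⟨QuotientAddGroup.mk '' U, QuotientAddGroup.isOpenQuotientMap_mk.isOpenMap U hU,
    ⟨z, hz, rfl⟩, ?_⟩
  rintro _ ⟨⟨u, hu, rfl⟩, hus⟩
  exact hUV ⟨hu, hus⟩

open Complex

/-- The points `Z` and `T` are related by `T = tan Z`, in the form
`e^{2iZ} = (1 + iT) / (1 - iT)`. -/
def TanRel (Z T : ℂ) : Prop := exp (2 * I * Z) * (1 - I * T) = 1 + I * T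

theorem tanRel_tan {Z : ℂ} (h : cos Z ≠ 0) : TanRel Z (tan Z) := by
  rw [TanRel, tan]
  have h1 : exp (2 * I * Z) * (cos Z - I * sin Z) = cos Z + I * sin Z := by
    have e1 : cos Z - I * sin Z = exp (-Z * I) := by rw [exp_mul_I, cos_neg, sin_neg]; ring
    have e2 : cos Z + I * sin Z = exp (Z * I) := by rw [exp_mul_I]; ring
    rw [e1, e2, ← exp_add]
    congr 1
    ring
  field_simp
  linear_combination h1

theorem TanRel.one_sub_ne {Z T : ℂ} (h : TanRel Z T) : 1 - I * T ≠ 0 := by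
  intro h0
  rw [TanRel, h0, mul_zero] at h
  have : (2 : ℂ) = 0 := by linear_combination h0 - h
  norm_num at this

theorem TanRel.one_add_sq_ne {Z T : ℂ} (h : TanRel Z T) : 1 + T ^ 2 ≠ 0 := by
  intro h0
  have h1 := h.one_sub_ne
  have h2 : 1 + I * T ≠ 0 := by
    rw [← h]
    exact mul_ne_zero (exp_ne_zero _) h1
  apply mul_ne_zero h1 h2
  linear_combination h0 - T ^ 2 * I_sq

theorem TanRel.unique {Z T T' : ℂ} (h : TanRel Z T) (h' : TanRel Z T') : T = T' := by
  rw [TanRel] at h h'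
  have h2 : exp (2 * I * Z) + 1 ≠ 0 := by
    intro h0
    rw [eq_neg_of_add_eq_zero_left h0] at h
    have : (2 : ℂ) = 0 := by linear_combination -h
    norm_num at this
  have h3 : I * T * (exp (2 * I * Z) + 1) = I * T' * (exp (2 * I * Z) + 1) := by
    linear_combination h' - h
  exact mul_left_cancel₀ I_ne_zero (mul_right_cancel₀ h2 h3)

theorem TanRel.exp_eq {Z Z' T : ℂ} (h : TanRel Z T) (h' : TanRel Z' T) :
    exp (2 * I * Z) = exp (2 * I * Z') := by
  have h1 := h.one_sub_ne
  rw [TanRel] at h h'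
  exact mul_right_cancel₀ h1 (h.trans h'.symm)

theorem tanRel_arctan {T : ℂ} (h : 1 + T ^ 2 ≠ 0) : TanRel (arctan T) T := by
  have h0 : (1 + I * T) * (1 - I * T) ≠ 0 := by
    intro h0
    apply h
    linear_combination h0 + T ^ 2 * I_sq
  have h1 := left_ne_zero_of_mul h0
  have h2 := right_ne_zero_of_mul h0
  rw [TanRel, arctan, show 2 * I * (-I / 2 * log ((1 + T * I) / (1 - T * I))) =
    log ((1 + T * I) / (1 - T * I)) by linear_combination (-log ((1 + T * I) / (1 - T * I))) * I_sq,
    mul_comm T I, exp_log (div_ne_zero h1 h2), div_mul_cancel₀ _ h2]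

/-- The tangent preserves the sign of the imaginary part. -/
theorem TanRel.im_sign {Z T : ℂ} (h : TanRel Z T) : (0 < Z.im ↔ 0 < T.im) ∧ (0 ≤ Z.im ↔ 0 ≤ T.im) := by
  have h1 := h.one_sub_ne
  have h2 : normSq (exp (2 * I * Z)) * normSq (1 - I * T) = normSq (1 + I * T) := by
    rw [← normSq_mul, h]
  have h3 : normSq (exp (2 * I * Z)) = Real.exp (-(4 * Z.im)) := by
    rw [normSq_eq_norm_sq, norm_exp, sq, ← Real.exp_add]
    congr 1
    simp
    ring
  have h4 : normSq (1 - I * T) - normSq (1 + I * T) = 4 * T.im := by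
    simp [normSq_apply]
    ring
  have hpos := normSq_pos.2 h1
  rw [← h2, h3] at h4
  have h5 : normSq (1 - I * T) * (1 - Real.exp (-(4 * Z.im))) = 4 * T.im := by linarith
  constructor
  · constructor
    · intro hz
      have : Real.exp (-(4 * Z.im)) < 1 := Real.exp_lt_one_iff.2 (by linarith)
      nlinarith
    · intro ht
      by_contra! hz
      have : 1 ≤ Real.exp (-(4 * Z.im)) := Real.one_le_exp (by linarith)
      nlinarith
  · constructor
    · intro hz
      have : Real.exp (-(4 * Z.im)) ≤ 1 := Real.exp_le_one_iff.2 (by linarith)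
      nlinarith
    · intro ht
      by_contra! hz
      have : 1 < Real.exp (-(4 * Z.im)) := Real.one_lt_exp_iff.2 (by linarith)
      nlinarith

theorem sqrt_sq (w : ℂ) : Complex.sqrt w ^ 2 = w := by
  have := cpow_nat_inv_pow w (n := 2) two_ne_zero
  rw [Complex.sqrt]
  exact_mod_cast this

theorem sqrt_re_im {w : ℂ} (hw : 0 ≤ w.im) :
    (Complex.sqrt w).re = Real.sqrt ((‖w‖ + w.re) / 2) ∧
      (Complex.sqrt w).im = Real.sqrt ((‖w‖ - w.re) / 2) := by
  rw [Complex.sqrt_eq_real_add_ite]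
  simp [hw]

theorem continuousOn_sqrt_im_nonneg : ContinuousOn Complex.sqrt {w | 0 ≤ w.im} := by
  have h : ContinuousOn (fun w : ℂ => (Real.sqrt ((‖w‖ + w.re) / 2) : ℂ) +
      (Real.sqrt ((‖w‖ - w.re) / 2) : ℂ) * I) {w | 0 ≤ w.im} := by
    apply Continuous.continuousOn
    fun_prop
  refine h.congr fun w hw => ?_
  have hw' : 0 ≤ w.im := hw
  obtain ⟨h1, h2⟩ := sqrt_re_im hw'
  simp only
  rw [← h1, ← h2, re_add_im]

theorem phi_sq {δ : ℝ} (hδ : δ ∈ Set.Ioo (0 : ℝ) 1) (z : ℂ) :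
    phi δ z ^ 2 = (1 - (δ : ℂ) ^ 2) * z ^ 2 - (δ : ℂ) ^ 2 := by
  have h : ((Real.sqrt (1 - δ ^ 2) : ℝ) : ℂ) ^ 2 = 1 - (δ : ℂ) ^ 2 := by
    rw [← ofReal_pow, Real.sq_sqrt (by nlinarith [hδ.1, hδ.2])]
    push_cast
    rfl
  rw [phi, mul_pow, sqrt_sq, sqrt_sq]
  linear_combination z ^ 2 * h

theorem one_add_phi_sq {δ : ℝ} (hδ : δ ∈ Set.Ioo (0 : ℝ) 1) (z : ℂ) :
    1 + phi δ z ^ 2 = (1 - (δ : ℂ) ^ 2) * (1 + z ^ 2) := by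
  rw [phi_sq hδ]; ring

theorem one_sub_sq_ne {δ : ℝ} (hδ : δ ∈ Set.Ioo (0 : ℝ) 1) : (1 - (δ : ℂ) ^ 2) ≠ 0 := by
  have : (1 - δ ^ 2 : ℝ) ≠ 0 := by nlinarith [hδ.1, hδ.2]
  exact_mod_cast this

theorem phi_im {δ : ℝ} {z : ℂ} (hz : 0 ≤ z.im) : 0 ≤ (phi δ z).im := by
  have h0 : 0 ≤ Real.sqrt (1 - δ ^ 2) * z.im := mul_nonneg (Real.sqrt_nonneg _) hz
  have h1 := sqrt_re_im (w := (Real.sqrt (1 - δ ^ 2) : ℂ) * z - δ) (by simpa using h0)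
  have h2 := sqrt_re_im (w := (Real.sqrt (1 - δ ^ 2) : ℂ) * z + δ) (by simpa using h0)
  rw [phi, mul_im, h1.1, h1.2, h2.1, h2.2]
  positivity

theorem sqrt_re_im_pos {w : ℂ} (hw : 0 < w.im) :
    0 < (Complex.sqrt w).re ∧ 0 < (Complex.sqrt w).im := by
  obtain ⟨h1, h2⟩ := sqrt_re_im hw.le
  have h := abs_lt.1 (abs_re_lt_norm.2 hw.ne')
  rw [h1, h2, Real.sqrt_pos, Real.sqrt_pos]
  constructor <;> linarith [h.1, h.2]

theorem phi_im_pos {δ : ℝ} (hδ : δ ∈ Set.Ioo (0 : ℝ) 1) {z : ℂ} (hz : 0 < z.im) :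
    0 < (phi δ z).im := by
  have h0 : 0 < Real.sqrt (1 - δ ^ 2) * z.im :=
    mul_pos (Real.sqrt_pos.2 (by nlinarith [hδ.1, hδ.2])) hz
  have h1 := sqrt_re_im_pos (w := (Real.sqrt (1 - δ ^ 2) : ℂ) * z - δ) (by simpa using h0)
  have h2 := sqrt_re_im_pos (w := (Real.sqrt (1 - δ ^ 2) : ℂ) * z + δ) (by simpa using h0)
  rw [phi, mul_im]
  have := mul_pos h1.1 h2.2
  have := mul_pos h1.2 h2.1
  linarith

theorem continuousOn_phi (δ : ℝ) : ContinuousOn (phi δ) {z | 0 ≤ z.im} := by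
  unfold phi
  refine ContinuousOn.mul ?_ ?_ <;>
  · refine continuousOn_sqrt_im_nonneg.comp (by fun_prop) fun z hz => ?_
    have h0 : 0 ≤ Real.sqrt (1 - δ ^ 2) * z.im := mul_nonneg (Real.sqrt_nonneg _) hz
    simpa using h0

end CHL

end

noncomputable section

namespace CHL

open Complex

theorem slitMap_coe (N δ : ℝ) (z : ℂ) : slitMap N δ (z : Cyl N) = (slitLift N δ z : Cyl N) := rfl

theorem cylExp_eq {N : ℝ} (hN : 0 < N) (z : ℂ) :
    cylExp N (z : Cyl N) = exp (2 * I * (z / (2 * N))) := by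
  have hN' : (N : ℂ) ≠ 0 := by exact_mod_cast hN.ne'
  rw [cylExp_coe]
  congr 1
  field_simp

theorem tanRel_slitLift {N δ : ℝ} (hN : 0 < N) (hδ : δ ∈ Set.Ioo (0 : ℝ) 1) {z : ℂ}
    (hz : cos (z / (2 * N)) ≠ 0) :
    TanRel (slitLift N δ z / (2 * N)) (phi δ (tan (z / (2 * N)))) := by
  have hN' : (N : ℂ) ≠ 0 := by exact_mod_cast hN.ne'
  rw [slitLift, if_neg hz, mul_div_cancel_left₀ _ (mul_ne_zero two_ne_zero hN')]
  apply tanRel_arctan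
  rw [one_add_phi_sq hδ]
  exact mul_ne_zero (one_sub_sq_ne hδ) (tanRel_tan hz).one_add_sq_ne

theorem im_div_two_mul {N : ℝ} (z : ℂ) : (z / (2 * N)).im = z.im / (2 * N) := by
  have : z / (2 * N) = z / ((2 * N : ℝ) : ℂ) := by push_cast; rfl
  rw [this, div_ofReal_im]

theorem cos_ne_zero_of_im {N : ℝ} (hN : 0 < N) {z : ℂ} (hz : 0 < z.im) :
    cos (z / (2 * N)) ≠ 0 := by
  intro h
  obtain ⟨k, hk⟩ := cos_eq_zero_iff.1 h
  have h1 := im_div_two_mul (N := N) z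
  rw [hk, show ((2 * k + 1) * Real.pi / 2 : ℂ) = (((2 * k + 1) * Real.pi / 2 : ℝ) : ℂ) by
    push_cast; rfl, ofReal_im] at h1
  have : 0 < z.im / (2 * N) := by positivity
  linarith

theorem tan_im_pos {N : ℝ} (hN : 0 < N) {z : ℂ} (hz : 0 < z.im) :
    0 < (tan (z / (2 * N))).im := by
  rw [← (tanRel_tan (cos_ne_zero_of_im hN hz)).im_sign.1, im_div_two_mul]
  positivity

theorem tan_im_nonneg {N : ℝ} (hN : 0 < N) {z : ℂ} (hz : 0 ≤ z.im) (hc : cos (z / (2 * N)) ≠ 0) :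
    0 ≤ (tan (z / (2 * N))).im := by
  rw [← (tanRel_tan hc).im_sign.2, im_div_two_mul]
  positivity

theorem slitLift_im_pos {N δ : ℝ} (hN : 0 < N) (hδ : δ ∈ Set.Ioo (0 : ℝ) 1) {z : ℂ}
    (hz : 0 < z.im) : 0 < (slitLift N δ z).im := by
  have h := (tanRel_slitLift hN hδ (cos_ne_zero_of_im hN hz)).im_sign.1.2
    (phi_im_pos hδ (tan_im_pos hN hz))
  rw [im_div_two_mul] at h
  by_contra! h'
  exact absurd h (not_lt.2 (div_nonpos_of_nonpos_of_nonneg h' (by positivity)))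

theorem slitLift_im_nonneg {N δ : ℝ} (hN : 0 < N) (hδ : δ ∈ Set.Ioo (0 : ℝ) 1) {z : ℂ}
    (hz : 0 ≤ z.im) : 0 ≤ (slitLift N δ z).im := by
  by_cases hc : cos (z / (2 * N)) = 0
  · rw [slitLift, if_pos hc, ofReal_im]
  have h := (tanRel_slitLift hN hδ hc).im_sign.2.2 (phi_im (tan_im_nonneg hN hz hc))
  rw [im_div_two_mul] at h
  by_contra! h'
  exact absurd h (not_le.2 (div_neg_of_neg_of_pos h' (by positivity)))

/-- The interior of the cylinder. -/
def interiorCyl (N : ℝ) : Set (Cyl N) := {p | 0 < height N p}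

/-- The cylinder with its boundary circle. -/
def closedCyl (N : ℝ) : Set (Cyl N) := {p | 0 ≤ height N p}

theorem slitMap_mapsTo_interior {N δ : ℝ} (hN : 0 < N) (hδ : δ ∈ Set.Ioo (0 : ℝ) 1) :
    Set.MapsTo (slitMap N δ) (interiorCyl N) (interiorCyl N) := by
  intro p
  induction p using QuotientAddGroup.induction_on with
  | H z => exact fun h => slitLift_im_pos hN hδ h

theorem slitMap_mapsTo_closed {N δ : ℝ} (hN : 0 < N) (hδ : δ ∈ Set.Ioo (0 : ℝ) 1) :
    Set.MapsTo (slitMap N δ) (closedCyl N) (closedCyl N) := by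
  intro p
  induction p using QuotientAddGroup.induction_on with
  | H z => exact fun h => slitLift_im_nonneg hN hδ h

theorem slitMap_injOn {N δ : ℝ} (hN : 0 < N) (hδ : δ ∈ Set.Ioo (0 : ℝ) 1) :
    Set.InjOn (slitMap N δ) (interiorCyl N) := by
  intro p hp q hq
  induction p using QuotientAddGroup.induction_on with
  | H z =>
    induction q using QuotientAddGroup.induction_on with
    | H w =>
      intro h
      have hz : 0 < z.im := hp
      have hw : 0 < w.im := hq
      have hcz := cos_ne_zero_of_im hN hz
      have hcw := cos_ne_zero_of_im hN hw
      have h1 := congrArg (cylExp N) h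
      rw [slitMap_coe, slitMap_coe, cylExp_eq hN, cylExp_eq hN] at h1
      have h2 := tanRel_slitLift hN hδ hcz
      have h3 := tanRel_slitLift hN hδ hcw
      have h4 : TanRel (slitLift N δ z / (2 * N)) (phi δ (tan (w / (2 * N)))) := by
        rw [TanRel, h1]; exact h3
      have h5 := h2.unique h4
      have h6 := phi_sq hδ (tan (z / (2 * N)))
      rw [h5, phi_sq hδ] at h6
      have h7 : tan (w / (2 * N)) ^ 2 = tan (z / (2 * N)) ^ 2 := by
        apply mul_left_cancel₀ (one_sub_sq_ne hδ)
        linear_combination h6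
      have hzi := tan_im_pos hN hz
      have hwi := tan_im_pos hN hw
      rcases sq_eq_sq_iff_eq_or_eq_neg.1 h7 with h8 | h8
      · apply cylExp_injective hN
        rw [cylExp_eq hN, cylExp_eq hN]
        refine (tanRel_tan hcz).exp_eq ?_
        rw [← h8]
        exact tanRel_tan hcw
      · rw [h8, neg_im] at hwi
        linarith

theorem cylExp_slitMap {N δ : ℝ} (hN : 0 < N) (hδ : δ ∈ Set.Ioo (0 : ℝ) 1) {w : ℂ}
    (hc : cos (w / (2 * N)) ≠ 0) :
    cylExp N (slitMap N δ (w : Cyl N)) = -1 + 2 / (1 - I * phi δ (tan (w / (2 * N)))) := by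
  have h1 := tanRel_slitLift hN hδ hc
  have h2 := h1.one_sub_ne
  rw [slitMap_coe, cylExp_eq hN]
  rw [TanRel, ← eq_div_iff h2] at h1
  rw [h1]
  field_simp
  ring

/-- At the pole of the tangent, `phi` tends to infinity. -/
theorem tendsto_norm_one_sub_phi {N δ : ℝ} (hN : 0 < N) (hδ : δ ∈ Set.Ioo (0 : ℝ) 1) {z : ℂ}
    (hc : cos (z / (2 * N)) = 0) :
    Filter.Tendsto (fun w : ℂ => ‖tan (w / (2 * N))‖) (nhdsWithin z {z}ᶜ) Filter.atTop ∧
    Filter.Tendsto (fun w : ℂ => ‖1 - I * phi δ (tan (w / (2 * N)))‖) (nhdsWithin z {z}ᶜ)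
      Filter.atTop := by
  have hN' : (N : ℂ) ≠ 0 := by exact_mod_cast hN.ne'
  have hdiv : Continuous fun w : ℂ => w / (2 * (N : ℂ)) := by fun_prop
  have h1 : Filter.Tendsto (fun w : ℂ => ‖tan (w / (2 * N))‖) (nhdsWithin z {z}ᶜ)
      Filter.atTop := by
    refine (tendsto_norm_tan_of_cos_eq_zero hc).comp ?_
    refine tendsto_nhdsWithin_of_tendsto_nhds_of_eventually_within _
      (hdiv.continuousAt.tendsto.mono_left nhdsWithin_le_nhds) ?_
    filter_upwards [self_mem_nhdsWithin] with w hw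
    intro h
    apply hw
    have h2 : w / (2 * N) = z / (2 * N) := h
    field_simp at h2
    exact h2
  refine ⟨h1, ?_⟩
  have hc0 : 0 < ‖(1 - (δ : ℂ) ^ 2)‖ := norm_pos_iff.2 (one_sub_sq_ne hδ)
  have h3 : Filter.Tendsto (fun w : ℂ => ‖(1 - (δ : ℂ) ^ 2)‖ * ‖tan (w / (2 * N))‖ ^ 2 +
      -‖(δ : ℂ) ^ 2‖) (nhdsWithin z {z}ᶜ) Filter.atTop :=
    Filter.tendsto_atTop_add_const_right _ _
      (((Filter.tendsto_pow_atTop two_ne_zero).comp h1).const_mul_atTop hc0)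
  have h4 : Filter.Tendsto (fun w : ℂ => ‖phi δ (tan (w / (2 * N)))‖ ^ 2)
      (nhdsWithin z {z}ᶜ) Filter.atTop := by
    refine Filter.tendsto_atTop_mono (fun w => ?_) h3
    have h5 : ‖phi δ (tan (w / (2 * N)))‖ ^ 2 =
        ‖(1 - (δ : ℂ) ^ 2) * tan (w / (2 * N)) ^ 2 - (δ : ℂ) ^ 2‖ := by
      rw [← norm_pow, phi_sq hδ]
    rw [h5, ← norm_pow, ← norm_mul, ← sub_eq_add_neg]
    exact norm_sub_norm_le _ _
  have h5 : Filter.Tendsto (fun w : ℂ => ‖phi δ (tan (w / (2 * N)))‖ + -1)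
      (nhdsWithin z {z}ᶜ) Filter.atTop := by
    refine Filter.tendsto_atTop_add_const_right _ _ ?_
    have := (Real.tendsto_sqrt_atTop).comp h4
    refine this.congr fun w => ?_
    simp [Real.sqrt_sq]
  refine Filter.tendsto_atTop_mono (fun w => ?_) h5
  have h6 := norm_sub_norm_le (I * phi δ (tan (w / (2 * N)))) 1
  rw [norm_mul, norm_I, one_mul, norm_one, norm_sub_rev] at h6
  exact h6

theorem continuousWithinAt_slitMap_of_cos_eq_zero {N δ : ℝ} (hN : 0 < N)
    (hδ : δ ∈ Set.Ioo (0 : ℝ) 1) {z : ℂ} (hc : cos (z / (2 * N)) = 0) :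
    ContinuousWithinAt (fun w : ℂ => cylExp N (slitMap N δ (w : Cyl N))) {w | 0 ≤ w.im} z := by
  have hN' : (N : ℂ) ≠ 0 := by exact_mod_cast hN.ne'
  obtain ⟨h1, h2⟩ := tendsto_norm_one_sub_phi hN hδ hc
  have hz1 : cylExp N (slitMap N δ (z : Cyl N)) = -1 := by
    rw [slitMap_coe, slitLift, if_pos hc, cylExp_coe]
    rw [show I * ((Real.pi * N : ℝ) : ℂ) / N = Real.pi * I by push_cast; field_simp]
    exact exp_pi_mul_I
  have h3 : Filter.Tendsto (fun w : ℂ => -1 + 2 / (1 - I * phi δ (tan (w / (2 * N)))))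
      (nhdsWithin z {z}ᶜ) (nhds (-1)) := by
    have h4 : Filter.Tendsto (fun w : ℂ => 2 / (1 - I * phi δ (tan (w / (2 * N)))))
        (nhdsWithin z {z}ᶜ) (nhds 0) := by
      rw [tendsto_zero_iff_norm_tendsto_zero]
      simp only [norm_div]
      exact h2.const_div_atTop _
    simpa using h4.const_add (-1)
  have hev : ∀ᶠ w : ℂ in nhdsWithin z {z}ᶜ, cos (w / (2 * N)) ≠ 0 := by
    filter_upwards [h1.eventually_gt_atTop 0] with w hw h0
    rw [tan, h0] at hw
    simp at hw
  have h4 : Filter.Tendsto (fun w : ℂ => cylExp N (slitMap N δ (w : Cyl N)))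
      (nhdsWithin z {z}ᶜ) (nhds (-1)) := by
    refine h3.congr' ?_
    filter_upwards [hev] with w hw
    exact (cylExp_slitMap hN hδ hw).symm
  rw [← continuousWithinAt_sdiff_self, ContinuousWithinAt, hz1]
  exact h4.mono_left (nhdsWithin_mono _ fun w hw => hw.2)

theorem continuousWithinAt_slitMap_of_cos_ne_zero {N δ : ℝ} (hN : 0 < N)
    (hδ : δ ∈ Set.Ioo (0 : ℝ) 1) {z : ℂ} (hz : 0 ≤ z.im) (hc : cos (z / (2 * N)) ≠ 0) :
    ContinuousWithinAt (fun w : ℂ => cylExp N (slitMap N δ (w : Cyl N))) {w | 0 ≤ w.im} z := by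
  have hdiv : Continuous fun w : ℂ => w / (2 * (N : ℂ)) := by fun_prop
  have ht : ContinuousAt (fun w : ℂ => tan (w / (2 * N))) z :=
    ContinuousAt.comp (f := fun w : ℂ => w / (2 * (N : ℂ))) (g := tan)
      (continuousAt_tan.2 hc) hdiv.continuousAt
  have hp : ContinuousWithinAt (fun w : ℂ => phi δ (tan (w / (2 * N))))
      ({w | 0 ≤ w.im} ∩ {w | cos (w / (2 * N)) ≠ 0}) z := by
    have h1 : ContinuousWithinAt (phi δ) {T | 0 ≤ T.im} (tan (z / (2 * N))) :=
      continuousOn_phi δ _ (tan_im_nonneg hN hz hc)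
    have h2 : Set.MapsTo (fun w : ℂ => tan (w / (2 * N)))
        ({w | 0 ≤ w.im} ∩ {w | cos (w / (2 * N)) ≠ 0}) {T | 0 ≤ T.im} :=
      fun w hw => tan_im_nonneg hN hw.1 hw.2
    exact h1.comp (f := fun w : ℂ => tan (w / (2 * N))) ht.continuousWithinAt h2
  have hcont : ContinuousWithinAt
      (fun w : ℂ => -1 + 2 / (1 - I * phi δ (tan (w / (2 * N)))))
      ({w | 0 ≤ w.im} ∩ {w | cos (w / (2 * N)) ≠ 0}) z := by
    have h0 : (1 - I * phi δ (tan (z / (2 * N)))) ≠ 0 := (tanRel_slitLift hN hδ hc).one_sub_ne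
    have h1 : ContinuousWithinAt (fun w : ℂ => 1 - I * phi δ (tan (w / (2 * N))))
        ({w | 0 ≤ w.im} ∩ {w | cos (w / (2 * N)) ≠ 0}) z :=
      continuousWithinAt_const.sub (continuousWithinAt_const.mul hp)
    exact continuousWithinAt_const.add (continuousWithinAt_const.div h1 h0)
  have hopen : {w : ℂ | cos (w / (2 * N)) ≠ 0} ∈ nhds z :=
    (isOpen_ne_fun (continuous_cos.comp hdiv) continuous_const).mem_nhds hc
  rw [continuousWithinAt_inter hopen] at hcont
  refine hcont.congr_of_eventuallyEq ?_ (cylExp_slitMap hN hδ hc)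
  filter_upwards [nhdsWithin_le_nhds hopen] with w hw
  exact cylExp_slitMap hN hδ hw

theorem continuousOn_slitMap {N δ : ℝ} (hN : 0 < N) (hδ : δ ∈ Set.Ioo (0 : ℝ) 1) :
    ContinuousOn (slitMap N δ) (closedCyl N) := by
  rw [(isEmbedding_cylExp hN).continuousOn_iff]
  intro p hp
  induction p using QuotientAddGroup.induction_on with
  | H z =>
    apply continuousWithinAt_of_comp_mk
    by_cases hc : cos (z / (2 * N)) = 0
    · exact continuousWithinAt_slitMap_of_cos_eq_zero hN hδ hc
    · exact continuousWithinAt_slitMap_of_cos_ne_zero hN hδ hp hc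

end CHL

end

noncomputable section

namespace CHL

/-! ### The collapsed boundary map modulo the period -/

theorem cos_add_int_mul_pi_sq (v : ℝ) (k : ℤ) :
    Real.cos (v + k * Real.pi) ^ 2 = Real.cos v ^ 2 := by
  rw [Real.cos_add_int_mul_pi]
  rcases Int.even_or_odd k with h | h <;> simp [h.neg_one_zpow]

theorem abs_div_cos_lt_one {β v : ℝ} (hβ : β ∈ Set.Ioo 0 (Real.pi / 2))
    (hv : Real.cos v ^ 2 < Real.cos β ^ 2) : |Real.cos v / Real.cos β| < 1 := by
  have hc := cos_pos_of_mem hβ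
  rw [abs_div, abs_of_pos hc, div_lt_one hc]
  exact (sq_lt_sq.1 hv).trans_eq (abs_of_pos hc)

theorem inMap_ne_int_mul_pi {β v : ℝ} (hβ : β ∈ Set.Ioo 0 (Real.pi / 2))
    (hv : Real.cos v ^ 2 < Real.cos β ^ 2) (k : ℤ) : inMap β v ≠ k * Real.pi := by
  obtain ⟨l, hl⟩ := exists_add_int_mul_pi_mem_Ico v
  intro h
  have h1 := inMap_add_int_mul_pi β v l
  have hv' : Real.cos (v + l * Real.pi) ^ 2 < Real.cos β ^ 2 := by
    rwa [cos_add_int_mul_pi_sq]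
  have h2 := abs_lt.1 (abs_div_cos_lt_one hβ hv')
  rw [inMap_of_mem hl, h, ← add_mul] at h1
  have h3 : 0 < Real.arccos (Real.cos (v + l * Real.pi) / Real.cos β) := Real.arccos_pos.2 h2.2
  have h4 : Real.arccos (Real.cos (v + l * Real.pi) / Real.cos β) < Real.pi :=
    Real.arccos_lt_pi.2 h2.1
  rw [h1] at h3 h4
  have h5 : (0 : ℝ) < k + l := pos_of_mul_pos_left h3 Real.pi_pos.le
  have h6 : ((k : ℝ) + l) < 1 := by
    by_contra! h
    nlinarith [Real.pi_pos]
  have h7 : 0 < k + l := by exact_mod_cast h5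
  have h8 : k + l < 1 := by exact_mod_cast h6
  omega

theorem exists_inMap_eq_int_mul_pi {β v : ℝ} (hβ : β ∈ Set.Ioo 0 (Real.pi / 2))
    (hv : Real.cos β ^ 2 ≤ Real.cos v ^ 2) : ∃ k : ℤ, inMap β v = k * Real.pi := by
  obtain ⟨l, hl⟩ := exists_add_int_mul_pi_mem_Ico v
  have hc := cos_pos_of_mem hβ
  have h1 := inMap_add_int_mul_pi β v l
  have hv' : Real.cos β ^ 2 ≤ Real.cos (v + l * Real.pi) ^ 2 := by
    rwa [cos_add_int_mul_pi_sq]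
  rw [sq_le_sq, abs_of_pos hc, le_abs'] at hv'
  rw [inMap_of_mem hl] at h1
  rcases hv' with h | h
  · rw [Real.arccos_of_le_neg_one (by rw [div_le_iff₀ hc]; linarith)] at h1
    exact ⟨1 - l, by push_cast; linarith⟩
  · rw [Real.arccos_of_one_le (by rw [le_div_iff₀ hc]; linarith)] at h1
    exact ⟨-l, by push_cast; linarith⟩

theorem eq_add_int_mul_pi_of_inMap_eq {β v w : ℝ} (hβ : β ∈ Set.Ioo 0 (Real.pi / 2))
    (hv : Real.cos v ^ 2 < Real.cos β ^ 2) {k : ℤ} (h : inMap β w = inMap β v + k * Real.pi) :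
    ∃ j : ℤ, w = v + j * Real.pi := by
  have hw : Real.cos w ^ 2 < Real.cos β ^ 2 := by
    by_contra! hw
    obtain ⟨l, hl⟩ := exists_inMap_eq_int_mul_pi hβ hw
    apply inMap_ne_int_mul_pi hβ hv (l - k)
    push_cast
    linarith
  have hc := cos_pos_of_mem hβ
  obtain ⟨l, hl⟩ := exists_add_int_mul_pi_mem_Ico v
  obtain ⟨m, hm⟩ := exists_add_int_mul_pi_mem_Ico w
  have hv' : Real.cos (v + l * Real.pi) ^ 2 < Real.cos β ^ 2 := by
    rwa [cos_add_int_mul_pi_sq]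
  have hw' : Real.cos (w + m * Real.pi) ^ 2 < Real.cos β ^ 2 := by
    rwa [cos_add_int_mul_pi_sq]
  have h1 := inMap_add_int_mul_pi β v l
  have h2 := inMap_add_int_mul_pi β w m
  rw [inMap_of_mem hl] at h1
  rw [inMap_of_mem hm] at h2
  have hv2 := abs_lt.1 (abs_div_cos_lt_one hβ hv')
  have hw2 := abs_lt.1 (abs_div_cos_lt_one hβ hw')
  have h3 := Real.arccos_pos.2 hv2.2
  have h4 := Real.arccos_lt_pi.2 hv2.1
  have h5 := Real.arccos_pos.2 hw2.2
  have h6 := Real.arccos_lt_pi.2 hw2.1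
  have h7 : Real.arccos (Real.cos (w + m * Real.pi) / Real.cos β) =
      Real.arccos (Real.cos (v + l * Real.pi) / Real.cos β) + ((k + m - l : ℤ) : ℝ) * Real.pi := by
    rw [h1, h2, h]
    push_cast
    ring
  have h8 : ((k + m - l : ℤ) : ℝ) < 1 := by
    by_contra! h
    nlinarith [Real.pi_pos]
  have h9 : (-1 : ℝ) < ((k + m - l : ℤ) : ℝ) := by
    by_contra! h
    nlinarith [Real.pi_pos]
  have h10 : k + m - l = 0 := by
    have : k + m - l < 1 := by exact_mod_cast h8
    have : -1 < k + m - l := by exact_mod_cast h9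
    omega
  rw [h10, Int.cast_zero, zero_mul, add_zero] at h7
  have h11 := Real.arccos_injOn ⟨hw2.1.le, hw2.2.le⟩ ⟨hv2.1.le, hv2.2.le⟩ h7
  have h12 := Real.injOn_cos ⟨hm.1, hm.2.le⟩ ⟨hl.1, hl.2.le⟩ ((div_left_inj' hc.ne').1 h11)
  exact ⟨l - m, by push_cast; linarith⟩

theorem inMap_outMap {β : ℝ} (hβ : β ∈ Set.Ioo 0 (Real.pi / 2)) (u : ℝ) :
    inMap β (outMap β u) = u ∧ Real.cos (outMap β u) ^ 2 ≤ Real.cos β ^ 2 := by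
  obtain ⟨k, hk⟩ := exists_add_int_mul_pi_mem_Ioc u
  have hc := cos_pos_of_mem hβ
  have h1 := outMap_add_int_mul_pi β u k
  have h2 := inMap_add_int_mul_pi β (outMap β u) k
  have hm1 := beta_le_outMap hβ hk
  have hm2 := outMap_le_sub hβ hk
  have hcos : Real.cos (outMap β (u + k * Real.pi)) = Real.cos β * Real.cos (u + k * Real.pi) := by
    rw [outMap_of_mem hk, Real.cos_arccos]
    · nlinarith [cos_lt_one_of_mem hβ, Real.neg_one_le_cos (u + k * Real.pi),
        Real.cos_le_one (u + k * Real.pi)]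
    · nlinarith [cos_lt_one_of_mem hβ, Real.neg_one_le_cos (u + k * Real.pi),
        Real.cos_le_one (u + k * Real.pi)]
  constructor
  · rw [← h1, inMap_of_mem ⟨by linarith [hβ.1], by linarith [hβ.1]⟩, hcos,
      mul_div_cancel_left₀ _ hc.ne', Real.arccos_cos hk.1.le hk.2] at h2
    linarith
  · have h3 : Real.cos (outMap β (u + k * Real.pi)) ^ 2 = Real.cos (outMap β u) ^ 2 := by
      rw [h1, cos_add_int_mul_pi_sq]
    rw [← h3, hcos, mul_pow]
    exact mul_le_of_le_one_right (sq_nonneg _) (Real.cos_sq_le_one _)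

/-! ### The slit map on the boundary circle -/

open Complex

theorem delta_eq (N s : ℝ) :
    delta N s = (1 - Real.exp (-(s / N))) / (1 + Real.exp (-(s / N))) := by
  rw [delta, Real.exp_neg]
  have := Real.exp_pos (s / N)
  field_simp
  ring

theorem delta_mem {N s : ℝ} (hN : 0 < N) (hs : 0 < s) : delta N s ∈ Set.Ioo (0 : ℝ) 1 := by
  have h1 : 1 < Real.exp (s / N) := Real.one_lt_exp_iff.2 (by positivity)
  rw [delta]
  constructor
  · rw [sub_pos, div_lt_one (by linarith)]
    linarith
  · rw [sub_lt_self_iff]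
    positivity

theorem delta_mono {N s u : ℝ} (hN : 0 < N) (hs : s ≤ u) : delta N s ≤ delta N u := by
  have h1 : Real.exp (s / N) ≤ Real.exp (u / N) := Real.exp_le_exp.2 (by gcongr)
  rw [delta, delta]
  have := Real.exp_pos (s / N)
  gcongr

theorem exists_delta_eq {N lam τ : ℝ} (hN : 0 < N) (hτ : 0 < τ) (hle : τ ≤ delta N lam)
    (hlam : 0 < lam) : ∃ s ∈ Set.Ioc 0 lam, delta N s = τ := by
  have h1 : τ < 1 := hle.trans_lt (delta_mem hN hlam).2
  have hpos : 0 < (1 + τ) / (1 - τ) := div_pos (by linarith) (by linarith)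
  have hd : delta N (N * Real.log ((1 + τ) / (1 - τ))) = τ := by
    have h2 : 1 - τ ≠ 0 := by linarith
    rw [delta, mul_div_cancel_left₀ _ hN.ne', Real.exp_log hpos]
    field_simp
    ring
  refine ⟨N * Real.log ((1 + τ) / (1 - τ)), ⟨?_, ?_⟩, hd⟩
  · refine mul_pos hN (Real.log_pos ?_)
    rw [lt_div_iff₀ (by linarith)]
    linarith
  · have h3 : (1 + τ) / (1 - τ) ≤ Real.exp (lam / N) := by
      have h4 := Real.exp_pos (lam / N)
      rw [delta, le_sub_iff_add_le, ← le_sub_iff_add_le', div_le_iff₀ (by linarith)] at hle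
      rw [div_le_iff₀ (by linarith)]
      nlinarith
    have h4 := Real.log_le_log hpos h3
    rw [Real.log_exp] at h4
    calc N * Real.log ((1 + τ) / (1 - τ)) ≤ N * (lam / N) := by gcongr
      _ = lam := by field_simp

theorem tanRel_slit {N : ℝ} (hN : 0 < N) (s : ℝ) :
    TanRel (s * I / (2 * N)) (delta N s * I) := by
  have hN' : (N : ℂ) ≠ 0 := by exact_mod_cast hN.ne'
  have h1 : exp (2 * I * (s * I / (2 * N))) = (Real.exp (-(s / N)) : ℂ) := by
    rw [ofReal_exp]
    congr 1
    push_cast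
    field_simp
    linear_combination s * I_sq
  have h2 : delta N s * (1 + Real.exp (-(s / N))) = 1 - Real.exp (-(s / N)) := by
    rw [delta_eq, div_mul_cancel₀]
    positivity
  have h3 : (delta N s : ℂ) * (1 + (Real.exp (-(s / N)) : ℂ)) = 1 - (Real.exp (-(s / N)) : ℂ) := by
    exact_mod_cast h2
  rw [TanRel, h1]
  linear_combination h3 - ((Real.exp (-(s / N)) : ℂ) + 1) * (delta N s : ℂ) * I_sq

/-- The slit map omits the slit in the interior of the cylinder. -/
theorem slitMap_ne_slit {N lam : ℝ} (hN : 0 < N) (hlam : 0 < lam) {p : Cyl N}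
    (hp : p ∈ interiorCyl N) {s : ℝ} (hs : s ∈ Set.Ioc 0 lam) :
    slitMap N (delta N lam) p ≠ ((s * I : ℂ) : Cyl N) := by
  induction p using QuotientAddGroup.induction_on with
  | H z =>
    intro h
    have hδ := delta_mem hN hlam
    have hz : 0 < z.im := hp
    have hc := cos_ne_zero_of_im hN hz
    have h1 := congrArg (cylExp N) h
    rw [slitMap_coe, cylExp_eq hN, cylExp_eq hN] at h1
    have h2 := tanRel_slitLift hN hδ hc
    have h3 : TanRel (slitLift N (delta N lam) z / (2 * N)) (delta N s * I) := by
      rw [TanRel, h1]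
      exact tanRel_slit hN s
    have h4 := phi_sq hδ (tan (z / (2 * N)))
    rw [h2.unique h3] at h4
    have hT := tan_im_pos hN hz
    set T := tan (z / (2 * N))
    set d := delta N lam
    have hsd := delta_mem hN hs.1
    have hle : delta N s ≤ d := delta_mono hN hs.2
    have h5 : (((1 - d ^ 2 : ℝ) : ℂ) * T ^ 2) = ((d ^ 2 - delta N s ^ 2 : ℝ) : ℂ) := by
      push_cast
      linear_combination -h4 + (delta N s : ℂ) ^ 2 * I_sq
    have h6 := congrArg Complex.re h5
    have h7 := congrArg Complex.im h5
    rw [re_ofReal_mul, ofReal_re, sq T, mul_re] at h6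
    rw [im_ofReal_mul, ofReal_im, sq T, mul_im] at h7
    have hd : 0 < 1 - d ^ 2 := by nlinarith [hδ.1, hδ.2]
    have h8 : T.re = 0 := by
      have : T.re * T.im + T.im * T.re = 0 := (mul_eq_zero.1 h7).resolve_left hd.ne'
      have : T.re * T.im = 0 := by linarith
      exact (mul_eq_zero.1 this).resolve_right hT.ne'
    rw [h8] at h6
    have h9 : 0 < (1 - d ^ 2) * (T.im * T.im) := by positivity
    have h10 : delta N s ^ 2 ≤ d ^ 2 := pow_le_pow_left₀ hsd.1.le hle 2
    nlinarith

theorem phi_eq_mul_I {δ : ℝ} (hδ : δ ∈ Set.Ioo (0 : ℝ) 1) {T τ : ℝ} (hτ : 0 < τ)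
    (h : τ ^ 2 = δ ^ 2 - (1 - δ ^ 2) * T ^ 2) : phi δ T = τ * I := by
  have h1 := phi_sq hδ (T : ℂ)
  have h2 : phi δ T ^ 2 = (τ * I) ^ 2 := by
    rw [h1, mul_pow, I_sq]
    have : ((τ ^ 2 : ℝ) : ℂ) = ((δ ^ 2 - (1 - δ ^ 2) * T ^ 2 : ℝ) : ℂ) := by rw [h]
    push_cast at this
    rw [this]
    ring
  rcases sq_eq_sq_iff_eq_or_eq_neg.1 h2 with h3 | h3
  · exact h3
  · have h4 := phi_im (δ := δ) (z := (T : ℂ)) (by simp)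
    rw [h3] at h4
    simp at h4
    linarith

theorem phi_eq_real {δ : ℝ} (hδ : δ ∈ Set.Ioo (0 : ℝ) 1) {T r : ℝ} (hr : 0 ≤ r * T)
    (h : r ^ 2 = (1 - δ ^ 2) * T ^ 2 - δ ^ 2) : phi δ T = r := by
  have hδ0 := hδ.1
  have h2 : phi δ T ^ 2 = (r : ℂ) ^ 2 := by
    rw [phi_sq hδ]
    exact_mod_cast h.symm
  have hT : T ≠ 0 := by
    rintro rfl
    nlinarith
  set a := Real.sqrt (1 - δ ^ 2) with ha
  have ha2 : a ^ 2 = 1 - δ ^ 2 := Real.sq_sqrt (by nlinarith [hδ.2])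
  have ha0 : 0 ≤ a := Real.sqrt_nonneg _
  have hle : δ ^ 2 ≤ (a * T) ^ 2 := by
    rw [mul_pow, ha2]
    nlinarith [sq_nonneg r]
  have hs1 := sqrt_re_im (w := (a : ℂ) * T - δ) (by simp)
  have hs2 := sqrt_re_im (w := (a : ℂ) * T + δ) (by simp)
  have e1 : (a : ℂ) * T - δ = ((a * T - δ : ℝ) : ℂ) := by push_cast; rfl
  have e2 : (a : ℂ) * T + δ = ((a * T + δ : ℝ) : ℂ) := by push_cast; rfl
  rw [e1, norm_real, Real.norm_eq_abs, ofReal_re] at hs1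
  rw [e2, norm_real, Real.norm_eq_abs, ofReal_re] at hs2
  -- the sign of the real root is the sign of `T`
  have hsign : 0 ≤ (phi δ T).re * T := by
    rw [phi, ← ha, e1, e2, mul_re]
    rcases hT.lt_or_gt with hT | hT
    · have h3 : a * T ≤ -δ := by
        have : a * T ≤ 0 := mul_nonpos_of_nonneg_of_nonpos ha0 hT.le
        nlinarith
      rw [hs1.1, abs_of_nonpos (by linarith : a * T - δ ≤ 0), neg_add_cancel, zero_div,
        Real.sqrt_zero, zero_mul, zero_sub]
      have : 0 ≤ (Complex.sqrt ((a * T - δ : ℝ) : ℂ)).im * (Complex.sqrt ((a * T + δ : ℝ) : ℂ)).im := by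
        rw [hs1.2, hs2.2]
        positivity
      nlinarith
    · have h3 : δ ≤ a * T := by
        have : 0 ≤ a * T := mul_nonneg ha0 hT.le
        nlinarith
      rw [hs1.2, abs_of_nonneg (by linarith : 0 ≤ a * T - δ), sub_self, zero_div,
        Real.sqrt_zero, zero_mul, sub_zero]
      have : 0 ≤ (Complex.sqrt ((a * T - δ : ℝ) : ℂ)).re * (Complex.sqrt ((a * T + δ : ℝ) : ℂ)).re := by
        rw [hs1.1, hs2.1]
        positivity
      positivity
  rcases sq_eq_sq_iff_eq_or_eq_neg.1 h2 with h3 | h3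
  · exact h3
  · rw [h3, neg_re, ofReal_re] at hsign
    have h4 : r * T = 0 := le_antisymm (by linarith) hr
    have h5 : r = 0 := (mul_eq_zero.1 h4).resolve_right hT
    rw [h3, h5]
    simp

/-- The boundary point of the cylinder with the coordinate `α ∈ ℝ / πℤ`. -/
def bdry (N α : ℝ) : Cyl N := ((2 * N * α : ℝ) : ℂ)

theorem bdry_add_int_mul_pi (N α : ℝ) (k : ℤ) : bdry N (α + k * Real.pi) = bdry N α := by
  rw [bdry, bdry, ← coe_add_period ((2 * N * α : ℝ) : ℂ) k]
  congr 1
  push_cast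
  ring

theorem bdry_mem (N α : ℝ) : bdry N α ∈ boundary N := ⟨_, rfl⟩

theorem exists_bdry_eq {N : ℝ} (hN : 0 < N) {p : Cyl N} (hp : p ∈ boundary N) :
    ∃ α, bdry N α = p := by
  obtain ⟨a, rfl⟩ := hp
  refine ⟨a / (2 * N), ?_⟩
  rw [bdry, mul_div_cancel₀ _ (by positivity)]

theorem bdry_div {N : ℝ} (hN : 0 < N) (α : ℝ) :
    (((2 * N * α : ℝ) : ℂ)) / (2 * N) = (α : ℂ) := by
  have hN' : (N : ℂ) ≠ 0 := by exact_mod_cast hN.ne'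
  push_cast
  field_simp

theorem slitMap_bdry_of_le {N lam β : ℝ} (hN : 0 < N) (hlam : 0 < lam)
    (hβ : β ∈ Set.Ioo 0 (Real.pi / 2)) (hδ : Real.sin β = delta N lam) {α : ℝ}
    (hα : Real.cos α ^ 2 ≤ Real.cos β ^ 2) :
    slitMap N (delta N lam) (bdry N α) = bdry N (inMap β α) := by
  -- both sides are periodic
  suffices H : ∀ α ∈ Set.Ico 0 Real.pi, Real.cos α ^ 2 ≤ Real.cos β ^ 2 →
      slitMap N (delta N lam) (bdry N α) = bdry N (inMap β α) by
    obtain ⟨k, hk⟩ := exists_add_int_mul_pi_mem_Ico α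
    have := H _ hk (by rwa [cos_add_int_mul_pi_sq])
    rwa [bdry_add_int_mul_pi, inMap_add_int_mul_pi, bdry_add_int_mul_pi] at this
  intro α hmem hα
  have hδ' := delta_mem hN hlam
  have hcβ := cos_pos_of_mem hβ
  have hN' : (N : ℂ) ≠ 0 := by exact_mod_cast hN.ne'
  rw [inMap_of_mem hmem]
  by_cases hc : Real.cos α = 0
  · rw [bdry, slitMap_coe, slitLift, bdry_div hN, if_pos (by rw [← ofReal_cos, hc, ofReal_zero]),
      hc, zero_div, Real.arccos_zero, bdry]
    congr 2
    ring
  have hc' : cos ((((2 * N * α : ℝ) : ℂ)) / (2 * N)) ≠ 0 := by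
    rw [bdry_div hN, ← ofReal_cos]
    exact_mod_cast hc
  set y := Real.arccos (Real.cos α / Real.cos β) with hy
  have hcy : Real.cos y = Real.cos α / Real.cos β := by
    have := abs_le.1 ((sq_le_sq.1 hα).trans_eq (abs_of_pos hcβ))
    exact Real.cos_arccos (by rw [le_div_iff₀ hcβ]; linarith) (by rw [div_le_iff₀ hcβ]; linarith)
  have hcy0 : Real.cos y ≠ 0 := by
    rw [hcy]
    positivity
  have hsy : 0 ≤ Real.sin y :=
    Real.sin_nonneg_of_nonneg_of_le_pi (Real.arccos_nonneg _) (Real.arccos_le_pi _)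
  have hsα : 0 ≤ Real.sin α := Real.sin_nonneg_of_nonneg_of_le_pi hmem.1 hmem.2.le
  have hphi : phi (delta N lam) (Real.tan α) = (Real.tan y : ℝ) := by
    apply phi_eq_real hδ'
    · rw [Real.tan_eq_sin_div_cos, Real.tan_eq_sin_div_cos, hcy]
      have : Real.sin y / (Real.cos α / Real.cos β) * (Real.sin α / Real.cos α) =
        Real.sin y * Real.sin α * Real.cos β / Real.cos α ^ 2 := by field_simp
      rw [this]
      positivity
    · rw [Real.tan_eq_sin_div_cos, Real.tan_eq_sin_div_cos, div_pow, div_pow, Real.sin_sq y,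
        Real.sin_sq α, hcy, ← hδ, Real.sin_sq β]
      field_simp
      ring
  have h1 := tanRel_slitLift hN hδ' hc'
  rw [bdry_div hN, ← ofReal_tan, hphi] at h1
  apply cylExp_injective hN
  rw [bdry, bdry, slitMap_coe, cylExp_eq hN, cylExp_eq hN, bdry_div hN]
  refine h1.exp_eq ?_
  rw [ofReal_tan]
  apply tanRel_tan
  rw [← ofReal_cos]
  exact_mod_cast hcy0

theorem slitMap_bdry_eq_slit {N lam β : ℝ} (hN : 0 < N) (hlam : 0 < lam)
    (hδ : Real.sin β = delta N lam) {α s : ℝ} (hc : Real.cos α ≠ 0) (hs : 0 < s)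
    (h : delta N s ^ 2 = Real.sin β ^ 2 - Real.cos β ^ 2 * Real.tan α ^ 2) :
    slitMap N (delta N lam) (bdry N α) = ((s * I : ℂ) : Cyl N) := by
  have hδ' := delta_mem hN hlam
  have hc' : cos ((((2 * N * α : ℝ) : ℂ)) / (2 * N)) ≠ 0 := by
    rw [bdry_div hN, ← ofReal_cos]
    exact_mod_cast hc
  have hphi : phi (delta N lam) (Real.tan α) = delta N s * I := by
    apply phi_eq_mul_I hδ' (delta_mem hN hs).1
    rw [h, ← hδ, Real.cos_sq']
  have h1 := tanRel_slitLift hN hδ' hc'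
  rw [bdry_div hN, ← ofReal_tan, hphi] at h1
  apply cylExp_injective hN
  rw [bdry, slitMap_coe, cylExp_eq hN, cylExp_eq hN]
  exact h1.exp_eq (tanRel_slit hN s)

theorem slitMap_bdry_of_lt {N lam β : ℝ} (hN : 0 < N) (hlam : 0 < lam)
    (hβ : β ∈ Set.Ioo 0 (Real.pi / 2)) (hδ : Real.sin β = delta N lam) {α : ℝ}
    (hα : Real.cos β ^ 2 < Real.cos α ^ 2) :
    ∃ s ∈ Set.Ioc 0 lam, slitMap N (delta N lam) (bdry N α) = ((s * I : ℂ) : Cyl N) := by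
  have hδ' := delta_mem hN hlam
  have hcβ := cos_pos_of_mem hβ
  have hc : Real.cos α ≠ 0 := by
    intro h
    rw [h] at hα
    nlinarith
  have hpos : 0 < Real.sin β ^ 2 - Real.cos β ^ 2 * Real.tan α ^ 2 := by
    rw [Real.tan_eq_sin_div_cos, div_pow, Real.sin_sq α, Real.sin_sq β]
    have h2 : 0 < Real.cos α ^ 2 := by positivity
    have : 1 - Real.cos β ^ 2 - Real.cos β ^ 2 * ((1 - Real.cos α ^ 2) / Real.cos α ^ 2) =
        1 - Real.cos β ^ 2 / Real.cos α ^ 2 := by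
      field_simp
      ring
    rw [this, sub_pos, div_lt_one h2]
    exact hα
  have hle : Real.sqrt (Real.sin β ^ 2 - Real.cos β ^ 2 * Real.tan α ^ 2) ≤ delta N lam := by
    rw [← hδ]
    apply Real.sqrt_le_iff.2
    exact ⟨by rw [hδ]; exact hδ'.1.le, by nlinarith [sq_nonneg (Real.cos β * Real.tan α)]⟩
  obtain ⟨s, hs, hsd⟩ := exists_delta_eq hN (Real.sqrt_pos.2 hpos) hle hlam
  exact ⟨s, hs, slitMap_bdry_eq_slit hN hlam hδ hc hs.1 (by rw [hsd, Real.sq_sqrt hpos.le])⟩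

theorem exists_slitMap_bdry_eq_slit {N lam β : ℝ} (hN : 0 < N) (hlam : 0 < lam)
    (hβ : β ∈ Set.Ioo 0 (Real.pi / 2)) (hδ : Real.sin β = delta N lam) {s : ℝ}
    (hs : s ∈ Set.Ioc 0 lam) :
    ∃ α, slitMap N (delta N lam) (bdry N α) = ((s * I : ℂ) : Cyl N) := by
  have hcβ := cos_pos_of_mem hβ
  have hsd := delta_mem hN hs.1
  have hle : delta N s ≤ Real.sin β := by
    rw [hδ]
    exact delta_mono hN hs.2
  refine ⟨Real.arctan (Real.sqrt (Real.sin β ^ 2 - delta N s ^ 2) / Real.cos β),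
    slitMap_bdry_eq_slit hN hlam hδ (Real.cos_arctan_pos _).ne' hs.1 ?_⟩
  rw [Real.tan_arctan, div_pow, Real.sq_sqrt (by nlinarith [hsd.1])]
  field_simp
  ring

end CHL

end

noncomputable section

namespace CHL

/-! ### The trees of the cluster -/

/-- The coordinates in `ℝ / πℤ` of the positions of the particles. -/
def coord (N : ℝ) (x : ℕ → ℝ) (n : ℕ) : ℝ := x n / (2 * N)

theorem bdry_coord {N : ℝ} (hN : 0 < N) (x : ℕ → ℝ) (n : ℕ) :
    bdry N (coord N x n) = ((x n : ℂ) : Cyl N) := by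
  rw [bdry, coord, mul_div_cancel₀ _ (by positivity)]

theorem bdry_sub (N a b : ℝ) : bdry N a - bdry N b = bdry N (a - b) := by
  rw [bdry, bdry, bdry, ← QuotientAddGroup.mk_sub]
  congr 1
  push_cast
  ring

theorem bdry_add (N a b : ℝ) : bdry N a + bdry N b = bdry N (a + b) := by
  rw [bdry, bdry, bdry, ← QuotientAddGroup.mk_add]
  congr 1
  push_cast
  ring

/-- The point at height `s` above the position `a`. -/
def above (N a s : ℝ) : Cyl N := ((a + s * Complex.I : ℂ) : Cyl N)

theorem above_eq (N a s : ℝ) :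
    above N a s = ((s * Complex.I : ℂ) : Cyl N) + ((a : ℂ) : Cyl N) := by
  rw [above, ← QuotientAddGroup.mk_add, add_comm]

theorem height_above (N a s : ℝ) : height N (above N a s) = s := by
  rw [above, height_coe]
  simp

theorem continuous_above (N a : ℝ) : Continuous (above N a) := by
  have h : Continuous fun s : ℝ => (a + s * Complex.I : ℂ) := by fun_prop
  exact QuotientAddGroup.isOpenQuotientMap_mk.continuous.comp h

theorem above_zero {N : ℝ} (hN : 0 < N) (x : ℕ → ℝ) (n : ℕ) :
    above N (x n) 0 = bdry N (coord N x n) := by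
  rw [bdry_coord hN, above]
  simp

section

variable {N lam β : ℝ}

theorem slitMapAt_mapsTo_interior (hN : 0 < N) (hlam : 0 < lam) (a : ℝ) :
    Set.MapsTo (slitMapAt N (delta N lam) a) (interiorCyl N) (interiorCyl N) := by
  intro p hp
  have h : p - ((a : ℂ) : Cyl N) ∈ interiorCyl N := by
    rw [interiorCyl, Set.mem_ofPred_eq, height_sub_real]
    exact hp
  have := slitMap_mapsTo_interior hN (delta_mem hN hlam) h
  rw [interiorCyl, Set.mem_ofPred_eq] at this ⊢
  rwa [slitMapAt, height_add_real]

theorem slitMapAt_mapsTo_closed (hN : 0 < N) (hlam : 0 < lam) (a : ℝ) :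
    Set.MapsTo (slitMapAt N (delta N lam) a) (closedCyl N) (closedCyl N) := by
  intro p hp
  have h : p - ((a : ℂ) : Cyl N) ∈ closedCyl N := by
    rw [closedCyl, Set.mem_ofPred_eq, height_sub_real]
    exact hp
  have := slitMap_mapsTo_closed hN (delta_mem hN hlam) h
  rw [closedCyl, Set.mem_ofPred_eq] at this ⊢
  rwa [slitMapAt, height_add_real]

theorem slitMapAt_injOn (hN : 0 < N) (hlam : 0 < lam) (a : ℝ) :
    Set.InjOn (slitMapAt N (delta N lam) a) (interiorCyl N) := by
  intro p hp q hq h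
  have hp' : p - ((a : ℂ) : Cyl N) ∈ interiorCyl N := by
    rw [interiorCyl, Set.mem_ofPred_eq, height_sub_real]
    exact hp
  have hq' : q - ((a : ℂ) : Cyl N) ∈ interiorCyl N := by
    rw [interiorCyl, Set.mem_ofPred_eq, height_sub_real]
    exact hq
  exact sub_left_injective (slitMap_injOn hN (delta_mem hN hlam) hp' hq' (add_right_cancel h))

theorem continuousOn_slitMapAt (hN : 0 < N) (hlam : 0 < lam) (a : ℝ) :
    ContinuousOn (slitMapAt N (delta N lam) a) (closedCyl N) := by
  have h1 : ContinuousOn (fun p : Cyl N => slitMap N (delta N lam) (p - ((a : ℂ) : Cyl N)))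
      (closedCyl N) := by
    refine (continuousOn_slitMap hN (delta_mem hN hlam)).comp
      (continuous_id.sub continuous_const).continuousOn fun p hp => ?_
    change 0 ≤ height N (p - ((a : ℂ) : Cyl N))
    rwa [height_sub_real]
  exact h1.add continuousOn_const

theorem slitMapAt_ne_above (hN : 0 < N) (hlam : 0 < lam) (a : ℝ) {p : Cyl N}
    (hp : p ∈ interiorCyl N) {s : ℝ} (hs : s ∈ Set.Ioc 0 lam) :
    slitMapAt N (delta N lam) a p ≠ above N a s := by
  have hp' : p - ((a : ℂ) : Cyl N) ∈ interiorCyl N := by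
    rw [interiorCyl, Set.mem_ofPred_eq, height_sub_real]
    exact hp
  rw [slitMapAt, above_eq]
  exact fun h => slitMap_ne_slit hN hlam hp' hs (add_right_cancel h)

/-- A boundary point is mapped to the boundary, or to the slit if the collapsed boundary map sends
it to the foot of the slit. -/
theorem slitMapAt_bdry (hN : 0 < N) (hlam : 0 < lam) (hβ : β ∈ Set.Ioo 0 (Real.pi / 2))
    (hδ : Real.sin β = delta N lam) (x : ℕ → ℝ) (n : ℕ) (α : ℝ) :
    (Real.cos (α - coord N x n) ^ 2 ≤ Real.cos β ^ 2 ∧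
      slitMapAt N (delta N lam) (x n) (bdry N α) = bdry N (pull β (coord N x n) α)) ∨
    (Real.cos β ^ 2 < Real.cos (α - coord N x n) ^ 2 ∧
      (∃ s ∈ Set.Ioc 0 lam, slitMapAt N (delta N lam) (x n) (bdry N α) = above N (x n) s) ∧
      ∃ k : ℤ, pull β (coord N x n) α = coord N x n + k * Real.pi) := by
  rcases le_or_gt (Real.cos (α - coord N x n) ^ 2) (Real.cos β ^ 2) with h | h
  · left
    refine ⟨h, ?_⟩
    rw [slitMapAt, ← bdry_coord hN, bdry_sub, slitMap_bdry_of_le hN hlam hβ hδ h, bdry_add, pull,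
      add_comm]
  · right
    refine ⟨h, ?_, ?_⟩
    · obtain ⟨s, hs, hs'⟩ := slitMap_bdry_of_lt hN hlam hβ hδ h
      refine ⟨s, hs, ?_⟩
      rw [slitMapAt, ← bdry_coord hN, bdry_sub, hs', above_eq, bdry_coord hN]
    · obtain ⟨k, hk⟩ := exists_inMap_eq_int_mul_pi hβ h.le
      exact ⟨k, by rw [pull, hk]⟩

theorem slitMapAt_image_boundary (hN : 0 < N) (hlam : 0 < lam) (hβ : β ∈ Set.Ioo 0 (Real.pi / 2))
    (hδ : Real.sin β = delta N lam) (x : ℕ → ℝ) (n : ℕ) :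
    boundary N ∪ above N (x n) '' Set.Ioc 0 lam ⊆
      slitMapAt N (delta N lam) (x n) '' boundary N := by
  rintro p (hp | ⟨s, hs, rfl⟩)
  · obtain ⟨α, rfl⟩ := exists_bdry_eq hN hp
    obtain ⟨h1, h2⟩ := inMap_outMap hβ (α - coord N x n)
    refine ⟨bdry N (outMap β (α - coord N x n) + coord N x n), bdry_mem _ _, ?_⟩
    rw [slitMapAt, ← bdry_coord hN, bdry_sub, add_sub_cancel_right,
      slitMap_bdry_of_le hN hlam hβ hδ h2, h1, bdry_add, sub_add_cancel]
  · obtain ⟨α, hα⟩ := exists_slitMap_bdry_eq_slit hN hlam hβ hδ hs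
    refine ⟨bdry N (α + coord N x n), bdry_mem _ _, ?_⟩
    rw [slitMapAt, ← bdry_coord hN, bdry_sub, add_sub_cancel_right, hα, above_eq, bdry_coord hN]

theorem above_mem_interior (N a : ℝ) {s : ℝ} (hs : 0 < s) : above N a s ∈ interiorCyl N := by
  rwa [interiorCyl, Set.mem_ofPred_eq, height_above]

theorem particle_eq (N lam : ℝ) (x : ℕ → ℝ) (n : ℕ) :
    particle N lam x n = chl N lam x n '' (above N (x n) '' Set.Ioc 0 lam) := rfl

theorem chl_mapsTo_interior (hN : 0 < N) (hlam : 0 < lam) (x : ℕ → ℝ) (n : ℕ) :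
    Set.MapsTo (chl N lam x n) (interiorCyl N) (interiorCyl N) := by
  induction n with
  | zero => exact Set.mapsTo_id _
  | succ n ih => exact ih.comp (slitMapAt_mapsTo_interior hN hlam _)

theorem chl_injOn (hN : 0 < N) (hlam : 0 < lam) (x : ℕ → ℝ) (n : ℕ) :
    Set.InjOn (chl N lam x n) (interiorCyl N) := by
  induction n with
  | zero => exact Set.injOn_id _
  | succ n ih => exact ih.comp (slitMapAt_injOn hN hlam _) (slitMapAt_mapsTo_interior hN hlam _)

theorem continuousOn_chl (hN : 0 < N) (hlam : 0 < lam) (x : ℕ → ℝ) (n : ℕ) :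
    ContinuousOn (chl N lam x n) (closedCyl N) := by
  induction n with
  | zero => exact continuousOn_id
  | succ n ih => exact ih.comp (continuousOn_slitMapAt hN hlam _) (slitMapAt_mapsTo_closed hN hlam _)

theorem interior_disjoint_boundary (N : ℝ) : Disjoint (interiorCyl N) (boundary N) := by
  rw [Set.disjoint_left]
  intro p hp hb
  rw [mem_boundary_iff] at hb
  exact (ne_of_gt hp) hb

theorem particle_subset_interior (hN : 0 < N) (hlam : 0 < lam) (x : ℕ → ℝ) (n : ℕ) :
    particle N lam x n ⊆ interiorCyl N := by
  rintro _ ⟨_, ⟨s, hs, rfl⟩, rfl⟩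
  exact chl_mapsTo_interior hN hlam x n (above_mem_interior N (x n) hs.1)

theorem exists_chl_eq (hN : 0 < N) (hlam : 0 < lam) (x : ℕ → ℝ) {k n : ℕ} (h : k < n) {p : Cyl N}
    (hp : p ∈ interiorCyl N) :
    ∃ q ∈ interiorCyl N, chl N lam x n p = chl N lam x k (slitMapAt N (delta N lam) (x k) q) := by
  induction n, h using Nat.le_induction generalizing p with
  | base => exact ⟨p, hp, rfl⟩
  | succ n hn ih => exact ih (slitMapAt_mapsTo_interior hN hlam (x n) hp)

theorem particle_disjoint (hN : 0 < N) (hlam : 0 < lam) (x : ℕ → ℝ) {k n : ℕ} (h : k ≠ n) :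
    Disjoint (particle N lam x k) (particle N lam x n) := by
  wlog hkn : k < n generalizing k n
  · exact (this h.symm (by omega)).symm
  rw [Set.disjoint_left]
  rintro _ ⟨_, ⟨s, hs, rfl⟩, rfl⟩ ⟨_, ⟨u, hu, rfl⟩, hus⟩
  obtain ⟨q, hq, hq'⟩ := exists_chl_eq hN hlam x hkn (above_mem_interior N (x n) hu.1)
  have hus' : chl N lam x n (above N (x n) u) = chl N lam x k (above N (x k) s) := hus
  rw [hq'] at hus'
  exact slitMapAt_ne_above hN hlam _ hq hs (chl_injOn hN hlam x k
    (slitMapAt_mapsTo_interior hN hlam _ hq) (above_mem_interior N (x k) hs.1) hus')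

/-- The image of a boundary point under the map of the first `n` particles is on the boundary, or on
a particle whose foot is the image of the point under the collapsed boundary map. -/
theorem chl_bdry (hN : 0 < N) (hlam : 0 < lam) (hβ : β ∈ Set.Ioo 0 (Real.pi / 2))
    (hδ : Real.sin β = delta N lam) (x : ℕ → ℝ) (n : ℕ) (α : ℝ) :
    chl N lam x n (bdry N α) ∈ boundary N ∨
      ∃ k < n, chl N lam x n (bdry N α) ∈ particle N lam x k ∧
        ∃ j : ℤ, back β (coord N x) n α = back β (coord N x) k (coord N x k) + j * Real.pi := by
  induction n generalizing α with
  | zero => exact Or.inl (bdry_mem N α)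
  | succ n ih =>
    rcases slitMapAt_bdry hN hlam hβ hδ x n α with ⟨-, h⟩ | ⟨-, ⟨s, hs, h⟩, j, hj⟩
    · rw [chl, Function.comp, h]
      rcases ih (pull β (coord N x n) α) with h' | ⟨k, hk, hk', hj⟩
      · exact Or.inl h'
      · exact Or.inr ⟨k, by omega, hk', hj⟩
    · refine Or.inr ⟨n, by omega, ?_, j, ?_⟩
      · rw [chl, Function.comp, h]
        exact ⟨_, ⟨s, hs, rfl⟩, rfl⟩
      · rw [back, Function.comp, hj, back_add_int_mul_pi]

/-- Only one boundary point is mapped to a given boundary point that lies at no tree. -/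
theorem eq_add_int_mul_pi_of_back_eq (hN : 0 < N) (hlam : 0 < lam)
    (hβ : β ∈ Set.Ioo 0 (Real.pi / 2)) (hδ : Real.sin β = delta N lam) (x : ℕ → ℝ) {n : ℕ}
    {α γ : ℝ} (hreg : Regular β (coord N x) n α) (hα : chl N lam x n (bdry N α) ∈ boundary N)
    {j : ℤ} (h : back β (coord N x) n γ = back β (coord N x) n α + j * Real.pi) :
    ∃ l : ℤ, γ = α + l * Real.pi := by
  induction n generalizing α γ with
  | zero => exact ⟨j, h⟩
  | succ n ih =>
    obtain ⟨hne, hreg'⟩ := regular_succ hreg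
    rcases slitMapAt_bdry hN hlam hβ hδ x n α with ⟨hle, h'⟩ | ⟨-, ⟨s, hs, h'⟩, -⟩
    · rw [chl, Function.comp, h'] at hα
      obtain ⟨l, hl⟩ := ih hreg' hα h
      have hlt := hle.lt_of_ne hne
      rw [pull, pull] at hl
      obtain ⟨m, hm⟩ := eq_add_int_mul_pi_of_inMap_eq hβ hlt
        (w := γ - coord N x n) (k := l) (by linarith)
      exact ⟨m, by linarith⟩
    · rw [chl, Function.comp, h'] at hα
      exact absurd hα (Set.disjoint_left.1 (interior_disjoint_boundary N)
        (chl_mapsTo_interior hN hlam x n (above_mem_interior N (x n) hs.1)))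

/-- A point whose image is on the boundary is not collapsed to the foot of a tree. -/
theorem back_ne_of_chl_mem_boundary (hN : 0 < N) (hlam : 0 < lam)
    (hβ : β ∈ Set.Ioo 0 (Real.pi / 2)) (hδ : Real.sin β = delta N lam) (x : ℕ → ℝ) {n : ℕ}
    {α : ℝ} (hreg : Regular β (coord N x) n α) (hα : chl N lam x n (bdry N α) ∈ boundary N)
    {k : ℕ} (hk : k < n) (j : ℤ) :
    back β (coord N x) n α ≠ back β (coord N x) k (coord N x k) + j * Real.pi := by
  induction n generalizing α with
  | zero => omega
  | succ n ih =>
    obtain ⟨hne, hreg'⟩ := regular_succ hreg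
    rcases slitMapAt_bdry hN hlam hβ hδ x n α with ⟨hle, h'⟩ | ⟨-, ⟨s, hs, h'⟩, -⟩
    · rw [chl, Function.comp, h'] at hα
      rcases (Nat.lt_succ_iff.1 hk).lt_or_eq with hk | rfl
      · exact ih hreg' hα hk
      · intro h
        obtain ⟨l, hl⟩ := eq_add_int_mul_pi_of_back_eq hN hlam hβ hδ x hreg' hα
          (γ := coord N x k) (j := -j) (by
            rw [back, Function.comp] at h
            push_cast
            linarith)
        rw [pull] at hl
        exact inMap_ne_int_mul_pi hβ (hle.lt_of_ne hne) (-l) (by push_cast; linarith)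
    · rw [chl, Function.comp, h'] at hα
      exact absurd hα (Set.disjoint_left.1 (interior_disjoint_boundary N)
        (chl_mapsTo_interior hN hlam x n (above_mem_interior N (x n) hs.1)))

/-- The slit map sends the boundary circle onto the boundary circle and the slit, so every particle
adds its image and nothing else. -/
theorem cluster_eq (hN : 0 < N) (hlam : 0 < lam) (hβ : β ∈ Set.Ioo 0 (Real.pi / 2))
    (hδ : Real.sin β = delta N lam) (x : ℕ → ℝ) (n : ℕ) :
    cluster N lam x n = ⋃ k < n, particle N lam x k := by
  apply Set.Subset.antisymm
  · rintro _ ⟨⟨p, hp, rfl⟩, hnb⟩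
    obtain ⟨α, rfl⟩ := exists_bdry_eq hN hp
    rcases chl_bdry hN hlam hβ hδ x n α with h | ⟨k, hk, hk', -⟩
    · exact absurd h hnb
    · exact Set.mem_biUnion (show k ∈ {k | k < n} from hk) hk'
  · have key : ∀ m, boundary N ⊆ chl N lam x m '' boundary N ∧
        ∀ k < m, particle N lam x k ⊆ chl N lam x m '' boundary N := by
      intro m
      induction m with
      | zero => exact ⟨by rw [chl, Set.image_id], by omega⟩
      | succ m ih =>
        have hb := slitMapAt_image_boundary hN hlam hβ hδ x m
        have himg : chl N lam x (m + 1) '' boundary N =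
            chl N lam x m '' (slitMapAt N (delta N lam) (x m) '' boundary N) := by
          rw [chl, Set.image_comp]
        have h1 : chl N lam x m '' boundary N ⊆ chl N lam x (m + 1) '' boundary N := by
          rw [himg]
          exact Set.image_mono (Set.subset_union_left.trans hb)
        refine ⟨ih.1.trans h1, fun k hk => ?_⟩
        rcases (Nat.lt_succ_iff.1 hk).lt_or_eq with hk | rfl
        · exact (ih.2 k hk).trans h1
        · rw [himg, particle_eq]
          exact Set.image_mono (Set.subset_union_right.trans hb)
    refine Set.iUnion₂_subset fun k hk p hp => ⟨(key n).2 k hk hp, ?_⟩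
    exact Set.disjoint_left.1 (interior_disjoint_boundary N) (particle_subset_interior hN hlam x k hp)

/-- The union of those of the first `n` particles whose feet satisfy `P`. -/
def footUnion (N lam β : ℝ) (x : ℕ → ℝ) (P : ℝ → Prop) (n : ℕ) : Set (Cyl N) :=
  ⋃ k ∈ {k | k < n ∧ P (foot β (coord N x) k)}, particle N lam x k

theorem mem_footUnion {N lam β : ℝ} {x : ℕ → ℝ} {P : ℝ → Prop} {n : ℕ} {p : Cyl N} :
    p ∈ footUnion N lam β x P n ↔
      ∃ k, (k < n ∧ P (foot β (coord N x) k)) ∧ p ∈ particle N lam x k := by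
  simp [footUnion]

theorem above_mem_closed (N a : ℝ) {s : ℝ} (hs : 0 ≤ s) : above N a s ∈ closedCyl N := by
  rwa [closedCyl, Set.mem_ofPred_eq, height_above]

theorem chl_image_above_insert (hN : 0 < N) (hlam : 0 < lam) (x : ℕ → ℝ) (n : ℕ) :
    chl N lam x n '' (above N (x n) '' Set.Icc 0 lam) =
      insert (chl N lam x n (bdry N (coord N x n))) (particle N lam x n) := by
  rw [particle_eq, ← above_zero hN, ← Set.image_insert_eq, ← Set.image_insert_eq,
    Set.Ioc_insert_left hlam.le]

theorem continuousOn_chl_above (hN : 0 < N) (hlam : 0 < lam) (x : ℕ → ℝ) (n : ℕ) :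
    ContinuousOn (fun s => chl N lam x n (above N (x n) s)) (Set.Icc 0 lam) :=
  (continuousOn_chl hN hlam x n).comp (continuous_above N (x n)).continuousOn
    fun _ hs => above_mem_closed N (x n) hs.1

/-- The particle `n` is attached at the image of its position.  That point lies on an earlier
particle with the same foot, unless it is on the boundary, in which case no earlier particle has that
foot. -/
theorem isPreconnected_footUnion (hN : 0 < N) (hlam : 0 < lam)
    (hβ : β ∈ Set.Ioo 0 (Real.pi / 2)) (hδ : Real.sin β = delta N lam) (x : ℕ → ℝ)
    (hreg : ∀ n, Regular β (coord N x) n (coord N x n)) (r : ℝ) (n : ℕ) :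
    IsPreconnected (footUnion N lam β x (· = r) n) := by
  induction n with
  | zero =>
    have : footUnion N lam β x (· = r) 0 = ∅ := by
      ext p
      simp [mem_footUnion]
    rw [this]
    exact isPreconnected_empty
  | succ n ih =>
    by_cases hr : foot β (coord N x) n = r
    · have hstep : footUnion N lam β x (· = r) (n + 1) =
          footUnion N lam β x (· = r) n ∪ particle N lam x n := by
        ext p
        rw [Set.mem_union, mem_footUnion, mem_footUnion]
        constructor
        · rintro ⟨k, ⟨hk, hk'⟩, hp⟩
          rcases (Nat.lt_succ_iff.1 hk).lt_or_eq with hk | rfl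
          · exact Or.inl ⟨k, ⟨hk, hk'⟩, hp⟩
          · exact Or.inr hp
        · rintro (⟨k, ⟨hk, hk'⟩, hp⟩ | hp)
          · exact ⟨k, ⟨by omega, hk'⟩, hp⟩
          · exact ⟨n, ⟨by omega, hr⟩, hp⟩
      rw [hstep]
      by_cases hex : ∃ k < n, foot β (coord N x) k = r
      · obtain ⟨k, hk, hkr⟩ := hex
        set b := chl N lam x n (bdry N (coord N x n)) with hb
        -- the particle is attached at a point of its tree
        have hbmem : b ∈ footUnion N lam β x (· = r) n := by
          rcases chl_bdry hN hlam hβ hδ x n (coord N x n) with h | ⟨l, hl, hl', hj⟩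
          · obtain ⟨j, hj⟩ := (foot_eq_iff β (coord N x) n k).1 (hr.trans hkr.symm)
            exact absurd hj (back_ne_of_chl_mem_boundary hN hlam hβ hδ x (hreg n) h hk j)
          · exact mem_footUnion.2
              ⟨l, ⟨hl, by rw [← hr]; exact ((foot_eq_iff β (coord N x) n l).2 hj).symm⟩, hl'⟩
        have hins : footUnion N lam β x (· = r) n ∪ particle N lam x n =
            footUnion N lam β x (· = r) n ∪ insert b (particle N lam x n) := by
          rw [Set.union_insert, Set.insert_eq_of_mem (Set.mem_union_left _ hbmem)]
        rw [hins]
        refine ih.union b hbmem (Set.mem_insert _ _) ?_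
        rw [hb, ← chl_image_above_insert hN hlam, Set.image_image]
        exact isPreconnected_Icc.image _ (continuousOn_chl_above hN hlam x n)
      · have : footUnion N lam β x (· = r) n = ∅ := by
          rw [Set.eq_empty_iff_forall_notMem]
          intro p hp
          obtain ⟨k, ⟨hk, hk'⟩, -⟩ := mem_footUnion.1 hp
          exact hex ⟨k, hk, hk'⟩
        rw [this, Set.empty_union, particle_eq, Set.image_image]
        exact isPreconnected_Ioc.image _
          ((continuousOn_chl_above hN hlam x n).mono Set.Ioc_subset_Icc_self)
    · have hstep : footUnion N lam β x (· = r) (n + 1) = footUnion N lam β x (· = r) n := by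
        ext p
        rw [mem_footUnion, mem_footUnion]
        constructor
        · rintro ⟨k, ⟨hk, hk'⟩, hp⟩
          rcases (Nat.lt_succ_iff.1 hk).lt_or_eq with hk | rfl
          · exact ⟨k, ⟨hk, hk'⟩, hp⟩
          · exact absurd hk' hr
        · rintro ⟨k, ⟨hk, hk'⟩, hp⟩
          exact ⟨k, ⟨by omega, hk'⟩, hp⟩
      rwa [hstep]

/-- Adding the end points at which they are attached makes a union of particles closed; such an end
point that is not on the boundary is on a particle with the same foot, so it belongs to the union. -/
theorem exists_isClosed_footUnion (hN : 0 < N) (hlam : 0 < lam)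
    (hβ : β ∈ Set.Ioo 0 (Real.pi / 2)) (hδ : Real.sin β = delta N lam) (x : ℕ → ℝ) (P : ℝ → Prop)
    (n : ℕ) : ∃ K, IsClosed K ∧ footUnion N lam β x P n ⊆ K ∧
      K ⊆ footUnion N lam β x P n ∪ boundary N := by
  have : T2Space (Cyl N) := (isEmbedding_cylExp hN).t2Space
  refine ⟨⋃ k ∈ {k | k < n ∧ P (foot β (coord N x) k)},
    chl N lam x k '' (above N (x k) '' Set.Icc 0 lam), ?_, ?_, ?_⟩
  · refine Set.Finite.isClosed_biUnion ((Set.finite_lt_nat n).subset fun k hk => hk.1)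
      fun k _ => ?_
    rw [Set.image_image]
    exact (isCompact_Icc.image_of_continuousOn (continuousOn_chl_above hN hlam x k)).isClosed
  · refine Set.iUnion₂_mono fun k _ => ?_
    rw [chl_image_above_insert hN hlam]
    exact Set.subset_insert _ _
  · refine Set.iUnion₂_subset fun k hk => ?_
    rw [chl_image_above_insert hN hlam]
    refine Set.insert_subset ?_ fun p hp => Or.inl (mem_footUnion.2 ⟨k, hk, hp⟩)
    rcases chl_bdry hN hlam hβ hδ x k (coord N x k) with h | ⟨l, hl, hl', hj⟩
    · exact Or.inr h
    · refine Or.inl (mem_footUnion.2 ⟨l, ⟨hl.trans hk.1, ?_⟩, hl'⟩)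
      rw [← (foot_eq_iff β (coord N x) k l).2 hj]
      exact hk.2

theorem particle_nonempty (N : ℝ) (hlam : 0 < lam) (x : ℕ → ℝ) (n : ℕ) :
    (particle N lam x n).Nonempty :=
  ((Set.nonempty_Ioc.2 hlam).image _).image _

/-- Particles belong to the same tree if and only if they have the same foot. -/
theorem sameTree_iff (hN : 0 < N) (hlam : 0 < lam)
    (hβ : β ∈ Set.Ioo 0 (Real.pi / 2)) (hδ : Real.sin β = delta N lam) (x : ℕ → ℝ)
    (hreg : ∀ n, Regular β (coord N x) n (coord N x n)) (i j : ℕ) :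
    SameTree N lam x i j ↔ foot β (coord N x) i = foot β (coord N x) j := by
  constructor
  · rintro ⟨n, hi, hj, Θ, ⟨p, hp, rfl⟩, hiΘ, hjΘ⟩
    by_contra hne
    obtain ⟨K, hK, hK1, hK2⟩ := exists_isClosed_footUnion hN hlam hβ hδ x
      (· = foot β (coord N x) i) n
    obtain ⟨L, hL, hL1, hL2⟩ := exists_isClosed_footUnion hN hlam hβ hδ x
      (· ≠ foot β (coord N x) i) n
    set Θ := connectedComponentIn (cluster N lam x n) p
    have hΘc : Θ ⊆ cluster N lam x n := connectedComponentIn_subset _ _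
    have hΘp : IsPreconnected Θ := isPreconnected_connectedComponentIn
    obtain ⟨a, ha⟩ := particle_nonempty N hlam x i
    obtain ⟨b, hb⟩ := particle_nonempty N hlam x j
    obtain ⟨q, hq, hqK, hqL⟩ := isPreconnected_closed_iff.1 hΘp K L hK hL
      (by
        intro q hq
        have := hΘc hq
        rw [cluster_eq hN hlam hβ hδ, Set.mem_iUnion₂] at this
        obtain ⟨k, hk, hqk⟩ := this
        by_cases hkr : foot β (coord N x) k = foot β (coord N x) i
        · exact Or.inl (hK1 (mem_footUnion.2 ⟨k, ⟨hk, hkr⟩, hqk⟩))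
        · exact Or.inr (hL1 (mem_footUnion.2 ⟨k, ⟨hk, hkr⟩, hqk⟩)))
      ⟨a, hiΘ ha, hK1 (mem_footUnion.2 ⟨i, ⟨hi, rfl⟩, ha⟩)⟩
      ⟨b, hjΘ hb, hL1 (mem_footUnion.2 ⟨j, ⟨hj, fun h => hne h.symm⟩, hb⟩)⟩
    have hnb := (hΘc hq).2
    obtain ⟨k, ⟨-, hk⟩, hqk⟩ := mem_footUnion.1 ((hK2 hqK).resolve_right hnb)
    obtain ⟨l, ⟨-, hl⟩, hql⟩ := mem_footUnion.1 ((hL2 hqL).resolve_right hnb)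
    have hkl : k ≠ l := by
      rintro rfl
      exact hl hk
    exact Set.disjoint_left.1 (particle_disjoint hN hlam x hkl) hqk hql
  · intro h
    have hsub : footUnion N lam β x (· = foot β (coord N x) i) (max i j + 1) ⊆
        cluster N lam x (max i j + 1) := by
      rw [cluster_eq hN hlam hβ hδ]
      exact Set.biUnion_subset_biUnion_left fun k hk => hk.1
    have hi : particle N lam x i ⊆
        footUnion N lam β x (· = foot β (coord N x) i) (max i j + 1) :=
      fun p hp => mem_footUnion.2 ⟨i, ⟨by omega, rfl⟩, hp⟩
    have hj : particle N lam x j ⊆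
        footUnion N lam β x (· = foot β (coord N x) i) (max i j + 1) :=
      fun p hp => mem_footUnion.2 ⟨j, ⟨by omega, h.symm⟩, hp⟩
    obtain ⟨a, ha⟩ := particle_nonempty N hlam x i
    have hcc := (isPreconnected_footUnion hN hlam hβ hδ x hreg (foot β (coord N x) i)
      (max i j + 1)).subset_connectedComponentIn (hi ha) hsub
    exact ⟨max i j + 1, by omega, by omega, _, ⟨a, hsub (hi ha), rfl⟩, hi.trans hcc, hj.trans hcc⟩

end

end CHL

end

noncomputable section

namespace CHL

/-! ### Occupation patterns of a sequence of times -/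

/-- The number of elements of `s` below `k`. -/
def rank (s : Finset ℕ) (k : ℕ) : ℕ := (s.filter (· < k)).card

theorem rank_zero (s : Finset ℕ) : rank s 0 = 0 := by simp [rank]

theorem rank_succ (s : Finset ℕ) (k : ℕ) : rank s (k + 1) = rank s k + if k ∈ s then 1 else 0 := by
  have h : s.filter (· < k + 1) = s.filter (· < k) ∪ s.filter (· = k) := by
    ext i
    simp only [Finset.mem_union, Finset.mem_filter, Nat.lt_succ_iff_lt_or_eq]
    tauto
  have hd : Disjoint (s.filter (· < k)) (s.filter (· = k)) := by
    refine Finset.disjoint_filter.2 fun i _ h1 h2 => ?_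
    exact absurd h2 (ne_of_lt h1)
  rw [rank, h, Finset.card_union_of_disjoint hd, Finset.filter_eq', rank]
  split_ifs <;> simp

theorem rank_mono (s : Finset ℕ) : Monotone (rank s) :=
  monotone_nat_of_le_succ fun k => by rw [rank_succ]; omega

theorem prod_rank {M : Type*} [CommMonoid M] (f : ℕ → M) (s : Finset ℕ) (K : ℕ) :
    ∏ k ∈ Finset.range K, (if k ∈ s then f (rank s k) else 1) =
      ∏ i ∈ Finset.range (rank s K), f i := by
  induction K with
  | zero => simp [rank_zero]
  | succ K ih =>
    rw [Finset.prod_range_succ, ih, rank_succ]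
    split_ifs
    · rw [Finset.prod_range_succ]
    · simp

/-- Of the first `K` time intervals of length `h`, those with index in `s` contain one of the times,
and the others contain none. -/
def Pattern (t : ℕ → ℝ) (h : ℝ) (K : ℕ) (s : Finset ℕ) : Prop :=
  ∀ k < K, {n | t n ∈ Set.Ioc (k * h) ((k + 1) * h)}.encard = if k ∈ s then 1 else 0

theorem Pattern.le_iff {t : ℕ → ℝ} (ht : StrictMono t) (h0 : ∀ n, 0 < t n) {h : ℝ} (hh : 0 < h)
    {K : ℕ} {s : Finset ℕ} (hp : Pattern t h K s) {k : ℕ} (hk : k ≤ K) (n : ℕ) :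
    t n ≤ k * h ↔ n < rank s k := by
  induction k generalizing n with
  | zero =>
    rw [rank_zero]
    simpa using h0 n
  | succ k ih =>
    have ih' := ih (by omega)
    have hcell := hp k (by omega)
    have hsplit : ∀ n, t n ≤ ((k + 1 : ℕ) : ℝ) * h ↔ n < rank s k ∨
        n ∈ {n | t n ∈ Set.Ioc (k * h) ((k + 1) * h)} := by
      intro n
      rw [← ih', Set.mem_ofPred_eq, Set.mem_Ioc]
      push_cast
      constructor
      · intro h1
        rcases le_or_gt (t n) (k * h) with h2 | h2
        · exact Or.inl h2
        · exact Or.inr ⟨h2, h1⟩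
      · rintro (h1 | h1)
        · linarith
        · exact h1.2
    rw [hsplit, rank_succ]
    split_ifs at hcell ⊢ with hs
    · obtain ⟨m, hm⟩ := Set.encard_eq_one.1 hcell
      rw [hm, Set.mem_singleton_iff]
      have hm' : m ∈ {n | t n ∈ Set.Ioc (k * h) ((k + 1) * h)} := by rw [hm]; rfl
      -- the time in the new interval is the next one, as the times are listed in order
      have hmr : m = rank s k := by
        have h1 : ¬ m < rank s k := by
          rw [← ih']
          exact not_le.2 hm'.1
        by_contra hne
        have h2 : t (rank s k) < t m := ht (by omega)
        have h3 := (hsplit (rank s k)).1 (by push_cast; exact h2.le.trans hm'.2)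
        rw [hm, Set.mem_singleton_iff] at h3
        omega
      omega
    · rw [Set.encard_eq_zero] at hcell
      rw [hcell]
      simp

theorem Pattern.mem_cell_iff {t : ℕ → ℝ} (ht : StrictMono t) (h0 : ∀ n, 0 < t n) {h : ℝ}
    (hh : 0 < h) {K : ℕ} {s : Finset ℕ} (hp : Pattern t h K s) {k : ℕ} (hk : k < K) (n : ℕ) :
    t n ∈ Set.Ioc (k * h) ((k + 1) * h) ↔ k ∈ s ∧ n = rank s k := by
  have h1 := hp.le_iff ht h0 hh hk.le n
  have h2 := hp.le_iff ht h0 hh (show k + 1 ≤ K from hk) n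
  rw [rank_succ] at h2
  push_cast at h2
  rw [Set.mem_Ioc, ← not_le, h1, h2]
  by_cases hs : k ∈ s
  · simp only [hs, if_true, true_and]
    omega
  · rw [if_neg hs, add_zero]
    exact ⟨fun h3 => absurd h3.2 h3.1, fun h3 => absurd h3.1 hs⟩

theorem exists_cell {h u : ℝ} (hu : 0 < u) {K : ℕ} (hK : u ≤ K * h) :
    ∃ k < K, u ∈ Set.Ioc (k * h) ((k + 1) * h) := by
  induction K with
  | zero => simp at hK; linarith
  | succ K ih =>
    rcases le_or_gt u (K * h) with h1 | h1
    · obtain ⟨k, hk, hk'⟩ := ih h1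
      exact ⟨k, by omega, hk'⟩
    · exact ⟨K, by omega, h1, by exact_mod_cast hK⟩

/-- The marks of the points lie in prescribed sets if and only if the numbers of points in the cells,
divided according to these sets, have prescribed values. -/
theorem pattern_and_mem_iff {t x : ℕ → ℝ} (ht : StrictMono t) (h0 : ∀ n, 0 < t n) {h : ℝ}
    (hh : 0 < h) {K : ℕ} {s : Finset ℕ} (B : ℕ → Set ℝ) :
    (Pattern t h K s ∧ ∀ i < rank s K, x i ∈ B i) ↔
      ∀ k < K, {n | (t n, x n) ∈ Set.Ioc (k * h) ((k + 1) * h) ×ˢ B (rank s k)}.encard =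
          (if k ∈ s then 1 else 0) ∧
        {n | (t n, x n) ∈ Set.Ioc (k * h) ((k + 1) * h) ×ˢ (B (rank s k))ᶜ}.encard = 0 := by
  constructor
  · rintro ⟨hp, hx⟩ k hk
    have hcell := hp.mem_cell_iff ht h0 hh hk
    have hB : k ∈ s → x (rank s k) ∈ B (rank s k) := by
      intro hks
      apply hx
      have := rank_mono s (show k + 1 ≤ K from hk)
      rw [rank_succ, if_pos hks] at this
      omega
    constructor
    · split_ifs with hks
      · rw [Set.encard_eq_one]
        refine ⟨rank s k, ?_⟩
        ext n
        rw [Set.mem_ofPred_eq, Set.mem_prod, hcell, Set.mem_singleton_iff]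
        constructor
        · rintro ⟨⟨-, h1⟩, -⟩
          exact h1
        · rintro rfl
          exact ⟨⟨hks, rfl⟩, hB hks⟩
      · rw [Set.encard_eq_zero, Set.eq_empty_iff_forall_notMem]
        rintro n ⟨h1, -⟩
        exact hks ((hcell n).1 h1).1
    · rw [Set.encard_eq_zero, Set.eq_empty_iff_forall_notMem]
      rintro n ⟨h1, h2⟩
      obtain ⟨h3, rfl⟩ := (hcell n).1 h1
      exact h2 (hB h3)
  · intro hc
    have hp : Pattern t h K s := by
      intro k hk
      obtain ⟨h1, h2⟩ := hc k hk
      rw [← h1]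
      congr 1
      ext n
      rw [Set.mem_ofPred_eq, Set.mem_ofPred_eq, Set.mem_prod]
      refine ⟨fun h3 => ⟨h3, ?_⟩, fun h3 => h3.1⟩
      by_contra h4
      rw [Set.encard_eq_zero, Set.eq_empty_iff_forall_notMem] at h2
      exact h2 n ⟨h3, h4⟩
    refine ⟨hp, fun i hi => ?_⟩
    obtain ⟨k, hk, hik⟩ := exists_cell (h0 i) ((hp.le_iff ht h0 hh le_rfl i).2 hi)
    obtain ⟨hks, hir⟩ := (hp.mem_cell_iff ht h0 hh hk i).1 hik
    obtain ⟨-, h2⟩ := hc k hk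
    rw [Set.encard_eq_zero, Set.eq_empty_iff_forall_notMem] at h2
    by_contra h4
    rw [hir] at h4 hik
    exact h2 _ ⟨hik, h4⟩

/-! ### The arrival times and positions -/

section

variable {Ω : Type*} [MeasurableSpace Ω] {μ : Measure Ω}

theorem measurableSet_encard_eq {E : Type*} [MeasurableSpace E] {p : ℕ → Ω → E}
    (hp : ∀ n, Measurable (p n)) {B : Set E} (hB : MeasurableSet B) (k : ℕ) :
    MeasurableSet {ω | {n | p n ω ∈ B}.encard = k} := by
  have : {ω | {n | p n ω ∈ B}.encard = k} =
      ⋃ s ∈ {s : Finset ℕ | s.card = k}, {ω | ∀ n, p n ω ∈ B ↔ n ∈ s} := by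
    ext ω
    simp only [Set.mem_ofPred_eq, Set.mem_iUnion]
    constructor
    · intro h
      have hf : {n | p n ω ∈ B}.Finite := Set.finite_of_encard_eq_coe h
      refine ⟨hf.toFinset, ?_, fun n => by simp⟩
      rw [hf.encard_eq_coe_toFinset_card] at h
      exact_mod_cast h
    · rintro ⟨s, hs, h⟩
      have : {n | p n ω ∈ B} = s := by
        ext n
        exact h n
      rw [this, Set.encard_coe_eq_coe_finsetCard, hs]
  rw [this]
  refine MeasurableSet.biUnion (Set.to_countable _) fun s _ => ?_
  have : {ω | ∀ n, p n ω ∈ B ↔ n ∈ s} = ⋂ n, {ω | p n ω ∈ B ↔ n ∈ s} := by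
    ext ω
    simp
  rw [this]
  refine MeasurableSet.iInter fun n => ?_
  by_cases hn : n ∈ s
  · have : {ω | p n ω ∈ B ↔ n ∈ s} = p n ⁻¹' B := by
      ext ω
      simp [hn]
    rw [this]
    exact hp n hB
  · have : {ω | p n ω ∈ B ↔ n ∈ s} = (p n ⁻¹' B)ᶜ := by
      ext ω
      simp [hn]
    rw [this]
    exact (hp n hB).compl

theorem real_count_law [IsProbabilityMeasure μ] {E : Type*} [MeasurableSpace E] {p : ℕ → Ω → E}
    {ν : Measure E} (hp : IsPoissonPointProcess p ν μ) {ι : Type*} [Fintype ι] (B : ι → Set E)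
    (hB : ∀ i, MeasurableSet (B i)) (hd : ∀ i j, i ≠ j → Disjoint (B i) (B j))
    (hν : ∀ i, ν (B i) ≠ ⊤) (k : ι → ℕ) :
    μ.real {ω | ∀ i, {n | p n ω ∈ B i}.encard = k i} =
      ∏ i, Real.exp (-ν.real (B i)) * ν.real (B i) ^ k i / (k i).factorial := by
  let e := Fintype.equivFin ι
  have h := hp.count_law (Fintype.card ι) (fun j => B (e.symm j)) (fun j => hB _)
    (fun i j hij => hd _ _ (by simpa using hij)) (fun j => hν _) (fun j => k (e.symm j))
  have hset : {ω | ∀ i, {n | p n ω ∈ B i}.encard = k i} =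
      {ω | ∀ j, {n | p n ω ∈ B (e.symm j)}.encard = k (e.symm j)} := by
    ext ω
    constructor
    · exact fun h j => h _
    · intro h i
      have := h (e i)
      rwa [e.symm_apply_apply] at this
  rw [hset, measureReal_def, h, ENNReal.toReal_prod, ← e.symm.prod_comp]
  refine Finset.prod_congr rfl fun j _ => ?_
  exact ProbabilityTheory.poissonMeasure_real_singleton _ _

theorem real_count_law_single [IsProbabilityMeasure μ] {E : Type*} [MeasurableSpace E]
    {p : ℕ → Ω → E} {ν : Measure E} (hp : IsPoissonPointProcess p ν μ) {B : Set E}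
    (hB : MeasurableSet B) (hν : ν B ≠ ⊤) (k : ℕ) :
    μ.real {ω | {n | p n ω ∈ B}.encard = k} =
      Real.exp (-ν.real B) * ν.real B ^ k / k.factorial := by
  have h := real_count_law hp (ι := Unit) (fun _ => B) (fun _ => hB)
    (fun i j hij => absurd rfl hij) (fun _ => hν) (fun _ => k)
  simpa using h

/-- The length of the part of a set that lies in the interval that represents the circle. -/
def arcLength (N : ℝ) (C : Set ℝ) : ℝ := (volume.restrict (Set.Ioc 0 (2 * Real.pi * N))).real C

theorem arcLength_nonneg (N : ℝ) (C : Set ℝ) : 0 ≤ arcLength N C := measureReal_nonneg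

theorem arcLength_univ {N : ℝ} (hN : 0 < N) : arcLength N Set.univ = 2 * Real.pi * N := by
  have := Real.pi_pos
  rw [arcLength, measureReal_restrict_apply MeasurableSet.univ, Set.univ_inter,
    Real.volume_real_Ioc_of_le (by positivity), sub_zero]

theorem arcLength_add_compl {N : ℝ} (hN : 0 < N) {C : Set ℝ} (hC : MeasurableSet C) :
    arcLength N C + arcLength N Cᶜ = 2 * Real.pi * N := by
  rw [← arcLength_univ hN, arcLength, arcLength, arcLength]
  exact measureReal_add_measureReal_compl hC

theorem intensity_prod (N : ℝ) (A C : Set ℝ) :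
    intensity N (A ×ˢ C) = volume.restrict (Set.Ioi 0) A *
      volume.restrict (Set.Ioc 0 (2 * Real.pi * N)) C := by
  rw [intensity, Measure.volume_eq_prod, ← Measure.prod_restrict, Measure.prod_prod]

theorem intensity_cell (N : ℝ) {a b : ℝ} (ha : 0 ≤ a) (hab : a ≤ b) (C : Set ℝ) :
    intensity N (Set.Ioc a b ×ˢ C) ≠ ⊤ ∧
      (intensity N).real (Set.Ioc a b ×ˢ C) = (b - a) * arcLength N C := by
  have h : volume.restrict (Set.Ioi (0 : ℝ)) (Set.Ioc a b) = ENNReal.ofReal (b - a) := by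
    rw [Measure.restrict_apply measurableSet_Ioc, Set.inter_eq_left.2, Real.volume_Ioc]
    exact fun u hu => ha.trans_lt hu.1
  constructor
  · rw [intensity_prod, h]
    exact ENNReal.mul_ne_top ENNReal.ofReal_ne_top (measure_ne_top _ _)
  · rw [measureReal_def, intensity_prod, h, ENNReal.toReal_mul,
      ENNReal.toReal_ofReal (by linarith)]
    rfl

section

variable {N : ℝ} {t x : ℕ → Ω → ℝ}

theorem IsDrivingProcess.measurable_time (hp : IsDrivingProcess N t x μ) (n : ℕ) :
    Measurable (t n) := (hp.poisson.measurable n).fst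

theorem IsDrivingProcess.measurable_position (hp : IsDrivingProcess N t x μ) (n : ℕ) :
    Measurable (x n) := (hp.poisson.measurable n).snd

theorem IsDrivingProcess.ae_mem [IsProbabilityMeasure μ] (hp : IsDrivingProcess N t x μ) :
    ∀ᵐ ω ∂μ, StrictMono (fun n => t n ω) ∧ ∀ n, 0 < t n ω := by
  have hS : MeasurableSet (Set.Iic (0 : ℝ) ×ˢ (Set.univ : Set ℝ)) :=
    measurableSet_Iic.prod MeasurableSet.univ
  have h0 : intensity N (Set.Iic (0 : ℝ) ×ˢ (Set.univ : Set ℝ)) = 0 := by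
    rw [intensity_prod, Measure.restrict_apply measurableSet_Iic, Set.Iic_inter_Ioi, Set.Ioc_self,
      measure_empty, zero_mul]
  have h := real_count_law_single hp.poisson hS (by rw [h0]; exact ENNReal.zero_ne_top) 0
  have h1 : ∀ᵐ ω ∂μ, {n | (t n ω, x n ω) ∈ Set.Iic (0 : ℝ) ×ˢ (Set.univ : Set ℝ)}.encard
      = ((0 : ℕ) : ℕ∞) := by
    rw [ae_iff]
    change μ {ω | {n | (t n ω, x n ω) ∈ Set.Iic (0 : ℝ) ×ˢ (Set.univ : Set ℝ)}.encard
      = ((0 : ℕ) : ℕ∞)}ᶜ = 0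
    rw [prob_compl_eq_zero_iff (measurableSet_encard_eq hp.poisson.measurable hS 0)]
    rw [measureReal_def, measureReal_def, h0] at h
    rw [← ENNReal.toReal_eq_one_iff, h]
    simp
  filter_upwards [hp.ordered, h1] with ω ho h2
  refine ⟨ho, fun n => ?_⟩
  rw [Nat.cast_zero, Set.encard_eq_zero, Set.eq_empty_iff_forall_notMem] at h2
  by_contra! h4
  exact h2 n ⟨h4, Set.mem_univ _⟩

/-- The cells of the pattern, divided into the parts over `B i` and over its complement, are disjoint,
so the probability of a pattern with prescribed positions is a product. -/
theorem real_pattern [IsProbabilityMeasure μ] (hN : 0 < N) (hp : IsDrivingProcess N t x μ) {h : ℝ} (hh : 0 < h) (K : ℕ)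
    (s : Finset ℕ) {B : ℕ → Set ℝ} (hB : ∀ i, MeasurableSet (B i)) :
    μ.real {ω | Pattern (fun n => t n ω) h K s ∧ ∀ i < rank s K, x i ω ∈ B i} =
      Real.exp (-(h * (2 * Real.pi * N))) ^ K *
        ∏ i ∈ Finset.range (rank s K), h * arcLength N (B i) := by
  set C : Fin K × Bool → Set (ℝ × ℝ) := fun q =>
    Set.Ioc (((q.1 : ℕ) : ℝ) * h) (((q.1 : ℕ) + 1) * h) ×ˢ
      (if q.2 then B (rank s q.1) else (B (rank s q.1))ᶜ) with hC
  have hCm : ∀ q, MeasurableSet (C q) := by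
    rintro ⟨k, b⟩
    refine measurableSet_Ioc.prod ?_
    cases b
    · simpa using (hB _).compl
    · simpa using hB _
  have hCd : ∀ q r, q ≠ r → Disjoint (C q) (C r) := by
    rintro ⟨k, b⟩ ⟨l, c⟩ hne
    rw [Set.disjoint_left]
    rintro ⟨u, v⟩ ⟨hu, hv⟩ ⟨hu', hv'⟩
    have hkl : k = l := by
      by_contra hkl
      rcases lt_or_gt_of_ne hkl with h1 | h1
      · have h2 : ((k : ℕ) : ℝ) + 1 ≤ (l : ℕ) := by exact_mod_cast h1
        have h3 : u ≤ ((k : ℕ) + 1) * h := hu.2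
        have h4 : ((l : ℕ) : ℝ) * h < u := hu'.1
        nlinarith
      · have h2 : ((l : ℕ) : ℝ) + 1 ≤ (k : ℕ) := by exact_mod_cast h1
        have h3 : u ≤ ((l : ℕ) + 1) * h := hu'.2
        have h4 : ((k : ℕ) : ℝ) * h < u := hu.1
        nlinarith
    subst hkl
    cases b <;> cases c <;> simp_all
  have hcell : ∀ k : Fin K, (0 : ℝ) ≤ ((k : ℕ) : ℝ) * h ∧
      ((k : ℕ) : ℝ) * h ≤ (((k : ℕ) : ℝ) + 1) * h := fun k => ⟨by positivity, by nlinarith⟩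
  have hlaw := real_count_law hp.poisson C hCm hCd
    (fun q => (intensity_cell N (hcell q.1).1 (hcell q.1).2 _).1)
    (fun q => if (q.1 : ℕ) ∈ s ∧ q.2 then 1 else 0)
  have hset : μ.real {ω | Pattern (fun n => t n ω) h K s ∧ ∀ i < rank s K, x i ω ∈ B i} =
      μ.real {ω | ∀ q, {n | (t n ω, x n ω) ∈ C q}.encard =
        ((if (q.1 : ℕ) ∈ s ∧ q.2 then 1 else 0 : ℕ) : ℕ∞)} := by
    apply measureReal_congr
    filter_upwards [hp.ae_mem] with ω hω
    apply propext
    change (Pattern (fun n => t n ω) h K s ∧ ∀ i < rank s K, x i ω ∈ B i) ↔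
      ∀ q, {n | (t n ω, x n ω) ∈ C q}.encard = ((if (q.1 : ℕ) ∈ s ∧ q.2 then 1 else 0 : ℕ) : ℕ∞)
    rw [pattern_and_mem_iff (x := fun n => x n ω) hω.1 hω.2 hh B]
    constructor
    · rintro h1 ⟨k, b⟩
      obtain ⟨h2, h3⟩ := h1 k k.2
      cases b
      · simpa [hC] using h3
      · simpa [hC] using h2
    · intro h1 k hk
      have h2 := h1 (⟨k, hk⟩, true)
      have h3 := h1 (⟨k, hk⟩, false)
      exact ⟨by simpa [hC] using h2, by simpa [hC] using h3⟩
  rw [hset, hlaw, Fintype.prod_prod_type]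
  have hterm : ∀ k : Fin K, (∏ b : Bool, Real.exp (-(intensity N).real (C (k, b))) *
      (intensity N).real (C (k, b)) ^ (if (k : ℕ) ∈ s ∧ b then 1 else 0) /
        ((if (k : ℕ) ∈ s ∧ b then 1 else 0 : ℕ).factorial : ℝ)) =
      Real.exp (-(h * (2 * Real.pi * N))) *
        (fun k => if k ∈ s then h * arcLength N (B (rank s k)) else 1) (k : ℕ) := by
    intro k
    have h1 := (intensity_cell N (hcell k).1 (hcell k).2 (B (rank s k))).2
    have h2 := (intensity_cell N (hcell k).1 (hcell k).2 (B (rank s k))ᶜ).2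
    rw [show (((k : ℕ) : ℝ) + 1) * h - ((k : ℕ) : ℝ) * h = h by ring] at h1 h2
    have hT : C (k, true) = Set.Ioc (((k : ℕ) : ℝ) * h) ((((k : ℕ) : ℝ) + 1) * h) ×ˢ
      B (rank s k) := rfl
    have hF : C (k, false) = Set.Ioc (((k : ℕ) : ℝ) * h) ((((k : ℕ) : ℝ) + 1) * h) ×ˢ
      (B (rank s k))ᶜ := by simp [hC]
    rw [Fintype.prod_bool, hT, hF, h1, h2, ← arcLength_add_compl hN (hB (rank s k)), mul_add,
      neg_add, Real.exp_add]
    by_cases hks : (k : ℕ) ∈ s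
    · simp [hks]
      ring
    · simp [hks]
  rw [Finset.prod_congr rfl fun k _ => hterm k, Finset.prod_mul_distrib, Finset.prod_const,
    Finset.card_univ, Fintype.card_fin, Fin.prod_univ_eq_prod_range
      (fun k => if k ∈ s then h * arcLength N (B (rank s k)) else 1) K,
    prod_rank (fun i => h * arcLength N (B i))]

end

end

end CHL

end

noncomputable section

namespace CHL

/-! ### The law of the positions -/

/-- Chernoff's bound with the exponential weight `exp (m - k)`, for the lower tail of the Poisson
distribution. -/
theorem sum_poisson_le {ρ : ℝ} (hρ : 0 ≤ ρ) (m : ℕ) :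
    ∑ k ∈ Finset.range m, Real.exp (-ρ) * ρ ^ k / k.factorial ≤
      Real.exp (m - ρ * (1 - Real.exp (-1))) := by
  have hterm : ∀ k ∈ Finset.range m, Real.exp (-ρ) * ρ ^ k / k.factorial ≤
      Real.exp (m - ρ) * ((ρ * Real.exp (-1)) ^ k / k.factorial) := by
    intro k hk
    have h1 : (k : ℝ) ≤ m := by exact_mod_cast (Finset.mem_range.1 hk).le
    have h2 : ρ ^ k = (ρ * Real.exp (-1)) ^ k * Real.exp k := by
      rw [mul_pow, mul_assoc, ← Real.exp_nat_mul, ← Real.exp_add]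
      simp
    have h3 : Real.exp (-ρ) * Real.exp k ≤ Real.exp (m - ρ) := by
      rw [← Real.exp_add]
      exact Real.exp_le_exp.2 (by linarith)
    rw [h2, ← mul_div_assoc]
    refine div_le_div_of_nonneg_right ?_ (by positivity)
    calc Real.exp (-ρ) * ((ρ * Real.exp (-1)) ^ k * Real.exp k)
        = (Real.exp (-ρ) * Real.exp k) * (ρ * Real.exp (-1)) ^ k := by ring
      _ ≤ Real.exp (m - ρ) * (ρ * Real.exp (-1)) ^ k := by gcongr
  refine (Finset.sum_le_sum hterm).trans ?_
  rw [← Finset.mul_sum]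
  calc Real.exp (m - ρ) * ∑ k ∈ Finset.range m, (ρ * Real.exp (-1)) ^ k / k.factorial
      ≤ Real.exp (m - ρ) * Real.exp (ρ * Real.exp (-1)) := by
        gcongr
        exact Real.sum_le_exp_of_nonneg (by positivity) m
    _ = _ := by
        rw [← Real.exp_add]
        congr 1
        ring

/-- Markov's inequality for the upper tail of the Poisson distribution. -/
theorem one_sub_le_sum_poisson {ρ : ℝ} (hρ : 0 ≤ ρ) (m : ℕ) :
    1 - ρ / (m + 1) ≤ ∑ k ∈ Finset.range (m + 1), Real.exp (-ρ) * ρ ^ k / k.factorial := by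
  set f : ℕ → ℝ := fun k => Real.exp (-ρ) * ρ ^ k / k.factorial with hf
  have hsum : HasSum f 1 := ProbabilityTheory.hasSum_one_poissonMeasure ⟨ρ, hρ⟩
  have hf0 : ∀ k, 0 ≤ f k := fun k => by positivity
  have h1 := hsum.summable.sum_add_tsum_nat_add (m + 1)
  have h2 := hsum.summable.sum_add_tsum_nat_add m
  rw [hsum.tsum_eq] at h1 h2
  have hs1 : Summable fun k => f (k + (m + 1)) := (summable_nat_add_iff _).2 hsum.summable
  have hs2 : Summable fun k => f (k + m) := (summable_nat_add_iff _).2 hsum.summable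
  have hstep : ∀ k, f (k + (m + 1)) ≤ ρ / (m + 1) * f (k + m) := by
    intro k
    have : f (k + (m + 1)) = ρ / (k + m + 1) * f (k + m) := by
      simp only [hf]
      rw [← add_assoc, Nat.factorial_succ, pow_succ]
      push_cast
      field_simp
    rw [this]
    have hk : (0 : ℝ) ≤ k := by positivity
    exact mul_le_mul_of_nonneg_right
      (div_le_div_of_nonneg_left hρ (by positivity) (by linarith)) (hf0 _)
  have h3 := hs1.tsum_le_tsum hstep (hs2.mul_left _)
  rw [tsum_mul_left] at h3
  have h4 : ∑' k, f (k + m) ≤ 1 := by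
    have := Finset.sum_nonneg fun k (_ : k ∈ Finset.range m) => hf0 k
    linarith
  have h5 : ρ / (m + 1) * ∑' k, f (k + m) ≤ ρ / (m + 1) :=
    mul_le_of_le_one_right (by positivity) h4
  linarith

section

variable {Ω : Type*} [MeasurableSpace Ω] {μ : Measure Ω} {N : ℝ}
  {t x : ℕ → Ω → ℝ}

theorem real_count_cell [IsProbabilityMeasure μ] (hN : 0 < N) (hp : IsDrivingProcess N t x μ) {a b : ℝ} (ha : 0 ≤ a)
    (hab : a ≤ b) (k : ℕ) :
    μ.real {ω | {n | t n ω ∈ Set.Ioc a b}.encard = k} =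
      Real.exp (-((b - a) * (2 * Real.pi * N))) * ((b - a) * (2 * Real.pi * N)) ^ k /
        k.factorial := by
  obtain ⟨h1, h2⟩ := intensity_cell N ha hab Set.univ
  have h := real_count_law_single hp.poisson (measurableSet_Ioc.prod MeasurableSet.univ) h1 k
  rw [h2, arcLength_univ hN] at h
  simpa using h

theorem measurableSet_count_cell (hp : IsDrivingProcess N t x μ) (a b : ℝ) (k : ℕ) :
    MeasurableSet {ω | {n | t n ω ∈ Set.Ioc a b}.encard = k} :=
  measurableSet_encard_eq hp.measurable_time measurableSet_Ioc k

theorem encard_le_iff {t : ℕ → ℝ} (ht : StrictMono t) (h0 : ∀ n, 0 < t n) (τ : ℝ) (m : ℕ) :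
    τ < t m ↔ ∃ k ∈ Finset.range (m + 1), {n | t n ∈ Set.Ioc 0 τ}.encard = (k : ℕ) := by
  have hset : {n | t n ∈ Set.Ioc 0 τ} = {n | t n ≤ τ} := by
    ext n
    simp [h0 n]
  rw [hset]
  constructor
  · intro h
    have hsub : {n | t n ≤ τ} ⊆ Set.Iio m := by
      intro n hn
      by_contra hnm
      have := ht.monotone (not_lt.1 hnm)
      linarith [show t n ≤ τ from hn]
    have hfin : {n | t n ≤ τ}.Finite := (Set.finite_Iio m).subset hsub
    refine ⟨hfin.toFinset.card, ?_, hfin.encard_eq_coe_toFinset_card⟩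
    have : hfin.toFinset ⊆ Finset.range m := by
      intro n hn
      exact Finset.mem_range.2 (hsub (hfin.mem_toFinset.1 hn))
    have := Finset.card_le_card this
    rw [Finset.card_range] at this
    exact Finset.mem_range.2 (by omega)
  · rintro ⟨k, hk, hcard⟩
    by_contra! h
    have hsub : ((Finset.range (m + 1) : Finset ℕ) : Set ℕ) ⊆ {n | t n ≤ τ} := by
      intro n hn
      have hn' : n ≤ m := Nat.lt_succ_iff.1 (Finset.mem_range.1 (Finset.mem_coe.1 hn))
      exact (ht.monotone hn').trans h
    have := Set.encard_le_encard hsub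
    rw [Set.encard_coe_eq_coe_finsetCard, Finset.card_range, hcard] at this
    have h1 : m + 1 ≤ k := by exact_mod_cast this
    have := Finset.mem_range.1 hk
    omega

theorem real_lt_time [IsProbabilityMeasure μ] (hN : 0 < N) (hp : IsDrivingProcess N t x μ) {τ : ℝ} (hτ : 0 ≤ τ) (m : ℕ) :
    μ.real {ω | τ < t m ω} = ∑ k ∈ Finset.range (m + 1),
      Real.exp (-(τ * (2 * Real.pi * N))) * (τ * (2 * Real.pi * N)) ^ k / k.factorial := by
  have h1 : μ.real {ω | τ < t m ω} = μ.real (⋃ k ∈ Finset.range (m + 1),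
      {ω | {n | t n ω ∈ Set.Ioc 0 τ}.encard = (k : ℕ)}) := by
    apply measureReal_congr
    filter_upwards [hp.ae_mem] with ω hω
    apply propext
    change τ < t m ω ↔ ω ∈ ⋃ k ∈ Finset.range (m + 1),
      {ω | {n | t n ω ∈ Set.Ioc 0 τ}.encard = (k : ℕ)}
    rw [encard_le_iff hω.1 hω.2]
    simp
  rw [h1, measureReal_biUnion_finset]
  · refine Finset.sum_congr rfl fun k _ => ?_
    rw [real_count_cell hN hp le_rfl hτ, sub_zero]
  · intro k _ l _ hkl
    rw [Function.onFun, Set.disjoint_left]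
    intro ω h2 h3
    rw [Set.mem_ofPred_eq] at h2 h3
    rw [h2] at h3
    exact hkl (by exact_mod_cast h3)
  · exact fun k _ => measurableSet_count_cell hp 0 τ k

theorem real_two_le_count_le [IsProbabilityMeasure μ] (hN : 0 < N) (hp : IsDrivingProcess N t x μ) {a b : ℝ} (ha : 0 ≤ a)
    (hab : a ≤ b) :
    μ.real {ω | {n | t n ω ∈ Set.Ioc a b}.encard ≠ 0 ∧ {n | t n ω ∈ Set.Ioc a b}.encard ≠ 1} ≤
      ((b - a) * (2 * Real.pi * N)) ^ 2 := by
  have h0 := real_count_cell hN hp ha hab 0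
  have h1 := real_count_cell hN hp ha hab 1
  have hm0 := measurableSet_count_cell hp a b 0
  have hm1 := measurableSet_count_cell hp a b 1
  have hd : Disjoint {ω | {n | t n ω ∈ Set.Ioc a b}.encard = (0 : ℕ)}
      {ω | {n | t n ω ∈ Set.Ioc a b}.encard = (1 : ℕ)} := by
    rw [Set.disjoint_left]
    intro ω h2 h3
    rw [Set.mem_ofPred_eq] at h2 h3
    rw [h2] at h3
    norm_num at h3
  have hc : {ω | {n | t n ω ∈ Set.Ioc a b}.encard ≠ 0 ∧ {n | t n ω ∈ Set.Ioc a b}.encard ≠ 1} =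
      ({ω | {n | t n ω ∈ Set.Ioc a b}.encard = (0 : ℕ)} ∪
        {ω | {n | t n ω ∈ Set.Ioc a b}.encard = (1 : ℕ)})ᶜ := by
    ext ω
    simp
  rw [hc, probReal_compl_eq_one_sub (hm0.union hm1), measureReal_union hd hm1, h0, h1]
  set ρ := (b - a) * (2 * Real.pi * N) with hρ
  have hρ0 : 0 ≤ ρ := by
    have := Real.pi_pos
    have : 0 ≤ b - a := by linarith
    positivity
  have h2 := Real.add_one_le_exp (-ρ)
  simp
  nlinarith

theorem measurableSet_pattern (hp : IsDrivingProcess N t x μ) (h : ℝ) (K : ℕ) (s : Finset ℕ) :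
    MeasurableSet {ω | Pattern (fun n => t n ω) h K s} := by
  have : {ω | Pattern (fun n => t n ω) h K s} = ⋂ k ∈ {k : ℕ | k < K},
      {ω | {n | t n ω ∈ Set.Ioc (k * h) ((k + 1) * h)}.encard =
        ((if k ∈ s then 1 else 0 : ℕ) : ℕ∞)} := by
    ext ω
    simp [Pattern]
  rw [this]
  exact MeasurableSet.biInter (Set.to_countable _) fun k _ => measurableSet_count_cell hp _ _ _

/-- The event that the points of the first `K` cells are in different cells, and that there are at
least `n` of them. -/
def patternEvent (t : ℕ → Ω → ℝ) (h : ℝ) (K n : ℕ) : Set Ω :=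
  ⋃ s ∈ (Finset.range K).powerset.filter (fun s => n ≤ rank s K),
    {ω | Pattern (fun n => t n ω) h K s}

theorem pattern_unique {t : ℕ → ℝ} {h : ℝ} {K : ℕ} {s r : Finset ℕ} (hs : s ⊆ Finset.range K)
    (hr : r ⊆ Finset.range K) (h1 : Pattern t h K s) (h2 : Pattern t h K r) : s = r := by
  have key : ∀ k < K, k ∈ s ↔ k ∈ r := by
    intro k hk
    have h3 := (h1 k hk).symm.trans (h2 k hk)
    split_ifs at h3 with h4 h5 h5 <;> simp_all
  ext k
  constructor
  · intro hk
    exact (key k (Finset.mem_range.1 (hs hk))).1 hk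
  · intro hk
    exact (key k (Finset.mem_range.1 (hr hk))).2 hk

/-- On the event that the points are in different cells, the positions are independent and uniform,
and independent of the number of points up to the time `J * h`. -/
theorem real_inter_patternEvent [IsProbabilityMeasure μ] (hN : 0 < N) (hp : IsDrivingProcess N t x μ) {h : ℝ} (hh : 0 < h)
    {J K n : ℕ} (hJ : J ≤ K) (m : ℕ) {B : ℕ → Set ℝ} (hB : ∀ i, MeasurableSet (B i))
    (hBn : ∀ i, n ≤ i → B i = Set.univ) :
    μ.real ({ω | (∀ i, x i ω ∈ B i) ∧ J * h < t m ω} ∩ patternEvent t h K n) =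
      (∏ i ∈ Finset.range n, arcLength N (B i) / (2 * Real.pi * N)) *
        μ.real ({ω | J * h < t m ω} ∩ patternEvent t h K n) := by
  have hpi := Real.pi_pos
  set F := (Finset.range K).powerset.filter (fun s => n ≤ rank s K) with hF
  have hmE : ∀ s, MeasurableSet {ω | Pattern (fun n => t n ω) h K s} :=
    fun s => measurableSet_pattern hp h K s
  have hmV : MeasurableSet {ω | (J : ℝ) * h < t m ω} :=
    measurableSet_lt measurable_const (hp.measurable_time m)
  have hmA : MeasurableSet {ω | (∀ i, x i ω ∈ B i) ∧ (J : ℝ) * h < t m ω} := by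
    have : {ω | (∀ i, x i ω ∈ B i) ∧ (J : ℝ) * h < t m ω} =
        (⋂ i, x i ⁻¹' B i) ∩ {ω | (J : ℝ) * h < t m ω} := by
      ext ω
      simp
    rw [this]
    exact (MeasurableSet.iInter fun i => hp.measurable_position i (hB i)).inter hmV
  have hsplit : ∀ A : Set Ω, MeasurableSet A → μ.real (A ∩ patternEvent t h K n) =
      ∑ s ∈ F, μ.real (A ∩ {ω | Pattern (fun n => t n ω) h K s}) := by
    intro A hA
    rw [patternEvent, Set.inter_iUnion₂, measureReal_biUnion_finset]
    · intro s hs r hr hsr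
      rw [Function.onFun, Set.disjoint_left]
      rintro ω ⟨-, h1⟩ ⟨-, h2⟩
      rw [Finset.coe_filter] at hs hr
      exact hsr (pattern_unique (Finset.mem_powerset.1 hs.1) (Finset.mem_powerset.1 hr.1) h1 h2)
    · exact fun s _ => hA.inter (hmE s)
  rw [hsplit _ hmA, hsplit _ hmV, Finset.mul_sum]
  refine Finset.sum_congr rfl fun s hs => ?_
  have hn : n ≤ rank s K := (Finset.mem_filter.1 hs).2
  have key : ∀ C : ℕ → Set ℝ, (∀ i, n ≤ i → C i = Set.univ) →
      μ.real ({ω | (∀ i, x i ω ∈ C i) ∧ (J : ℝ) * h < t m ω} ∩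
        {ω | Pattern (fun n => t n ω) h K s}) = if rank s J ≤ m then
          μ.real {ω | Pattern (fun n => t n ω) h K s ∧ ∀ i < rank s K, x i ω ∈ C i} else 0 := by
    intro C hC
    have hV : ∀ᵐ ω ∂μ, Pattern (fun n => t n ω) h K s → ((J : ℝ) * h < t m ω ↔ rank s J ≤ m) := by
      filter_upwards [hp.ae_mem] with ω hω hpat
      rw [← not_le, hpat.le_iff hω.1 hω.2 hh hJ, not_lt]
    split_ifs with hm
    · apply measureReal_congr
      filter_upwards [hV] with ω hω
      apply propext
      change (((∀ i, x i ω ∈ C i) ∧ (J : ℝ) * h < t m ω) ∧ Pattern (fun n => t n ω) h K s) ↔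
        (Pattern (fun n => t n ω) h K s ∧ ∀ i < rank s K, x i ω ∈ C i)
      constructor
      · rintro ⟨⟨h1, -⟩, h2⟩
        exact ⟨h2, fun i _ => h1 i⟩
      · rintro ⟨h1, h2⟩
        refine ⟨⟨fun i => ?_, (hω h1).2 hm⟩, h1⟩
        rcases lt_or_ge i (rank s K) with hi | hi
        · exact h2 i hi
        · rw [hC i (hn.trans hi)]
          exact Set.mem_univ _
    · rw [measureReal_eq_zero_iff]
      refine measure_mono_null ?_ (ae_iff.1 hV)
      rintro ω ⟨⟨-, h1⟩, h2⟩ h3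
      exact hm ((h3 h2).1 h1)
  have h1 := key B hBn
  have h2 := key (fun _ => Set.univ) fun _ _ => rfl
  have hV : {ω | (∀ i, x i ω ∈ Set.univ) ∧ (J : ℝ) * h < t m ω} = {ω | (J : ℝ) * h < t m ω} := by
    ext ω
    simp
  rw [hV] at h2
  rw [h1, h2]
  split_ifs
  · rw [real_pattern hN hp hh K s hB, real_pattern hN hp hh K s (B := fun _ => Set.univ)
      (fun _ => MeasurableSet.univ)]
    have h3 : ∏ i ∈ Finset.range n, arcLength N (B i) / (2 * Real.pi * N) =
        ∏ i ∈ Finset.range (rank s K), arcLength N (B i) / (2 * Real.pi * N) := by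
      refine Finset.prod_subset (Finset.range_subset_range.2 hn) fun i _ hi => ?_
      rw [hBn i (by simpa using hi), arcLength_univ hN, div_self (by positivity)]
    have h4 : ∏ i ∈ Finset.range (rank s K), h * arcLength N (B i) =
        (∏ i ∈ Finset.range (rank s K), arcLength N (B i) / (2 * Real.pi * N)) *
          ∏ i ∈ Finset.range (rank s K), h * arcLength N Set.univ := by
      rw [← Finset.prod_mul_distrib]
      refine Finset.prod_congr rfl fun i _ => ?_
      rw [arcLength_univ hN]
      field_simp
    rw [h3, h4]
    ring
  · rw [mul_zero]

theorem real_compl_patternEvent_le [IsProbabilityMeasure μ] (hN : 0 < N) (hp : IsDrivingProcess N t x μ) {h : ℝ}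
    (hh : 0 < h) (K n : ℕ) :
    μ.real (patternEvent t h K (n + 1))ᶜ ≤ K * (h * (2 * Real.pi * N)) ^ 2 +
      Real.exp (n + 1 - K * h * (2 * Real.pi * N) * (1 - Real.exp (-1))) := by
  classical
  have hpi := Real.pi_pos
  set D : ℕ → Set Ω := fun k => {ω | {n | t n ω ∈ Set.Ioc (k * h) ((k + 1) * h)}.encard ≠ 0 ∧
    {n | t n ω ∈ Set.Ioc (k * h) ((k + 1) * h)}.encard ≠ 1} with hD
  have hsub : ∀ᵐ ω ∂μ, ω ∈ (patternEvent t h K (n + 1))ᶜ →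
      ω ∈ (⋃ k ∈ Finset.range K, D k) ∪ {ω | K * h < t n ω} := by
    filter_upwards [hp.ae_mem] with ω hω hmem
    by_contra hnot
    rw [Set.mem_union, not_or] at hnot
    obtain ⟨h1, h2⟩ := hnot
    set s := (Finset.range K).filter
      (fun k : ℕ => {n | t n ω ∈ Set.Ioc (k * h) ((k + 1) * h)}.encard = 1) with hs
    have hpat : Pattern (fun n => t n ω) h K s := by
      intro k hk
      split_ifs with hks
      · exact (Finset.mem_filter.1 hks).2
      · by_contra h0
        apply h1
        refine Set.mem_biUnion (Finset.mem_coe.2 (Finset.mem_range.2 hk)) ⟨h0, fun h1 => hks ?_⟩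
        exact Finset.mem_filter.2 ⟨Finset.mem_range.2 hk, h1⟩
    apply hmem
    refine Set.mem_biUnion (Finset.mem_coe.2 (Finset.mem_filter.2
      ⟨Finset.mem_powerset.2 (Finset.filter_subset _ _), ?_⟩)) hpat
    exact (hpat.le_iff hω.1 hω.2 hh le_rfl n).1 (not_lt.1 h2)
  have h1 : μ.real (patternEvent t h K (n + 1))ᶜ ≤
      μ.real ((⋃ k ∈ Finset.range K, D k) ∪ {ω | K * h < t n ω}) :=
    ENNReal.toReal_mono (measure_ne_top _ _) (measure_mono_ae hsub)
  refine h1.trans ((measureReal_union_le _ _).trans (add_le_add ?_ ?_))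
  · refine (measureReal_biUnion_finset_le _ _).trans ?_
    refine (Finset.sum_le_sum fun (k : ℕ) _ => real_two_le_count_le hN hp (a := k * h)
      (b := (k + 1) * h) (by positivity) (by nlinarith)).trans (le_of_eq ?_)
    rw [← Finset.card_range K, ← nsmul_eq_mul, ← Finset.sum_const, Finset.card_range]
    exact Finset.sum_congr rfl fun k _ => by ring
  · rw [real_lt_time hN hp (by positivity)]
    exact_mod_cast sum_poisson_le (ρ := K * h * (2 * Real.pi * N)) (by positivity) (n + 1)

end

end CHL

end

noncomputable section

namespace CHL

section

variable {Ω : Type*} [MeasurableSpace Ω] {μ : Measure Ω} {N : ℝ} {t x : ℕ → Ω → ℝ}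

theorem measurableSet_patternEvent (hp : IsDrivingProcess N t x μ) (h : ℝ) (K n : ℕ) :
    MeasurableSet (patternEvent t h K n) :=
  Finset.measurableSet_biUnion _ fun s _ => measurableSet_pattern hp h K s

/-- The positions are independent and uniform, and independent of the number of points up to a fixed
time: the time axis is divided into cells that are so small that no two points share a cell, up to a
probability that tends to `0`. -/
theorem real_position_mem [IsProbabilityMeasure μ] (hN : 0 < N) (hp : IsDrivingProcess N t x μ)
    {τ : ℝ} (hτ : 0 ≤ τ) (m n : ℕ) {B : ℕ → Set ℝ} (hB : ∀ i, MeasurableSet (B i))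
    (hBn : ∀ i, n < i → B i = Set.univ) :
    μ.real {ω | (∀ i, x i ω ∈ B i) ∧ τ < t m ω} =
      (∏ i ∈ Finset.range (n + 1), arcLength N (B i) / (2 * Real.pi * N)) *
        μ.real {ω | τ < t m ω} := by
  have hpi := Real.pi_pos
  set L := 2 * Real.pi * N with hL
  have hL0 : 0 < L := by positivity
  set q := ∏ i ∈ Finset.range (n + 1), arcLength N (B i) / L with hq
  have hq0 : 0 ≤ q := Finset.prod_nonneg fun i _ => div_nonneg (arcLength_nonneg _ _) hL0.le
  have hq1 : q ≤ 1 := by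
    refine Finset.prod_le_one (fun i _ => div_nonneg (arcLength_nonneg _ _) hL0.le) fun i _ => ?_
    rw [div_le_one hL0, hL, ← arcLength_univ hN]
    exact measureReal_mono (Set.subset_univ _)
  obtain ⟨a, b, ha, hab⟩ : ∃ (a : ℝ) (b : ℕ), 0 < a ∧ τ = b * a := by
    rcases hτ.eq_or_lt with rfl | h
    · exact ⟨1, 0, one_pos, by simp⟩
    · exact ⟨τ, 1, h, by simp⟩
  have hbound : ∀ j : ℕ, b ≤ j + 1 → |μ.real {ω | (∀ i, x i ω ∈ B i) ∧ τ < t m ω} -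
      q * μ.real {ω | τ < t m ω}| ≤ 2 * ((a * L) ^ 2 * (1 / ((j : ℝ) + 1)) +
        Real.exp (n + 1 + -(a * L * (1 - Real.exp (-1))) * ((j : ℝ) + 1))) := by
    intro j hj
    have hj0 : (0 : ℝ) < (j : ℝ) + 1 := by positivity
    set h := a / ((j : ℝ) + 1) ^ 2 with hh
    have hh0 : 0 < h := by positivity
    have hJ : b * (j + 1) ^ 2 ≤ (j + 1) ^ 3 := by
      rw [pow_succ' _ 2]
      exact Nat.mul_le_mul_right _ hj
    have hJh : ((b * (j + 1) ^ 2 : ℕ) : ℝ) * h = τ := by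
      rw [hab, hh]
      push_cast
      field_simp
    have h1 := real_inter_patternEvent hN hp hh0 hJ m (n := n + 1) hB fun i hi => hBn i hi
    have h2 := real_compl_patternEvent_le hN hp hh0 ((j + 1) ^ 3) n
    rw [hJh, ← hL, ← hq] at h1
    set U := patternEvent t h ((j + 1) ^ 3) (n + 1) with hU
    have hUm : MeasurableSet U := measurableSet_patternEvent hp h _ _
    have e1 : (((j + 1) ^ 3 : ℕ) : ℝ) * (h * (2 * Real.pi * N)) ^ 2 =
        (a * L) ^ 2 * (1 / ((j : ℝ) + 1)) := by
      rw [hh, ← hL]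
      push_cast
      field_simp
    have e2 : ((n : ℝ) + 1 - (((j + 1) ^ 3 : ℕ) : ℝ) * h * (2 * Real.pi * N) *
        (1 - Real.exp (-1))) =
        n + 1 + -(a * L * (1 - Real.exp (-1))) * ((j : ℝ) + 1) := by
      rw [hh, ← hL]
      push_cast
      field_simp
      ring
    rw [e1, e2] at h2
    have hsplit : ∀ A : Set Ω, μ.real A = μ.real (A ∩ U) + μ.real (A ∩ Uᶜ) := fun A => by
      rw [← Set.sdiff_eq, measureReal_inter_add_sdiff hUm]
    have hle : ∀ A : Set Ω, μ.real (A ∩ Uᶜ) ≤ μ.real Uᶜ :=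
      fun A => measureReal_mono Set.inter_subset_right
    have hA := hsplit {ω | (∀ i, x i ω ∈ B i) ∧ τ < t m ω}
    have hV := hsplit {ω | τ < t m ω}
    have hA' := hle {ω | (∀ i, x i ω ∈ B i) ∧ τ < t m ω}
    have hV' := hle {ω | τ < t m ω}
    have hA0 : 0 ≤ μ.real ({ω | (∀ i, x i ω ∈ B i) ∧ τ < t m ω} ∩ Uᶜ) := measureReal_nonneg
    have hV0 : 0 ≤ μ.real ({ω | τ < t m ω} ∩ Uᶜ) := measureReal_nonneg
    rw [hA, hV, h1, mul_add, add_sub_add_left_eq_sub]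
    refine le_trans ?_ (mul_le_mul_of_nonneg_left h2 zero_le_two)
    rw [abs_le]
    constructor <;> nlinarith
  have hlim : Filter.Tendsto (fun j : ℕ => 2 * ((a * L) ^ 2 * (1 / ((j : ℝ) + 1)) +
      Real.exp (n + 1 + -(a * L * (1 - Real.exp (-1))) * ((j : ℝ) + 1)))) Filter.atTop
      (nhds (2 * ((a * L) ^ 2 * 0 + 0))) := by
    refine Filter.Tendsto.const_mul _ (Filter.Tendsto.add ?_ ?_)
    · exact tendsto_one_div_add_atTop_nhds_zero_nat.const_mul _
    · refine Real.tendsto_exp_atBot.comp (Filter.tendsto_atBot_add_const_left _ _ ?_)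
      have hc : -(a * L * (1 - Real.exp (-1))) < 0 := by
        have : Real.exp (-1) < 1 := Real.exp_lt_one_iff.2 (by norm_num)
        have : 0 < a * L * (1 - Real.exp (-1)) := mul_pos (by positivity) (by linarith)
        linarith
      exact (Filter.tendsto_atTop_add_const_right _ _
        tendsto_natCast_atTop_atTop).const_mul_atTop_of_neg hc
  have h0 := ge_of_tendsto hlim (by
    filter_upwards [Filter.eventually_ge_atTop b] with j hj
    exact hbound j (by omega))
  simp only [mul_zero, add_zero] at h0
  linarith [abs_nonpos_iff.1 h0]

/-- The coordinates of the positions in `ℝ / πℤ`. -/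
def coords (N : ℝ) (x : ℕ → Ω → ℝ) (ω : Ω) : ℕ → ℝ := coord N fun n => x n ω

theorem measurable_coords (hp : IsDrivingProcess N t x μ) : Measurable (coords N x) :=
  measurable_pi_lambda _ fun n => (hp.measurable_position n).div_const _

theorem arcLength_preimage (hN : 0 < N) {B : Set ℝ} (hB : MeasurableSet B) :
    arcLength N ((fun u => u / (2 * N)) ⁻¹' B) / (2 * Real.pi * N) = unif.real B := by
  have hpi := Real.pi_pos
  have hset : (fun u : ℝ => u / (2 * N)) ⁻¹' B ∩ Set.Ioc 0 (2 * Real.pi * N) =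
      (fun u : ℝ => u * (2 * N)⁻¹) ⁻¹' (B ∩ Set.Ioc 0 Real.pi) := by
    ext u
    simp only [Set.mem_inter_iff, Set.mem_preimage, Set.mem_Ioc, ← div_eq_mul_inv]
    rw [lt_div_iff₀ (by positivity), div_le_iff₀ (by positivity), zero_mul,
      show Real.pi * (2 * N) = 2 * Real.pi * N by ring]
  have hm : MeasurableSet ((fun u : ℝ => u / (2 * N)) ⁻¹' B) :=
    (measurable_id.div_const (2 * N)) hB
  rw [arcLength, measureReal_restrict_apply hm, hset, measureReal_def,
    Real.volume_preimage_mul_right (by positivity), ENNReal.toReal_mul, inv_inv,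
    ENNReal.toReal_ofReal (abs_nonneg _), abs_of_pos (by positivity), unif,
    measureReal_ennreal_smul_apply, measureReal_restrict_apply hB, ENNReal.toReal_inv,
    ENNReal.toReal_ofReal hpi.le, measureReal_def]
  field_simp

/-- The sequence of all positions is distributed as independent uniform points, and is independent of
the event that fewer than `m + 1` particles arrive up to the time `τ`. -/
theorem real_coords_mem [IsProbabilityMeasure μ] (hN : 0 < N) (hp : IsDrivingProcess N t x μ)
    {τ : ℝ} (hτ : 0 ≤ τ) (m : ℕ) {S : Set (ℕ → ℝ)} (hS : MeasurableSet S) :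
    μ.real ({ω | τ < t m ω} ∩ coords N x ⁻¹' S) = μ.real {ω | τ < t m ω} * seqMeasure.real S := by
  set V := {ω | τ < t m ω} with hV
  have hVm : MeasurableSet V := measurableSet_lt measurable_const (hp.measurable_time m)
  by_cases hV0 : μ V = 0
  · rw [measureReal_def, measure_mono_null Set.inter_subset_left hV0, measureReal_def, hV0]
    simp
  have hcond : IsProbabilityMeasure (ProbabilityTheory.cond μ V) :=
    ProbabilityTheory.cond_isProbabilityMeasure hV0
  have hXm := measurable_coords hp
  have hlaw : (ProbabilityTheory.cond μ V).map (coords N x) = seqMeasure := by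
    rw [seqMeasure]
    refine Measure.eq_infinitePi _ fun s B hB => ?_
    set C : ℕ → Set ℝ := fun i => if i ∈ s then (fun u => u / (2 * N)) ⁻¹' B i else Set.univ with hC
    have hCm : ∀ i, MeasurableSet (C i) := by
      intro i
      simp only [hC]
      split_ifs with hi
      · exact (measurable_id.div_const (2 * N)) (hB i)
      · exact MeasurableSet.univ
    have hset : V ∩ coords N x ⁻¹' Set.pi s B = {ω | (∀ i, x i ω ∈ C i) ∧ τ < t m ω} := by
      ext ω
      rw [Set.mem_inter_iff, and_comm]
      refine and_congr_left fun _ => ?_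
      constructor
      · intro h i
        simp only [hC]
        split_ifs with hi
        · exact h i hi
        · exact Set.mem_univ _
      · intro h i hi
        have := h i
        simp only [hC] at this
        rwa [if_pos (Finset.mem_coe.1 hi)] at this
    have hpos := real_position_mem hN hp hτ m (s.sup id) hCm (fun i hi => by
      simp only [hC]
      rw [if_neg]
      intro his
      exact absurd (Finset.le_sup (f := id) his) (not_le.2 hi))
    have hprod : ∏ i ∈ Finset.range (s.sup id + 1), arcLength N (C i) / (2 * Real.pi * N) =
        ∏ i ∈ s, unif.real (B i) := by
      have hpi := Real.pi_pos
      have hsub : s ⊆ Finset.range (s.sup id + 1) := fun i hi =>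
        Finset.mem_range.2 (Nat.lt_succ_of_le (Finset.le_sup (f := id) hi))
      rw [← Finset.prod_subset hsub]
      · refine Finset.prod_congr rfl fun i hi => ?_
        simp only [hC]
        rw [if_pos hi, arcLength_preimage hN (hB i)]
      · intro i _ hi
        simp only [hC]
        rw [if_neg hi, arcLength_univ hN, div_self (by positivity)]
    have hSm : MeasurableSet (Set.pi (s : Set ℕ) B) :=
      MeasurableSet.pi (Set.to_countable _) fun i _ => hB i
    rw [Measure.map_apply hXm hSm, ProbabilityTheory.cond_apply hVm, hset]
    rw [hprod] at hpos
    have h1 : μ {ω | (∀ i, x i ω ∈ C i) ∧ τ < t m ω} = (∏ i ∈ s, unif (B i)) * μ V := by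
      rw [← ENNReal.toReal_eq_toReal_iff' (measure_ne_top _ _), ENNReal.toReal_mul,
        ENNReal.toReal_prod]
      · exact hpos
      · exact ENNReal.mul_ne_top (ENNReal.prod_ne_top fun i _ => measure_ne_top _ _)
          (measure_ne_top _ _)
    rw [h1, mul_comm, mul_assoc, ENNReal.mul_inv_cancel hV0 (measure_ne_top _ _), mul_one]
  have h2 : seqMeasure.real S = (ProbabilityTheory.cond μ V).real (coords N x ⁻¹' S) := by
    rw [← hlaw, map_measureReal_apply hXm hS]
  rw [h2, measureReal_def (ProbabilityTheory.cond μ V), ProbabilityTheory.cond_apply hVm,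
    ENNReal.toReal_mul, ENNReal.toReal_inv, ← measureReal_def, ← measureReal_def]
  have hV1 : μ.real V ≠ 0 := by
    rw [measureReal_def]
    exact ENNReal.toReal_ne_zero.2 ⟨hV0, measure_ne_top _ _⟩
  field_simp

theorem map_coords [IsProbabilityMeasure μ] (hN : 0 < N) (hp : IsDrivingProcess N t x μ) :
    μ.map (coords N x) = seqMeasure := by
  have hXm := measurable_coords hp
  have : IsProbabilityMeasure (μ.map (coords N x)) := Measure.isProbabilityMeasure_map hXm.aemeasurable
  have : IsProbabilityMeasure seqMeasure := by rw [seqMeasure]; infer_instance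
  have hV : μ {ω | 0 < t 0 ω}ᶜ = 0 := by
    have : ∀ᵐ ω ∂μ, 0 < t 0 ω := by
      filter_upwards [hp.ae_mem] with ω hω
      exact hω.2 0
    exact ae_iff.1 this
  have hV1 : ∀ A : Set Ω, μ.real ({ω | 0 < t 0 ω} ∩ A) = μ.real A := by
    intro A
    apply measureReal_congr
    filter_upwards [hp.ae_mem] with ω hω
    apply propext
    exact ⟨fun h => h.2, fun h => ⟨hω.2 0, h⟩⟩
  ext S hS
  have h := real_coords_mem hN hp le_rfl 0 hS
  rw [hV1, ← Set.inter_univ {ω | 0 < t 0 ω}, hV1, probReal_univ, one_mul] at h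
  rw [Measure.map_apply hXm hS, ← ENNReal.toReal_eq_toReal_iff' (measure_ne_top _ _)
    (measure_ne_top _ _)]
  exact h

end

end CHL

end

noncomputable section

namespace CHL

/-! ### The domination time -/

/-- The half opening angle `β` of the arc that a slit map sends to the slit is comparable to
`lam / N`. -/
theorem exists_angle {N lam Λ : ℝ} (hN : 0 < N) (hlam : 0 < lam) (hle : lam ≤ Λ * N) :
    ∃ β ∈ Set.Ioo 0 (Real.pi / 2), Real.sin β = delta N lam ∧
      lam / N * (1 + Real.exp Λ)⁻¹ ≤ β ∧ β ≤ Real.pi / 2 * (lam / N) ∧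
      2 * (1 + Real.exp Λ)⁻¹ ≤ Real.cos β := by
  have hpi := Real.pi_pos
  have hδ := delta_mem hN hlam
  have he : 0 < lam / N := by positivity
  have heΛ : lam / N ≤ Λ := by rwa [div_le_iff₀ hN]
  have hE1 := Real.add_one_le_exp (lam / N)
  have hE2 := Real.add_one_le_exp (-(lam / N))
  have hE3 : Real.exp (lam / N) ≤ Real.exp Λ := Real.exp_le_exp.2 heΛ
  have hEE : Real.exp (lam / N) * Real.exp (-(lam / N)) = 1 := by
    rw [← Real.exp_add, add_neg_cancel, Real.exp_zero]
  have hE0 := Real.exp_pos (lam / N)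
  set E := Real.exp (lam / N) with hE
  have hδE : delta N lam = (E - 1) / (1 + E) := by
    rw [delta, ← hE]
    field_simp
    ring
  have hβ1 : Real.sin (Real.arcsin (delta N lam)) = delta N lam :=
    Real.sin_arcsin (by linarith [hδ.1]) hδ.2.le
  set β := Real.arcsin (delta N lam) with hβ
  have hmem : β ∈ Set.Ioo 0 (Real.pi / 2) :=
    ⟨Real.arcsin_pos.2 hδ.1, Real.arcsin_lt_pi_div_two.2 hδ.2⟩
  refine ⟨β, hmem, hβ1, ?_, ?_, ?_⟩
  · have h1 := (Real.sin_lt hmem.1).le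
    rw [hβ1, hδE] at h1
    refine le_trans ?_ h1
    rw [← div_eq_mul_inv, div_le_div_iff₀ (by positivity) (by positivity)]
    have h2 : (lam / N) * (1 + E) ≤ (E - 1) * (1 + E) := by gcongr; linarith
    have h3 : (E - 1) * (1 + E) ≤ (E - 1) * (1 + Real.exp Λ) := by
      apply mul_le_mul_of_nonneg_left <;> linarith
    linarith
  · have h1 := Real.mul_le_sin hmem.1.le hmem.2.le
    rw [hβ1, hδE] at h1
    have h2 : (E - 1) / (1 + E) ≤ lam / N := by
      rw [div_le_iff₀ (by positivity)]
      nlinarith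
    have h3 : β = Real.pi / 2 * (2 / Real.pi * β) := by field_simp
    rw [h3]
    exact mul_le_mul_of_nonneg_left (h1.trans h2) (by positivity)
  · have hc := cos_pos_of_mem hmem
    have h1 : Real.cos β ^ 2 = 1 - delta N lam ^ 2 := by rw [Real.cos_sq', hβ1]
    have h2 : 1 - delta N lam = 2 * (1 + E)⁻¹ := by
      rw [hδE]
      field_simp
      ring
    have h3 : (1 + Real.exp Λ)⁻¹ ≤ (1 + E)⁻¹ := by gcongr
    nlinarith [hδ.1, hδ.2, cos_lt_one_of_mem hmem]

/-- The events that the feet do not agree from the particle `2n` on decrease, and their probabilities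
tend to `0`. -/
theorem ae_exists_foot_eq {β : ℝ} (hβ : β ∈ Set.Ioo 0 (Real.pi / 2)) :
    ∀ᵐ x ∂seqMeasure, ∃ m, ∀ k l, m ≤ k → m ≤ l → foot β x k = foot β x l := by
  have hpi := Real.pi_pos
  have hβ0 := hβ.1
  rw [ae_iff]
  have hlim : Filter.Tendsto (fun n : ℕ => ENNReal.ofReal
      (8 * Real.pi ^ 3 / β ^ 3 * (1 / ((n : ℝ) + 1)))) Filter.atTop (nhds 0) := by
    rw [← ENNReal.ofReal_zero]
    apply ENNReal.tendsto_ofReal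
    have := tendsto_one_div_add_atTop_nhds_zero_nat.const_mul (8 * Real.pi ^ 3 / β ^ 3)
    rwa [mul_zero] at this
  refine le_antisymm (ge_of_tendsto' hlim fun n => ?_) bot_le
  refine le_trans (measure_mono ?_) ((seqMeasure_exists_foot_ne_le hβ n.succ_pos).trans
    (ENNReal.ofReal_le_ofReal ?_))
  · intro x hx
    have hx' : ¬ ∃ m, ∀ k l, m ≤ k → m ≤ l → foot β x k = foot β x l := hx
    push Not at hx'
    exact hx' _
  · have h1 : Real.exp (-(β ^ 3 / (2 * Real.pi ^ 3)) * (n + 1 : ℕ)) ≤ 1 := by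
      rw [Real.exp_le_one_iff, neg_mul, neg_nonpos]
      positivity
    refine (mul_le_of_le_one_right (by positivity) h1).trans (le_of_eq ?_)
    push_cast
    field_simp

theorem inInfiniteTree_iff {N lam β : ℝ} (hN : 0 < N) (hlam : 0 < lam)
    (hβ : β ∈ Set.Ioo 0 (Real.pi / 2)) (hδ : Real.sin β = delta N lam) (x : ℕ → ℝ)
    (hreg : ∀ n, Regular β (coord N x) n (coord N x n)) {m : ℕ}
    (hm : ∀ k l, m ≤ k → m ≤ l → foot β (coord N x) k = foot β (coord N x) l) (i : ℕ) :
    InInfiniteTree N lam x i ↔ foot β (coord N x) i = foot β (coord N x) m := by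
  simp only [InInfiniteTree, sameTree_iff hN hlam hβ hδ x hreg]
  constructor
  · intro h
    obtain ⟨j, hj, hmj⟩ := h.exists_gt m
    exact Eq.trans hj (hm j m hmj.le le_rfl)
  · intro h
    refine (Set.Ici_infinite m).mono fun j hj => ?_
    exact h.trans (hm m j le_rfl hj)

section

variable {Ω : Type*} [MeasurableSpace Ω] {μ : Measure Ω} {N lam β : ℝ} {t x : ℕ → Ω → ℝ}

theorem ae_regular_coord [IsProbabilityMeasure μ] (hN : 0 < N) (hp : IsDrivingProcess N t x μ)
    (hβ : β ∈ Set.Ioo 0 (Real.pi / 2)) :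
    ∀ᵐ ω ∂μ, ∀ n, Regular β (coords N x ω) n (coords N x ω n) := by
  have h := ae_regular hβ
  rw [← map_coords hN hp] at h
  exact ae_of_ae_map (measurable_coords hp).aemeasurable h

theorem ae_exists_foot_coord_eq [IsProbabilityMeasure μ] (hN : 0 < N)
    (hp : IsDrivingProcess N t x μ) (hβ : β ∈ Set.Ioo 0 (Real.pi / 2)) :
    ∀ᵐ ω ∂μ, ∃ m, ∀ k l, m ≤ k → m ≤ l → foot β (coords N x ω) k = foot β (coords N x ω) l := by
  have h := ae_exists_foot_eq hβ
  rw [← map_coords hN hp] at h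
  exact ae_of_ae_map (measurable_coords hp).aemeasurable h

theorem ae_uniqueInfiniteTree [IsProbabilityMeasure μ] (hN : 0 < N) (hlam : 0 < lam)
    (hp : IsDrivingProcess N t x μ) (hβ : β ∈ Set.Ioo 0 (Real.pi / 2))
    (hδ : Real.sin β = delta N lam) :
    ∀ᵐ ω ∂μ, UniqueInfiniteTree N lam fun n => x n ω := by
  filter_upwards [ae_regular_coord hN hp hβ, ae_exists_foot_coord_eq hN hp hβ] with ω hreg hm
  obtain ⟨m, hm⟩ := hm
  have hiff := inInfiniteTree_iff hN hlam hβ hδ (fun n => x n ω) hreg hm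
  refine ⟨⟨m, (hiff m).2 rfl⟩, fun i j hi hj => ?_⟩
  rw [sameTree_iff hN hlam hβ hδ (fun n => x n ω) hreg]
  exact ((hiff i).1 hi).trans ((hiff j).1 hj).symm

/-- The domination time exceeds `τ` only if two different trees grow after the first `2 * n`
particles or fewer than `2 * n` particles arrive up to the time `τ`. -/
theorem real_lt_dominationTime_le [IsProbabilityMeasure μ] (hN : 0 < N) (hlam : 0 < lam)
    (hp : IsDrivingProcess N t x μ) (hβ : β ∈ Set.Ioo 0 (Real.pi / 2))
    (hδ : Real.sin β = delta N lam) {τ : ℝ} (hτ : 0 ≤ τ) {n : ℕ} (hn : 0 < n) :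
    μ.real {ω | ENNReal.ofReal τ < dominationTime N lam (fun n => t n ω) fun n => x n ω} ≤
      8 * Real.pi ^ 3 / (β ^ 3 * n) * Real.exp (-(β ^ 3 / (2 * Real.pi ^ 3)) * n) +
        Real.exp (2 * n - τ * (2 * Real.pi * N) * (1 - Real.exp (-1))) := by
  have hpi := Real.pi_pos
  have hβ0 := hβ.1
  set S := {x | ∃ k l, 2 * n ≤ k ∧ 2 * n ≤ l ∧ foot β x k ≠ foot β x l} with hS
  have hsub : ∀ᵐ ω ∂μ,
      ω ∈ {ω | ENNReal.ofReal τ < dominationTime N lam (fun n => t n ω) fun n => x n ω} →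
      ω ∈ coords N x ⁻¹' S ∪ {ω | τ < t (2 * n - 1) ω} := by
    filter_upwards [ae_regular_coord hN hp hβ, hp.ae_mem] with ω hreg hω hdom
    by_contra hnot
    rw [Set.mem_union, not_or] at hnot
    obtain ⟨h1, h2⟩ := hnot
    have hm : ∀ k l, 2 * n ≤ k → 2 * n ≤ l → foot β (coords N x ω) k = foot β (coords N x ω) l := by
      intro k l hk hl
      by_contra h
      exact h1 ⟨k, l, hk, hl, h⟩
    have hdom' : ENNReal.ofReal τ < dominationTime N lam (fun n => t n ω) fun n => x n ω := hdom
    rw [dominationTime, lt_iSup_iff] at hdom'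
    obtain ⟨i, hi⟩ := hdom'
    obtain ⟨hfin, hi⟩ := lt_iSup_iff.1 hi
    have hti : τ < t i ω := (ENNReal.ofReal_lt_ofReal_iff (hω.2 i)).1 hi
    apply hfin
    rw [inInfiniteTree_iff hN hlam hβ hδ (fun n => x n ω) hreg hm]
    refine hm i (2 * n) ?_ le_rfl
    by_contra! hlt
    have := hω.1.monotone (show i ≤ 2 * n - 1 by omega)
    exact h2 (hti.trans_le this)
  have h1 : μ.real {ω | ENNReal.ofReal τ < dominationTime N lam (fun n => t n ω) fun n => x n ω} ≤
      μ.real (coords N x ⁻¹' S ∪ {ω | τ < t (2 * n - 1) ω}) :=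
    ENNReal.toReal_mono (measure_ne_top _ _) (measure_mono_ae hsub)
  refine h1.trans ((measureReal_union_le _ _).trans (add_le_add ?_ ?_))
  · have h2 : μ (coords N x ⁻¹' S) ≤ _ :=
      (Measure.le_map_apply (measurable_coords hp).aemeasurable S).trans
        ((map_coords hN hp).symm ▸ seqMeasure_exists_foot_ne_le hβ hn)
    exact ENNReal.toReal_le_of_le_ofReal (by positivity) h2
  · rw [real_lt_time hN hp hτ, show 2 * n - 1 + 1 = 2 * n by omega]
    exact_mod_cast sum_poisson_le (ρ := τ * (2 * Real.pi * N)) (by positivity) (2 * n)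

/-- If the particles `m` and `m + 1` arrive after the time `τ` at different trees, then the
domination time exceeds `τ`. -/
theorem le_real_lt_dominationTime [IsProbabilityMeasure μ] (hN : 0 < N) (hlam : 0 < lam)
    (hp : IsDrivingProcess N t x μ) (hβ : β ∈ Set.Ioo 0 (Real.pi / 2))
    (hδ : Real.sin β = delta N lam) {τ : ℝ} (hτ : 0 ≤ τ) (m : ℕ) :
    μ.real {ω | τ < t m ω} * seqMeasure.real (switch β 0 (Real.pi / 2) m) ≤
      μ.real {ω | ENNReal.ofReal τ < dominationTime N lam (fun n => t n ω) fun n => x n ω} := by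
  rw [← real_coords_mem hN hp hτ m (measurableSet_switch hβ _ _ m)]
  refine ENNReal.toReal_mono (measure_ne_top _ _) (measure_mono_ae ?_)
  filter_upwards [ae_regular_coord hN hp hβ, hp.ae_mem,
    ae_uniqueInfiniteTree hN hlam hp hβ hδ] with ω hreg hω huniq hmem
  have ht : τ < t m ω := hmem.1
  have hne : foot β (coords N x ω) m ≠ foot β (coords N x ω) (m + 1) :=
    foot_ne_of_mem_switch hβ hmem.2
  obtain ⟨i, hmi, hi⟩ : ∃ i, m ≤ i ∧ ¬ InInfiniteTree N lam (fun n => x n ω) i := by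
    by_contra! h
    exact hne ((sameTree_iff hN hlam hβ hδ (fun n => x n ω) hreg _ _).1
      (huniq.2 m (m + 1) (h m le_rfl) (h (m + 1) (by omega))))
  change ENNReal.ofReal τ < dominationTime N lam (fun n => t n ω) fun n => x n ω
  rw [dominationTime, lt_iSup_iff]
  refine ⟨i, lt_iSup_iff.2 ⟨hi, (ENNReal.ofReal_lt_ofReal_iff (hω.2 i)).2 ?_⟩⟩
  exact ht.trans_le (hω.1.monotone hmi)

end

end CHL

end

theorem theorem1p2 (Λ : ℝ) (hΛ : 0 < Λ) :
    ∃ C₁ C₂ C₃ C₄ : ℝ, 0 < C₁ ∧ 0 < C₂ ∧ 0 < C₃ ∧ 0 < C₄ ∧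
      ∀ (N lam : ℝ), 0 < N → 0 < lam → lam ≤ Λ * N →
      ∀ (Ω : Type*) [MeasurableSpace Ω] (μ : MeasureTheory.Measure Ω)
        [MeasureTheory.IsProbabilityMeasure μ] (t x : ℕ → Ω → ℝ),
        CHL.IsDrivingProcess N t x μ →
        (∀ᵐ ω ∂μ, CHL.UniqueInfiniteTree N lam (fun n => x n ω)) ∧
        ∀ s : ℝ, 0 < s →
          C₃ * Real.exp (-C₄ * s) ≤
              μ.real {ω | ENNReal.ofReal (lam ^ (-3 : ℤ) * N ^ 2 * s) <
                CHL.dominationTime N lam (fun n => t n ω) (fun n => x n ω)} ∧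
            μ.real {ω | ENNReal.ofReal (lam ^ (-3 : ℤ) * N ^ 2 * s) <
                CHL.dominationTime N lam (fun n => t n ω) (fun n => x n ω)} ≤
              C₁ * Real.exp (-C₂ * s) := by
  have hpi := Real.pi_pos
  set κ := (1 + Real.exp Λ)⁻¹ with hκ
  have hκ0 : 0 < κ := by positivity
  obtain ⟨c, C, hc, hC, hswitch⟩ := CHL.exists_le_real_switch (c₀ := 2 * κ) (by positivity)
  set C₂ := min (κ ^ 3 / (8 * Real.pi ^ 3)) (1 / Λ ^ 3) with hC₂
  have hC₂0 : 0 < C₂ := by positivity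
  refine ⟨32 * Real.pi ^ 3 / κ ^ 3 + Real.exp 2 + Real.exp C₂, C₂,
    c * Real.exp (-C * ((Real.pi / 2) ^ 3 * Λ ^ 3)) / 2, C * ((Real.pi / 2) ^ 3 * (4 * Real.pi)),
    by positivity, hC₂0, by positivity, by positivity, ?_⟩
  intro N lam hN hlam hle Ω _ μ _ t x hp
  obtain ⟨β, hβ, hδ, hβ1, hβ2, hβ3⟩ := CHL.exists_angle hN hlam hle
  rw [← hκ] at hβ1 hβ3
  refine ⟨CHL.ae_uniqueInfiniteTree hN hlam hp hβ hδ, fun s hs => ?_⟩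
  set τ := lam ^ (-3 : ℤ) * N ^ 2 * s with hτ
  have hτ0 : 0 ≤ τ := by positivity
  set e := lam / N with he
  have he0 : 0 < e := by positivity
  have heΛ : e ≤ Λ := by rwa [he, div_le_iff₀ hN]
  -- the mean number of particles that arrive up to the time `τ`
  have hρ : τ * (2 * Real.pi * N) = 2 * Real.pi * (s / e ^ 3) := by
    rw [hτ, he, zpow_neg]
    norm_cast
    field_simp
  have he3 : e ^ 3 ≤ Λ ^ 3 := by gcongr
  have hse : s / Λ ^ 3 ≤ s / e ^ 3 := by gcongr
  constructor
  · set m := ⌈2 * (2 * Real.pi * (s / e ^ 3))⌉₊ with hm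
    have hm1 : 2 * (2 * Real.pi * (s / e ^ 3)) ≤ m := Nat.le_ceil _
    have hm2 : (m : ℝ) ≤ 2 * (2 * Real.pi * (s / e ^ 3)) + 1 :=
      (Nat.ceil_lt_add_one (by positivity)).le
    refine le_trans ?_ (CHL.le_real_lt_dominationTime hN hlam hp hβ hδ hτ0 m)
    have h1 : 1 / 2 ≤ μ.real {ω | τ < t m ω} := by
      rw [CHL.real_lt_time hN hp hτ0, hρ]
      refine le_trans ?_ (CHL.one_sub_le_sum_poisson (by positivity) m)
      have : 2 * Real.pi * (s / e ^ 3) / (m + 1) ≤ 1 / 2 := by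
        rw [div_le_iff₀ (by positivity)]
        linarith
      linarith
    have h2 := hswitch β hβ hβ3 m
    have h3 : β ^ 3 * m ≤ (Real.pi / 2) ^ 3 * Λ ^ 3 + (Real.pi / 2) ^ 3 * (4 * Real.pi) * s := by
      have h4 : β ^ 3 ≤ (Real.pi / 2 * e) ^ 3 := pow_le_pow_left₀ hβ.1.le hβ2 3
      calc β ^ 3 * m ≤ (Real.pi / 2 * e) ^ 3 * (2 * (2 * Real.pi * (s / e ^ 3)) + 1) := by gcongr
        _ = (Real.pi / 2) ^ 3 * e ^ 3 + (Real.pi / 2) ^ 3 * (4 * Real.pi) * s := by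
          field_simp
          ring
        _ ≤ _ := by gcongr
    have h4 : c * Real.exp (-C * ((Real.pi / 2) ^ 3 * Λ ^ 3)) *
        Real.exp (-(C * ((Real.pi / 2) ^ 3 * (4 * Real.pi))) * s) ≤
        c * Real.exp (-C * β ^ 3 * m) := by
      rw [mul_assoc, ← Real.exp_add]
      gcongr
      nlinarith
    calc c * Real.exp (-C * ((Real.pi / 2) ^ 3 * Λ ^ 3)) / 2 *
        Real.exp (-(C * ((Real.pi / 2) ^ 3 * (4 * Real.pi))) * s)
        = 1 / 2 * (c * Real.exp (-C * ((Real.pi / 2) ^ 3 * Λ ^ 3)) *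
          Real.exp (-(C * ((Real.pi / 2) ^ 3 * (4 * Real.pi))) * s)) := by ring
      _ ≤ _ := by
        apply mul_le_mul h1 (h4.trans h2) (by positivity) MeasureTheory.measureReal_nonneg
  · rcases lt_or_ge s 1 with hs1 | hs1
    · -- the bound is at least `1`
      refine MeasureTheory.measureReal_le_one.trans ?_
      have h1 : 1 ≤ Real.exp C₂ * Real.exp (-C₂ * s) := by
        rw [← Real.exp_add, Real.one_le_exp_iff]
        nlinarith
      have h2 : 0 ≤ (32 * Real.pi ^ 3 / κ ^ 3 + Real.exp 2) * Real.exp (-C₂ * s) := by positivity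
      linarith
    · set n := ⌈s / e ^ 3 / 4⌉₊ with hn
      have hn0 : 0 < n := Nat.ceil_pos.2 (by positivity)
      have hn1 : s / e ^ 3 / 4 ≤ n := Nat.le_ceil _
      have hn2 : (n : ℝ) ≤ s / e ^ 3 / 4 + 1 := (Nat.ceil_lt_add_one (by positivity)).le
      refine (CHL.real_lt_dominationTime_le hN hlam hp hβ hδ hτ0 hn0).trans ?_
      have hβ0 := hβ.1
      have hβn : κ ^ 3 * s / 4 ≤ β ^ 3 * n := by
        calc κ ^ 3 * s / 4 = (e * κ) ^ 3 * (s / e ^ 3 / 4) := by field_simp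
          _ ≤ β ^ 3 * n := by gcongr
      have h1 : 8 * Real.pi ^ 3 / (β ^ 3 * n) * Real.exp (-(β ^ 3 / (2 * Real.pi ^ 3)) * n) ≤
          32 * Real.pi ^ 3 / κ ^ 3 * Real.exp (-C₂ * s) := by
        refine mul_le_mul ?_ (Real.exp_le_exp.2 ?_) (by positivity) (by positivity)
        · rw [div_le_div_iff₀ (by positivity) (by positivity)]
          have : κ ^ 3 ≤ 4 * (β ^ 3 * n) := by nlinarith [pow_pos hκ0 3]
          nlinarith [pow_pos hpi 3]
        · have h2 : C₂ * s ≤ κ ^ 3 / (8 * Real.pi ^ 3) * s := by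
            gcongr
            exact min_le_left _ _
          have h3 : κ ^ 3 / (8 * Real.pi ^ 3) * s ≤ β ^ 3 / (2 * Real.pi ^ 3) * n := by
            calc κ ^ 3 / (8 * Real.pi ^ 3) * s = κ ^ 3 * s / 4 / (2 * Real.pi ^ 3) := by
                  field_simp
                  ring
              _ ≤ β ^ 3 * n / (2 * Real.pi ^ 3) := by gcongr
              _ = _ := by ring
          linarith
      have h2 : Real.exp (2 * n - τ * (2 * Real.pi * N) * (1 - Real.exp (-1))) ≤
          Real.exp 2 * Real.exp (-C₂ * s) := by
        rw [← Real.exp_add, Real.exp_le_exp, hρ]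
        have h3 : Real.exp (-1) ≤ 1 / 2 := by
          rw [Real.exp_neg, ← one_div]
          have := Real.add_one_le_exp (1 : ℝ)
          apply one_div_le_one_div_of_le <;> linarith
        have h4 : C₂ * s ≤ s / Λ ^ 3 := by
          calc C₂ * s ≤ 1 / Λ ^ 3 * s := by
                gcongr
                exact min_le_right _ _
            _ = _ := by ring
        have h5 : 0 < s / e ^ 3 := by positivity
        have h6 : 2 * Real.pi * (s / e ^ 3) * (1 / 2) ≤
            2 * Real.pi * (s / e ^ 3) * (1 - Real.exp (-1)) := by
          apply mul_le_mul_of_nonneg_left _ (by positivity)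
          linarith
        nlinarith [Real.pi_gt_three]
      have h3 : 0 ≤ Real.exp C₂ * Real.exp (-C₂ * s) := by positivity
      linarith
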